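/- Let $n$ be an even positive integer. A welded tree of height $n$ consists of two balanced binary trees of height $n$, with roots $s$ and $t$, whose $2^n+2^n$ leaves are joined by a cycle alternating between the leaves of the two trees. The random graph $G$ is built as follows. Take disjoint welded trees $W^1,\dots,W^n$ of height $n$, where $W^i$ has roots $s_i,t_i$ and its alternating cycle is uniformly random. For each $1\le i\le n$ and $1\le k\le i+1$ add a new edge $\{m^i_k,n^i_k\}$ and the edge $\{t_i,m^i_k\}$ (so $t_i$ has degree $i+3$). Take a path graph $p_1,\dots,p_n$ and add the edges $\{p_i,s_i\}$ for $1\le i\le n$. Finally add a uniformly random cycle through all the vertices $n^i_k$. Put $x=p_1$, $y=p_n$. Suppose that $2^{2n}$ is at least the number of vertices of $G$, and let $a\ne b$ be in $\{0,1\}^{2n}$ (for instance $a=0^{2n}$, $b=1^{2n}$). The vertices of $G$ are given distinct names in $\{0,1\}^{2n}$, uniformly at random subject to $x$ having name $a$ and $y$ having name $b$; the cycles and the naming are chosen independently. The adjacency list oracle $O$, queried at $u\in\{0,1\}^{2n}$, returns the set of the names of the neighbours of the vertex named $u$, or $\perp$ if no vertex has the name $u$. Let $\mathcal R$ be any classical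 randomized adaptive algorithm that knows $n,a,b$ and makes at most $2^{n/6}$ queries to $O$. Then: 1. the probability that $\mathcal R$ outputs the names of the consecutive vertices of an $x$-$y$ path of $G$ is at most $2(n+1)\cdot 4\cdot 2^{-n/6}$; 2. call a vertex visited if it is $x$ or $y$ or its name occurred as a query or in an answer of the oracle; the probability that the visited vertices include $p_{n/2}$, or a vertex of degree at least $4$ in $G$, or all the vertices of a cycle of $G$, is at most $2(n+1)\cdot 4\cdot 2^{-n/6}$. Both probabilities are over the random graph, the random naming and the randomness of $\mathcal R$. -/

import Mathlib

open scoped ENNReal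

namespace WeldedPath

/-- Nodes of the balanced binary tree of height `n` in heap order: the root is `1`, the children of
`h` are `2 * h` and `2 * h + 1`, and the leaves are `2 ^ n, …, 2 ^ (n + 1) - 1`. -/
abbrev Node (n : ℕ) : Type := {h : ℕ // h ∈ Finset.Ico 1 (2 ^ (n + 1))}

/-- The root of the tree. -/
def Node.root (n : ℕ) : Node n :=
  ⟨1, Finset.mem_Ico.2 ⟨le_rfl, Nat.one_lt_two_pow (Nat.succ_ne_zero n)⟩⟩

/-- The `j`-th leaf of the tree. -/
def Node.leaf {n : ℕ} (j : Fin (2 ^ n)) : Node n :=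
  ⟨2 ^ n + j, by
    have h1 := j.isLt
    have h2 := Nat.one_le_two_pow (n := n)
    have h3 : 2 ^ (n + 1) = 2 ^ n + 2 ^ n := by ring
    exact Finset.mem_Ico.2 ⟨by omega, by omega⟩⟩

/-- Indices of the edges hung on the roots `t_i`. With `i` counted from `0`, the root `t_i`
receives `i + 2` of them (that is `i + 1` of them when `i` is counted from `1`). -/
abbrev Spoke (n : ℕ) : Type := (i : Fin n) × Fin ((i : ℕ) + 2)

/-- Vertices of the welded tree path graph. -/
inductive Vertex (n : ℕ) : Type
  /-- the vertices of the path graph -/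
  | path (i : Fin n)
  /-- the nodes of the binary tree of the `i`-th welded tree with root `s_i` -/
  | left (i : Fin n) (h : Node n)
  /-- the nodes of the binary tree of the `i`-th welded tree with root `t_i` -/
  | right (i : Fin n) (h : Node n)
  /-- the endpoint of a hung edge that is joined to `t_i` -/
  | inner (e : Spoke n)
  /-- the other endpoint of a hung edge -/
  | outer (e : Spoke n)
  deriving DecidableEq, Fintype

/-- The starting vertex: the first vertex of the path graph. -/
def start (n : ℕ) [NeZero n] : Vertex n := .path ⟨0, NeZero.pos n⟩

/-- The ending vertex: the last vertex of the path graph. -/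
def finish (n : ℕ) [NeZero n] : Vertex n :=
  .path ⟨n - 1, by have := NeZero.pos n; omega⟩

/-- The vertex number `n / 2` of the path graph, the first vertex being number `1`. -/
def middle (n : ℕ) [NeZero n] : Vertex n :=
  .path ⟨n / 2 - 1, by have := NeZero.pos n; omega⟩

/-- Names of vertices: bit strings of length `2 n`. -/
abbrev Name (n : ℕ) : Type := Fin (2 * n) → Bool

/-- The edges of the welded tree path graph, each in one direction.
The cycle of the `i`-th welded tree visits the leaves in the cyclic order
`σ i 0, τ i 0, σ i 1, τ i 1, …, σ i (2 ^ n - 1), τ i (2 ^ n - 1)`,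
where `σ i` lists the leaves of the tree of `s_i` and `τ i` those of the tree of `t_i`.
The top cycle visits the outer endpoints of the hung edges in the cyclic order `ρ 0, ρ 1, …`. -/
inductive Edge {n : ℕ} (σ τ : Fin n → Equiv.Perm (Fin (2 ^ n)))
    (ρ : Fin (Fintype.card (Spoke n)) ≃ Spoke n) : Vertex n → Vertex n → Prop
  | treeLeft (i : Fin n) (h h' : Node n) (hh : (h : ℕ) = h' / 2) :
      Edge σ τ ρ (.left i h) (.left i h')
  | treeRight (i : Fin n) (h h' : Node n) (hh : (h : ℕ) = h' / 2) :
      Edge σ τ ρ (.right i h) (.right i h')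
  | weld (i : Fin n) (j : Fin (2 ^ n)) :
      Edge σ τ ρ (.left i (.leaf (σ i j))) (.right i (.leaf (τ i j)))
  | weldNext (i : Fin n) (j : Fin (2 ^ n)) :
      Edge σ τ ρ (.right i (.leaf (τ i j))) (.left i (.leaf (σ i (finRotate (2 ^ n) j))))
  | path (i j : Fin n) (hij : (j : ℕ) = i + 1) : Edge σ τ ρ (.path i) (.path j)
  | hook (i : Fin n) : Edge σ τ ρ (.path i) (.left i (.root n))
  | spoke (e : Spoke n) : Edge σ τ ρ (.right e.1 (.root n)) (.inner e)
  | hung (e : Spoke n) : Edge σ τ ρ (.inner e) (.outer e)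
  | top (j : Fin (Fintype.card (Spoke n))) :
      Edge σ τ ρ (.outer (ρ j)) (.outer (ρ (finRotate _ j)))

/-- An outcome of the random choices: the cycles welding the trees, the top cycle, and the names of
the vertices, where the starting and ending vertex have the names `a` and `b`.
A uniformly random cyclic listing gives a uniformly random cycle, so the uniform distribution on this
type makes all the cycles and the naming independent and uniform. -/
structure Instance (n : ℕ) [NeZero n] (a b : Name n) : Type where
  weldLeft : Fin n → Equiv.Perm (Fin (2 ^ n))
  weldRight : Fin n → Equiv.Perm (Fin (2 ^ n))
  top : Fin (Fintype.card (Spoke n)) ≃ Spoke n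
  name : Vertex n ↪ Name n
  name_start : name (start n) = a
  name_finish : name (finish n) = b

instance Instance.finite (n : ℕ) [NeZero n] (a b : Name n) : Finite (Instance n a b) :=
  Finite.of_injective
    (fun I : Instance n a b => (I.weldLeft, I.weldRight, I.top, I.name)) (by
      rintro ⟨_, _, _, _, _, _⟩ ⟨_, _, _, _, _, _⟩ h
      simp only [Prod.mk.injEq] at h
      obtain ⟨rfl, rfl, rfl, rfl⟩ := h
      rfl)

namespace Instance

variable {n : ℕ} [NeZero n] {a b : Name n}

/-- The welded tree path graph. -/
def graph (I : Instance n a b) : SimpleGraph (Vertex n) :=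
  SimpleGraph.fromRel (Edge I.weldLeft I.weldRight I.top)

open Classical in
/-- The adjacency list oracle: the set of the names of the neighbours of the vertex named `u`, and
`none` if `u` names no vertex. -/
noncomputable def oracle (I : Instance n a b) (u : Name n) : Option (Finset (Name n)) :=
  if ∃ v, I.name v = u then
    some (Finset.univ.filter fun w => ∃ v v', I.name v = u ∧ I.name v' = w ∧ I.graph.Adj v v')
  else none

end Instance

/-- Deterministic adaptive query algorithms: either stop and output a list of names, or query the
oracle at a name and continue according to the answer. -/
inductive QueryTree (n : ℕ) : Type
  | output (l : List (Name n))
  | query (q : Name n) (next : Option (Finset (Name n)) → QueryTree n)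

namespace QueryTree

variable {n : ℕ}

/-- The output when the queries are answered by `O`. -/
def run (O : Name n → Option (Finset (Name n))) : QueryTree n → List (Name n)
  | output l => l
  | query q next => (next (O q)).run O

/-- The number of queries made when the queries are answered by `O`. -/
def queryCount (O : Name n → Option (Finset (Name n))) : QueryTree n → ℕ
  | output _ => 0
  | query q next => (next (O q)).queryCount O + 1

/-- The names that occur as a query or in an answer when the queries are answered by `O`. -/
def seen (O : Name n → Option (Finset (Name n))) : QueryTree n → Set (Name n)
  | output _ => ∅
  | query q next => {q} ∪ ((O q).getD ∅ : Finset (Name n)) ∪ (next (O q)).seen O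

end QueryTree

namespace Instance

variable {n : ℕ} [NeZero n] {a b : Name n}

/-- The output is the list of the names of the consecutive vertices of a path from the starting to
the ending vertex. -/
def OutputsPath (I : Instance n a b) (A : QueryTree n) : Prop :=
  ∃ w : I.graph.Walk (start n) (finish n),
    w.IsPath ∧ A.run I.oracle = w.support.map I.name

/-- The vertices known to the algorithm at the end: the two given ones, and those whose names
occurred as a query or in an answer. -/
def visited (I : Instance n a b) (A : QueryTree n) : Set (Vertex n) :=
  {v | I.name v = a ∨ I.name v = b ∨ I.name v ∈ A.seen I.oracle}

/-- The visited vertices include the middle vertex of the path graph, or a vertex of degree at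
least `4`, or all vertices of a cycle of the graph. -/
def Finds (I : Instance n a b) (A : QueryTree n) : Prop :=
  middle n ∈ I.visited A ∨
  (∃ v ∈ I.visited A, 4 ≤ (I.graph.neighborSet v).ncard) ∨
  ∃ (v : Vertex n) (c : I.graph.Walk v v), c.IsCycle ∧ ∀ u ∈ c.support, u ∈ I.visited A

end Instance

/-- The probability of the event `E` when the deterministic algorithm is drawn from `R` (a randomized
algorithm) and, independently, the instance is drawn uniformly. -/
noncomputable def prob {n : ℕ} [NeZero n] {a b : Name n} (R : PMF (QueryTree n))
    (E : Instance n a b → QueryTree n → Prop) : ℝ≥0∞ :=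
  ∑' A, R A * ((Nat.card {I : Instance n a b // E I A} : ℝ≥0∞) / Nat.card (Instance n a b))

end WeldedPath

/-!
Apart from the two ends, every vertex that the algorithm is likely to visit has degree `3`, so
exploring the graph from the ends looks like exploring two infinite binary trees. The whole proof
compares the two.

**Addresses.** The vertices of the two binary trees get addresses: `2` and `3` are the two ends,
and `2 * h`, `2 * h + 1` are the two new neighbours seen when the vertex with address `h` is
explored. A `Welding` `π` (the alternating cycles) and a set `c` of addresses at which the two new
neighbours are exchanged place every address in the graph, by a walk that never turns back (`loc`,
`Loc.step`). If the places are pairwise different and have only the neighbours with addresses (`Embeds`),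
the explored part is a forest in which the two ends are not connected and no vertex has degree
above `3`, so it contains no cycle, no path between the ends, and, as walks along the path graph
are short, not the middle vertex. A vertex at the end of the forest is harmless too because the
placement is required one generation further.

**The placement succeeds with high probability** (`card_good`), with `m = n / 2` and `t` addresses:
* For fixed `π`, walking `m - 1` steps along the path graph, or up in a tree from a leaf, needs the
  right choice at each step, and the choices are made by `c`: probability at most `t / 2 ^ (m - 1)`
  (`card_luck_mul_le`). Hence neither the middle vertex nor, from below, the upper half of a tree
  is reached. In particular no root `t_i` is reached, and a walk that enters a tree at a leaf stays
  in the subtree of height `m`, the block, of this leaf.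
* For fixed `c` consider two walks that enter the same block, one of them from the alternating
  cycle. The leaf at which a walk along an alternating cycle arrives is nearly uniform among the
  leaves not seen before, and a block has `2 ^ m` of the `2 ^ n` leaves. In place of conditional
  probabilities the leaf is exchanged with any unseen one (`Switch`) and the pairs of weldings
  related in this way are counted from both sides (`card_switch`). The leaf is really new unless
  the cycle was entered before at a near position (`PosClash`), an event treated in the same way.
  Summing over the pairs of addresses with a first clash gives `card_exists_blockClash`.

Without such events different addresses have different places (`eq_of_vert_eq`): two walks with the
same end have the same last step, unless they have entered the same block separately.

**Adaptive queries.** A state of the algorithm consists of the set `Q` of explored addresses, the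
names `z` of the known ones and the set `F` of names that turned out to be unused. For each state
the instances that agree with it and have a good placement are nearly as many as the choices of
a welding, a top cycle, an exchange `c ⊆ Q` and a naming (`card_nice`); the exchanges count because an answer is
an unordered set. A query at a known name leads to one state for each pair of unused names, and a
query at an unknown name is taken to fail. An induction over the query tree from its outputs shows
that the algorithm fails on all but a small proportion of the instances (`le_card_failing`). No
union bound over the queries is needed: badness is paid for once, at the outputs. Guessing names
costs a factor close to `1`, computed with falling factorials (`mul_namings_le`).

With `Y = 2 ^ (n / 6)` the proportion of the remaining instances is at most `102 / Y`
(`card_success_le`), which is below `8 * (n + 1) / Y` as soon as the latter is at most `1`. A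
randomized algorithm is an average of deterministic ones (`prob_le`).
-/

namespace WeldedPath

/-! ### Walking through the graph by bits -/

namespace Node

variable {n : ℕ}

theorem one_le (h : Node n) : 1 ≤ (h : ℕ) := (Finset.mem_Ico.1 h.2).1

theorem lt_two_pow (h : Node n) : (h : ℕ) < 2 ^ (n + 1) := (Finset.mem_Ico.1 h.2).2

/-- The parent of a node; the root is its own parent. -/
def par (h : Node n) : Node n :=
  ⟨max 1 (h / 2), by
    have := h.one_le; have := h.lt_two_pow
    exact Finset.mem_Ico.2 ⟨by omega, by omega⟩⟩

/-- The sibling of a node; the root is its own sibling. -/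
def sib (h : Node n) : Node n :=
  ⟨if (h : ℕ) = 1 then 1 else if (h : ℕ) % 2 = 0 then h + 1 else h - 1, by
    have := h.one_le; have := h.lt_two_pow
    have h3 : 2 ^ (n + 1) = 2 * 2 ^ n := by ring
    have := Nat.one_le_two_pow (n := n)
    refine Finset.mem_Ico.2 ⟨?_, ?_⟩ <;> split_ifs <;> omega⟩

/-- The left (`false`) or right (`true`) child of a node, and the root if the node is a leaf. -/
def chd (h : Node n) (b : Bool) : Node n :=
  if hh : 2 * (h : ℕ) + b.toNat < 2 ^ (n + 1) then
    ⟨2 * h + b.toNat, Finset.mem_Ico.2 ⟨by have := h.one_le; omega, hh⟩⟩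
  else root n

/-- The index of a leaf. -/
def idx (h : Node n) : Fin (2 ^ n) := ⟨h % 2 ^ n, Nat.mod_lt _ (by positivity)⟩

theorem coe_root : ((root n : Node n) : ℕ) = 1 := rfl

theorem coe_leaf (j : Fin (2 ^ n)) : ((leaf j : Node n) : ℕ) = 2 ^ n + j := rfl

theorem coe_par (h : Node n) (hh : (h : ℕ) ≠ 1) : (h.par : ℕ) = h / 2 := by
  have := h.one_le
  simp only [par]; omega

theorem coe_sib (h : Node n) (hh : (h : ℕ) ≠ 1) :
    (h.sib : ℕ) = if (h : ℕ) % 2 = 0 then (h : ℕ) + 1 else (h : ℕ) - 1 := by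
  simp only [sib, if_neg hh]

theorem coe_chd (h : Node n) (hh : (h : ℕ) < 2 ^ n) (b : Bool) :
    (h.chd b : ℕ) = 2 * h + b.toNat := by
  have h3 : 2 ^ (n + 1) = 2 * 2 ^ n := by ring
  have : b.toNat ≤ 1 := Bool.toNat_le b
  rw [chd, dif_pos (by omega)]

theorem leaf_injective : Function.Injective (leaf : Fin (2 ^ n) → Node n) := by
  intro j j' h
  have := congrArg Subtype.val h
  simp only [coe_leaf] at this
  exact Fin.ext (by omega)

theorem leaf_idx (h : Node n) (hh : 2 ^ n ≤ (h : ℕ)) : leaf h.idx = h := by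
  have h1 := h.lt_two_pow
  have h3 : 2 ^ (n + 1) = 2 * 2 ^ n := by ring
  apply Subtype.ext
  rw [coe_leaf]
  simp only [idx]
  rw [Nat.mod_eq_sub_mod hh, Nat.mod_eq_of_lt (by omega)]
  omega

theorem idx_leaf (j : Fin (2 ^ n)) : (leaf j : Node n).idx = j := by
  apply leaf_injective
  rw [leaf_idx]
  rw [coe_leaf]; omega

theorem log_le (h : Node n) : Nat.log 2 h ≤ n :=
  Nat.lt_succ_iff.1 (Nat.log_lt_of_lt_pow (by have := h.one_le; omega) h.lt_two_pow)

theorem log_par (h : Node n) (hh : (h : ℕ) ≠ 1) : Nat.log 2 h.par = Nat.log 2 h - 1 := by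
  rw [coe_par h hh, Nat.log_div_base]

theorem log_leaf (j : Fin (2 ^ n)) : Nat.log 2 ((leaf j : Node n) : ℕ) = n := by
  have := j.2
  rw [coe_leaf]
  exact Nat.log_eq_of_pow_le_of_lt_pow (by omega) (by rw [pow_succ]; omega)

end Node

/-- The bijections between the leaves and the positions on the alternating cycles: `false` stands
for the trees of the `s_i`, `true` for those of the `t_i`. -/
abbrev Welding (n : ℕ) : Type := Bool → Fin n → Equiv.Perm (Fin (2 ^ n))

/-- A step of a walk in the welded tree path graph, that is, a vertex with the direction from which
it was entered:
* `path dir i`: the vertex `p_i`, entered along the path graph, upwards if `dir`;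
* `desc i h`: the node `h` of the tree of `s_i`, entered on the way down from `s_i`;
* `cyc side i j dir`: position `j` of one side of the `i`-th alternating cycle, entered along the
  cycle, forwards if `dir`;
* `up side i w`: the parent of the node `w`, entered from `w`;
* `down side i h`: the node `h`, entered from its parent after an earlier step up. -/
inductive Loc (n : ℕ) : Type
  | path (dir : Bool) (i : Fin n)
  | desc (i : Fin n) (h : Node n)
  | cyc (side : Bool) (i : Fin n) (j : Fin (2 ^ n)) (dir : Bool)
  | up (side : Bool) (i : Fin n) (w : Node n)
  | down (side : Bool) (i : Fin n) (h : Node n)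

/-- The positions on an alternating cycle are numbered separately on its two sides; this takes a
position on a given side to the next one (`dir = true`) or the previous one on the other side. -/
def nxt {n : ℕ} (side dir : Bool) : Equiv.Perm (Fin (2 ^ n)) :=
  match side, dir with
  | false, true => Equiv.refl _
  | false, false => (finRotate _).symm
  | true, true => finRotate _
  | true, false => Equiv.refl _

/-- The nodes of the two trees of the `i`-th welded tree. -/
def treeVertex {n : ℕ} (side : Bool) (i : Fin n) (h : Node n) : Vertex n :=
  if side then .right i h else .left i h

namespace Loc

variable {n : ℕ} (π : Welding n)

/-- A step of a walk that does not turn back: the bit says which of the two other neighbours is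
visited next. Where a vertex does not have exactly two other neighbours the value is irrelevant. -/
def step : Loc n → Bool → Loc n
  | path true i, true => if h : (i : ℕ) + 1 < n then path true ⟨i + 1, h⟩ else desc i (.root n)
  | path false i, true =>
    if 1 ≤ (i : ℕ) then path false ⟨i - 1, by have := i.2; omega⟩ else desc i (.root n)
  | path _ i, false => desc i (.root n)
  | desc i h, b =>
    if (h : ℕ) < 2 ^ n then desc i (h.chd b)
    else cyc true i (nxt false b ((π false i).symm h.idx)) b
  | cyc s i j d, false => cyc (!s) i (nxt s d j) d
  | cyc s i j _, true => up s i (.leaf (π s i j))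
  | up s i w, true => up s i w.par
  | up s i w, false => down s i w.sib
  | down s i h, b =>
    if (h : ℕ) < 2 ^ n then down s i (h.chd b)
    else cyc (!s) i (nxt s b ((π s i).symm h.idx)) b

/-- The vertex reached. -/
def vert : Loc n → Vertex n
  | path _ i => .path i
  | desc i h => .left i h
  | cyc s i j _ => treeVertex s i (.leaf (π s i j))
  | up s i w => treeVertex s i w.par
  | down s i h => treeVertex s i h

/-- The vertex from which the present one was entered. -/
def prev : Loc n → Vertex n
  | path true i => .path ⟨i - 1, by have := i.2; omega⟩
  | path false i => .path ⟨min (i + 1) (n - 1), by have := i.2; omega⟩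
  | desc i h => if (h : ℕ) = 1 then .path i else .left i h.par
  | cyc s i j d => treeVertex (!s) i (.leaf (π (!s) i ((nxt (!s) d).symm j)))
  | up s i w => treeVertex s i w
  | down s i h => treeVertex s i h.par

/-- The number of consecutive favourable steps made last: steps along the path graph away from the
end where the walk began, or steps up in a tree, starting at a leaf. -/
def luck : Loc n → ℕ
  | path true i => i
  | path false i => n - 1 - i
  | up _ _ w => n + 1 - Nat.log 2 w
  | _ => 0

theorem luck_step_le (l : Loc n) (b : Bool) : (l.step π b).luck ≤ l.luck + 1 := by
  rcases l with ⟨_ | _, i⟩ | ⟨i, h⟩ | ⟨s, i, j, d⟩ | ⟨s, i, w⟩ | ⟨s, i, h⟩ <;> cases b <;>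
    simp only [step] <;> (try split_ifs) <;>
    simp only [luck, zero_le, le_refl, Node.log_leaf]
  · have := i.2
    omega
  · omega
  · by_cases hw : (w : ℕ) = 1
    · have : w.par = w := Subtype.ext (by simp [Node.par, hw])
      rw [this]; omega
    · rw [Node.log_par w hw]; omega

/-- At most one of the two possible steps is favourable. -/
theorem luck_step_eq_zero (l : Loc n) : (l.step π false).luck = 0 := by
  rcases l with ⟨_ | _, i⟩ | ⟨i, h⟩ | ⟨s, i, j, d⟩ | ⟨s, i, w⟩ | ⟨s, i, h⟩ <;>
    simp only [step] <;> (try split_ifs) <;> simp only [luck]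

end Loc

/-! ### Walks along a binary tree of addresses -/

section Walk

variable {n : ℕ} [NeZero n] (π : Welding n)

/-- Addresses are natural numbers `h ≥ 2`. The addresses `2` and `3` belong to the starting and the
ending vertex, and `2 * h`, `2 * h + 1` to the two vertices that become known when the vertex with
address `h` is explored. This is the place of the address `h`, when for the addresses in `c` the two
possible steps are exchanged. -/
def loc (c : Finset ℕ) (h : ℕ) : Loc n :=
  if _hh : h < 4 then
    if h = 3 then .path false ⟨n - 1, by have := NeZero.pos n; omega⟩
    else .path true ⟨0, NeZero.pos n⟩
  else (loc c (h / 2)).step π (decide (h % 2 = 1) ^^ decide (h / 2 ∈ c))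
termination_by h

theorem loc_of_four_le (c : Finset ℕ) {h : ℕ} (hh : 4 ≤ h) :
    loc π c h = (loc π c (h / 2)).step π (decide (h % 2 = 1) ^^ decide (h / 2 ∈ c)) := by
  rw [loc, dif_neg (by omega)]

theorem loc_two (c : Finset ℕ) : loc π c 2 = .path true ⟨0, NeZero.pos n⟩ := by
  rw [loc]; simp

theorem loc_three (c : Finset ℕ) :
    loc π c 3 = .path false ⟨n - 1, by have := NeZero.pos n; omega⟩ := by
  rw [loc]; simp

theorem loc_congr {c c' : Finset ℕ} {h : ℕ} (hc : ∀ g < h, g ∈ c ↔ g ∈ c') :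
    loc π c h = loc π c' h := by
  induction h using Nat.strong_induction_on with
  | _ h ih =>
    by_cases hh : h < 4
    · rw [loc, dif_pos hh, loc, dif_pos hh]
    · rw [loc_of_four_le π c (by omega), loc_of_four_le π c' (by omega),
        ih (h / 2) (by omega) fun g hg => hc g (by omega)]
      simp only [hc (h / 2) (by omega)]

theorem loc_two_mul (c : Finset ℕ) {h : ℕ} (hh : 2 ≤ h) (b : Bool) :
    loc π c (2 * h + b.toNat) = (loc π c h).step π (b ^^ decide (h ∈ c)) := by
  have hb : b.toNat ≤ 1 := Bool.toNat_le b
  rw [loc_of_four_le π c (by omega), show (2 * h + b.toNat) / 2 = h by omega]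
  congr 2
  cases b <;> simp [Nat.add_mod]

/-- The addresses known after the exploration of `Q`. -/
def known (Q : Finset ℕ) : Finset ℕ :=
  {2, 3} ∪ (Q.image (2 * ·) ∪ Q.image (2 * · + 1))

theorem mem_known {Q : Finset ℕ} {h : ℕ} : h ∈ known Q ↔ h = 2 ∨ h = 3 ∨ h / 2 ∈ Q := by
  simp only [known, Finset.mem_union, Finset.mem_insert, Finset.mem_singleton, Finset.mem_image]
  constructor
  · rintro ((h | h) | ⟨g, hg, rfl⟩ | ⟨g, hg, rfl⟩)
    · exact .inl h
    · exact .inr (.inl h)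
    · exact .inr (.inr (by rwa [Nat.mul_div_cancel_left _ (by omega)]))
    · exact .inr (.inr (by rwa [show (2 * g + 1) / 2 = g by omega]))
  · rintro (h | h | hq)
    · exact .inl (.inl h)
    · exact .inl (.inr h)
    · rcases Nat.mod_two_eq_zero_or_one h with h0 | h0
      · exact .inr (.inl ⟨_, hq, by omega⟩)
      · exact .inr (.inr ⟨_, hq, by omega⟩)

/-- A set of addresses that can have been explored: an address is explored only when it is known. -/
def Closed (Q : Finset ℕ) : Prop := ∀ h ∈ Q, 2 ≤ h ∧ (4 ≤ h → h / 2 ∈ Q)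

theorem Closed.four_le {Q : Finset ℕ} (hQ : Closed Q) {h : ℕ} (hh : h ∈ known Q)
    (h2 : h ≠ 2) (h3 : h ≠ 3) : 4 ≤ h ∧ h / 2 ∈ Q := by
  rcases mem_known.1 hh with h | h | h
  · exact absurd h h2
  · exact absurd h h3
  · exact ⟨by have := (hQ _ h).1; omega, h⟩

theorem Closed.subset_known {Q : Finset ℕ} (hQ : Closed Q) : Q ⊆ known Q := fun h hh => by
  have h1 := hQ h hh
  rw [mem_known]
  by_cases h4 : 4 ≤ h
  · exact .inr (.inr (h1.2 h4))
  · omega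

theorem Closed.closed_known {Q : Finset ℕ} (hQ : Closed Q) : Closed (known Q) := fun h hh => by
  rcases mem_known.1 hh with rfl | rfl | h1
  · exact ⟨le_rfl, by omega⟩
  · exact ⟨by omega, by omega⟩
  · exact ⟨by have := (hQ _ h1).1; omega, fun _ => hQ.subset_known h1⟩

theorem Closed.card_known {Q : Finset ℕ} (hQ : Closed Q) : (known Q).card = 2 + 2 * Q.card := by
  have e : (known Q) = ({2, 3} : Finset ℕ) ∪ (Q.image (2 * ·) ∪ Q.image (2 * · + 1)) := rfl
  rw [e, Finset.card_union_of_disjoint, Finset.card_union_of_disjoint,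
    Finset.card_image_of_injective _ fun a b h => by simpa using h,
    Finset.card_image_of_injective _ fun a b h => by simpa using h]
  · have : ({2, 3} : Finset ℕ).card = 2 := rfl
    omega
  · rw [Finset.disjoint_left]
    rintro x hx hy
    simp only [Finset.mem_image] at hx hy
    omega
  · rw [Finset.disjoint_left]
    rintro x hx hy
    simp only [Finset.mem_image, Finset.mem_union, Finset.mem_insert,
      Finset.mem_singleton] at hx hy
    rcases hy with ⟨g, hg, h⟩ | ⟨g, hg, h⟩ <;> have := (hQ g hg).1 <;> omega

/-- The place of an address only depends on the exchanges at the explored addresses. -/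
theorem loc_inter {Q : Finset ℕ} (hQ : Closed Q) (c : Finset ℕ) {h : ℕ} (hh : h ∈ known Q) :
    loc π (c ∩ Q) h = loc π c h := by
  induction h using Nat.strong_induction_on with
  | _ h ih =>
    by_cases h4 : h < 4
    · rw [loc, dif_pos h4, loc, dif_pos h4]
    · have hq := (hQ.four_le hh (by omega) (by omega)).2
      rw [loc_of_four_le π (c ∩ Q) (by omega), loc_of_four_le π c (by omega),
        ih (h / 2) (by omega) (hQ.subset_known hq)]
      simp only [Finset.mem_inter, hq, and_true]

/-- A long run of favourable steps is unlikely: the exchange at the parent of an address turns a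
favourable last step into an unfavourable one. -/
theorem card_luck_mul_le {Q : Finset ℕ} (hQ : Closed Q) (k : ℕ) {h : ℕ} (hh : h ∈ known Q) :
    (Q.powerset.filter fun c => k ≤ (loc π c h).luck).card * 2 ^ k ≤ 2 ^ Q.card := by
  induction k generalizing h with
  | zero => simp
  | succ k ih =>
    by_cases h4 : h < 4
    · have : (Q.powerset.filter fun c => k + 1 ≤ (loc π c h).luck) = ∅ := by
        rw [Finset.filter_eq_empty_iff]
        intro c _
        rw [loc, dif_pos h4]
        split_ifs <;> simp [Loc.luck]
      rw [this]; simp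
    · obtain ⟨-, hq⟩ := hQ.four_le hh (by omega) (by omega)
      refine le_trans ?_ (ih (hQ.subset_known hq))
      rw [pow_succ', ← mul_assoc]
      refine Nat.mul_le_mul_right _ ?_
      set g := h / 2 with hg
      set A := Q.powerset.filter fun c => k + 1 ≤ (loc π c h).luck with hA
      have hl : ∀ c, loc π (symmDiff c {g}) g = loc π c g := fun c =>
        loc_congr π fun x hx => by simp [Finset.mem_symmDiff, hx.ne]
      have hbit : ∀ c ∈ A, (decide (h % 2 = 1) ^^ decide (g ∈ c)) = true := by
        intro c hc
        by_contra hb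
        rw [Bool.not_eq_true] at hb
        have := (Finset.mem_filter.1 hc).2
        rw [loc_of_four_le π c (by omega), ← hg, hb, Loc.luck_step_eq_zero] at this
        omega
      have hdisj : Disjoint A (A.image fun c => symmDiff c {g}) := by
        rw [Finset.disjoint_left]
        rintro c hc hc'
        obtain ⟨c', hc2, rfl⟩ := Finset.mem_image.1 hc'
        have h1 := hbit _ hc
        have h2 := hbit _ hc2
        have h3 : g ∈ symmDiff c' {g} ↔ g ∉ c' := by simp [Finset.mem_symmDiff]
        simp only [h3] at h1
        by_cases hgc : g ∈ c' <;> simp_all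
      have hinj : Function.Injective fun c : Finset ℕ => symmDiff c {g} :=
        symmDiff_left_injective _
      rw [mul_two]
      nth_rewrite 2 [← Finset.card_image_of_injective A hinj]
      rw [← Finset.card_union_of_disjoint hdisj]
      refine Finset.card_le_card ?_
      have hmem : ∀ c ∈ A, c ⊆ Q ∧ k ≤ (loc π c g).luck := by
        intro c hc
        have hc' := Finset.mem_filter.1 hc
        refine ⟨Finset.mem_powerset.1 hc'.1, ?_⟩
        have := Loc.luck_step_le π (loc π c g) (decide (h % 2 = 1) ^^ decide (g ∈ c))
        have h5 := hc'.2
        rw [loc_of_four_le π c (by omega), ← hg] at h5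
        omega
      intro c hc
      rw [Finset.mem_filter, Finset.mem_powerset]
      rcases Finset.mem_union.1 hc with hc | hc
      · exact hmem c hc
      · obtain ⟨c, hc2, rfl⟩ := Finset.mem_image.1 hc
        refine ⟨?_, by rw [hl]; exact (hmem c hc2).2⟩
        intro x hx
        rcases Finset.mem_symmDiff.1 hx with h | h
        · exact (hmem c hc2).1 h.1
        · rw [Finset.mem_singleton.1 h.1]; exact hq

end Walk

/-! ### Neighbours in the welded tree path graph -/

section Places

variable {n : ℕ} {π : Welding n}

theorem treeVertex_inj {s s' : Bool} {i i' : Fin n} {h h' : Node n} :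
    treeVertex s i h = treeVertex s' i' h' ↔ s = s' ∧ i = i' ∧ h = h' := by
  cases s <;> cases s' <;> simp [treeVertex]

theorem treeVertex_ne_path {s : Bool} {i j : Fin n} {h : Node n} :
    treeVertex s i h ≠ .path j := by
  cases s <;> simp [treeVertex]

/-- The two positions next to a position are different. -/
theorem nxt_ne (hn : 1 ≤ n) (s : Bool) (j : Fin (2 ^ n)) :
    (nxt s true j : Fin (2 ^ n)) ≠ nxt s false j := by
  have h2 : 2 ≤ 2 ^ n := by
    calc 2 = 2 ^ 1 := rfl
      _ ≤ 2 ^ n := Nat.pow_le_pow_right (by norm_num) hn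
  have hrot : ∀ k : Fin (2 ^ n), finRotate (2 ^ n) k ≠ k := by
    intro k hk
    obtain ⟨N, hN⟩ : ∃ N, 2 ^ n = N + 1 := ⟨2 ^ n - 1, by omega⟩
    revert k
    rw [hN]
    intro k hk
    have := congrArg Fin.val hk
    rw [coe_finRotate] at this
    split_ifs at this with h
    · rw [h] at this; simp at this; omega
    · omega
  cases s
  · simp only [nxt, Equiv.refl_apply, ne_eq]
    intro h
    apply hrot j
    conv_lhs => rw [h]
    simp
  · simpa [nxt] using hrot j

theorem Loc.step_desc_leaf (i : Fin n) (j : Fin (2 ^ n)) (d : Bool) :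
    (Loc.desc i (.leaf j)).step π d = .cyc true i (nxt false d ((π false i).symm j)) d := by
  rw [Loc.step, if_neg (by rw [Node.coe_leaf]; omega), Node.idx_leaf]

theorem Loc.step_down_leaf (s : Bool) (i : Fin n) (j : Fin (2 ^ n)) (d : Bool) :
    (Loc.down s i (.leaf j)).step π d = .cyc (!s) i (nxt s d ((π s i).symm j)) d := by
  rw [Loc.step, if_neg (by rw [Node.coe_leaf]; omega), Node.idx_leaf]

theorem Node.eq_leaf (h : Node n) (hh : ¬ (h : ℕ) < 2 ^ n) : ∃ j, h = .leaf j :=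
  ⟨h.idx, (h.leaf_idx (by omega)).symm⟩

/-- Places from which a walk continues regularly, when no run of favourable steps was long. -/
def Loc.Regular : Loc n → Prop
  | .path true i => (i : ℕ) + 1 < n
  | .path false i => 1 ≤ (i : ℕ)
  | .up _ _ w => 4 ≤ (w : ℕ)
  | .down _ _ h => 2 ≤ (h : ℕ)
  | _ => True

theorem Node.chd_inj (h : Node n) (hh : (h : ℕ) < 2 ^ n) {b b' : Bool}
    (e : h.chd b = h.chd b') : b = b' := by
  have := congrArg Subtype.val e
  rw [h.coe_chd hh, h.coe_chd hh] at this
  cases b <;> cases b' <;> simp_all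

theorem Node.eq_chd {h h' : Node n} (e : (h : ℕ) = h' / 2) :
    h' = h.chd false ∨ h' = h.chd true := by
  have h1 := h'.lt_two_pow
  have h3 : 2 ^ (n + 1) = 2 * 2 ^ n := by ring
  have hlt : (h : ℕ) < 2 ^ n := by omega
  rcases Nat.mod_two_eq_zero_or_one h' with h0 | h0
  · left; apply Subtype.ext; rw [h.coe_chd hlt]; simp; omega
  · right; apply Subtype.ext; rw [h.coe_chd hlt]; simp; omega

theorem Node.par_chd (h : Node n) (hh : (h : ℕ) < 2 ^ n) (b : Bool) : (h.chd b).par = h := by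
  have h1 := h.one_le
  have hb : b.toNat ≤ 1 := Bool.toNat_le b
  apply Subtype.ext
  rw [Node.coe_par _ (by rw [h.coe_chd hh]; omega), h.coe_chd hh]
  omega

theorem Node.coe_chd_ne_one (h : Node n) (hh : (h : ℕ) < 2 ^ n) (b : Bool) :
    (h.chd b : ℕ) ≠ 1 := by
  have h1 := h.one_le
  rw [h.coe_chd hh]
  omega

theorem Node.eq_par {h h' : Node n} (e : (h' : ℕ) = h / 2) : (h : ℕ) ≠ 1 ∧ h' = h.par := by
  have h1 := h'.one_le
  have : (h : ℕ) ≠ 1 := by omega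
  exact ⟨this, Subtype.ext (by rw [h.coe_par this, e])⟩

theorem Node.coe_leaf_ne_one (hn : 1 ≤ n) (j : Fin (2 ^ n)) : ((leaf j : Node n) : ℕ) ≠ 1 := by
  have h2 : 2 ≤ 2 ^ n := by
    calc 2 = 2 ^ 1 := rfl
      _ ≤ 2 ^ n := Nat.pow_le_pow_right (by norm_num) hn
  rw [coe_leaf]
  omega

/-- The two possible steps lead to different vertices. -/
theorem Loc.vert_step_ne (hn : 1 ≤ n) (l : Loc n) (hl : l.Regular) :
    (l.step π true).vert π ≠ (l.step π false).vert π := by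
  have hcyc : ∀ s i j, (Loc.cyc (!s) i (nxt s true j) true : Loc n).vert π ≠
      (Loc.cyc (!s) i (nxt s false j) false).vert π := by
    intro s i j h
    exact nxt_ne hn s j ((π (!s) i).injective (Node.leaf_injective (treeVertex_inj.1 h).2.2))
  rcases l with ⟨_ | _, i⟩ | ⟨i, h⟩ | ⟨s, i, j, d⟩ | ⟨s, i, w⟩ | ⟨s, i, h⟩
  · have hl' : 1 ≤ (i : ℕ) := hl
    simp [step, hl', vert]
  · have hl' : (i : ℕ) + 1 < n := hl
    simp [step, hl', vert]
  · by_cases hh : (h : ℕ) < 2 ^ n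
    · simp only [step, if_pos hh, vert]
      intro e
      simpa using h.chd_inj hh (Vertex.left.inj e).2
    · obtain ⟨j, rfl⟩ := h.eq_leaf hh
      rw [step_desc_leaf, step_desc_leaf]
      exact hcyc false _ _
  · simp only [step, vert]
    intro e
    simpa using (treeVertex_inj.1 e).1
  · have hl' : 4 ≤ (w : ℕ) := hl
    simp only [step, vert]
    intro e
    have := congrArg Subtype.val (treeVertex_inj.1 e).2.2
    rw [w.coe_sib (by omega), Node.coe_par _ (by rw [w.coe_par (by omega)]; omega),
      w.coe_par (by omega)] at this
    split_ifs at this <;> omega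
  · by_cases hh : (h : ℕ) < 2 ^ n
    · simp only [step, if_pos hh, vert]
      intro e
      simpa using h.chd_inj hh (treeVertex_inj.1 e).2.2
    · obtain ⟨j, rfl⟩ := h.eq_leaf hh
      rw [step_down_leaf, step_down_leaf]
      exact hcyc s _ _

/-- A regular step can be traced back. -/
theorem Loc.prev_step (hn : 1 ≤ n) (l : Loc n) (hl : l.Regular) (b : Bool) :
    (l.step π b).prev π = l.vert π := by
  rcases l with ⟨_ | _, i⟩ | ⟨i, h⟩ | ⟨s, i, j, d⟩ | ⟨s, i, w⟩ | ⟨s, i, h⟩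
  · have hl' : 1 ≤ (i : ℕ) := hl
    have := i.2
    cases b
    · simp [step, prev, Node.root, vert]
    · simp only [step, hl', if_pos, prev, vert, Vertex.path.injEq]
      exact Fin.ext (by simp; omega)
  · have hl' : (i : ℕ) + 1 < n := hl
    cases b
    · simp [step, prev, Node.root, vert]
    · simp [step, hl', prev, vert]
  · by_cases hh : (h : ℕ) < 2 ^ n
    · simp only [step, if_pos hh, prev, vert, if_neg (h.coe_chd_ne_one hh b), h.par_chd hh]
    · obtain ⟨j, rfl⟩ := h.eq_leaf hh
      rw [step_desc_leaf]
      simp [prev, vert, treeVertex]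
  · cases b
    · simp [step, prev, vert]
    · simp [step, prev, vert]
  · have hl' : 4 ≤ (w : ℕ) := hl
    cases b
    · simp only [step, prev, vert]
      congr 1
      apply Subtype.ext
      have h2 : (w.sib : ℕ) = if (w : ℕ) % 2 = 0 then (w : ℕ) + 1 else (w : ℕ) - 1 :=
        w.coe_sib (by omega)
      rw [Node.coe_par, Node.coe_par _ (by omega), h2]
      · split_ifs <;> omega
      · rw [h2]; split_ifs <;> omega
    · simp [step, prev, vert]
  · by_cases hh : (h : ℕ) < 2 ^ n
    · simp only [step, if_pos hh, prev, vert, h.par_chd hh]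
    · obtain ⟨j, rfl⟩ := h.eq_leaf hh
      rw [step_down_leaf]
      simp [prev, vert]

theorem Loc.pos_of_step_eq {l : Loc n} {b : Bool} {i : Fin n} (e : l.step π b = .path true i) :
    1 ≤ (i : ℕ) := by
  rcases l with ⟨_ | _, k⟩ | ⟨k, v⟩ | ⟨s, k, j, d⟩ | ⟨s, k, w⟩ | ⟨s, k, v⟩ <;>
    cases b <;> simp only [Loc.step] at e <;> (try split_ifs at e) <;> cases e
  simp

theorem Loc.lt_of_step_eq {l : Loc n} {b : Bool} {i : Fin n} (e : l.step π b = .path false i) :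
    (i : ℕ) + 1 < n := by
  rcases l with ⟨_ | _, k⟩ | ⟨k, v⟩ | ⟨s, k, j, d⟩ | ⟨s, k, w⟩ | ⟨s, k, v⟩ <;>
    cases b <;> simp only [Loc.step] at e <;> (try split_ifs at e) <;> cases e
  have := k.2
  simp only
  omega

end Places

section Graph

variable {n : ℕ} [NeZero n] {a b : Name n}

/-- The bijections between leaves and positions given by the alternating cycles. -/
def Instance.welding (I : Instance n a b) : Welding n :=
  fun s => if s then I.weldRight else I.weldLeft

theorem adj_path_iff (I : Instance n a b) (i : Fin n) (v : Vertex n) :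
    I.graph.Adj (.path i) v ↔
      (∃ j : Fin n, v = .path j ∧ ((j : ℕ) = i + 1 ∨ (i : ℕ) = j + 1)) ∨
        v = treeVertex false i (.root n) := by
  rw [Instance.graph, SimpleGraph.fromRel_adj]
  constructor
  · rintro ⟨-, h | h⟩ <;> cases h
    · exact .inl ⟨_, rfl, .inl ‹_›⟩
    · exact .inr rfl
    · exact .inl ⟨_, rfl, .inr ‹_›⟩
  · rintro (⟨j, rfl, h | h⟩ | rfl)
    · exact ⟨fun e => by rw [Vertex.path.inj e] at h; omega, .inl (.path _ _ h)⟩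
    · exact ⟨fun e => by rw [Vertex.path.inj e] at h; omega, .inr (.path _ _ h)⟩
    · exact ⟨by simp [treeVertex], .inl (.hook i)⟩

theorem adj_treeVertex_iff (I : Instance n a b) (s : Bool) (i : Fin n) (h : Node n)
    (v : Vertex n) :
    I.graph.Adj (treeVertex s i h) v ↔
      (∃ h' : Node n, v = treeVertex s i h' ∧ ((h : ℕ) = h' / 2 ∨ (h' : ℕ) = h / 2)) ∨
      (∃ j d, h = .leaf (I.welding s i j) ∧
        v = treeVertex (!s) i (.leaf (I.welding (!s) i (nxt s d j)))) ∨
      (s = false ∧ h = .root n ∧ v = .path i) ∨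
      (s = true ∧ h = .root n ∧ ∃ e : Spoke n, e.1 = i ∧ v = .inner e) := by
  rw [Instance.graph, SimpleGraph.fromRel_adj]
  have hpos := h.one_le
  constructor
  · cases s
    · rintro ⟨-, h | h⟩ <;> cases h
      · exact .inl ⟨_, rfl, .inl ‹_›⟩
      · exact .inr (.inl ⟨_, true, rfl, rfl⟩)
      · exact .inl ⟨_, rfl, .inr ‹_›⟩
      · refine .inr (.inl ⟨_, false, rfl, ?_⟩)
        simp [treeVertex, Instance.welding, nxt]
      · exact .inr (.inr (.inl ⟨rfl, rfl, rfl⟩))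
    · rintro ⟨-, h | h⟩ <;> cases h
      · exact .inl ⟨_, rfl, .inl ‹_›⟩
      · exact .inr (.inl ⟨_, true, rfl, rfl⟩)
      · exact .inr (.inr (.inr ⟨rfl, rfl, _, rfl, rfl⟩))
      · exact .inl ⟨_, rfl, .inr ‹_›⟩
      · exact .inr (.inl ⟨_, false, rfl, rfl⟩)
  · rintro (⟨h', rfl, hh⟩ | ⟨j, d, rfl, rfl⟩ | ⟨rfl, rfl, rfl⟩ | ⟨rfl, rfl, e, rfl, rfl⟩)
    · have hpos' := h'.one_le
      refine ⟨fun e => ?_, ?_⟩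
      · rw [(treeVertex_inj.1 e).2.2] at hh
        omega
      · cases s
        · exact hh.imp (.treeLeft i h h') (.treeLeft i h' h)
        · exact hh.imp (.treeRight i h h') (.treeRight i h' h)
    · refine ⟨fun e => by simpa using (treeVertex_inj.1 e).1, ?_⟩
      cases s <;> cases d
      · right
        have := Edge.weldNext (σ := I.weldLeft) (τ := I.weldRight) (ρ := I.top) i
          ((finRotate (2 ^ n)).symm j)
        simpa [treeVertex, Instance.welding, nxt] using this
      · exact .inl (.weld i j)
      · exact .inr (.weld i j)
      · exact .inl (.weldNext i j)
    · exact ⟨by simp [treeVertex], .inr (.hook i)⟩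
    · exact ⟨by simp [treeVertex], .inl (.spoke e)⟩

theorem adj_inner_node (I : Instance n a b) (s : Bool) (i : Fin n) (h : Node n)
    (h1 : (h : ℕ) ≠ 1) (h2 : (h : ℕ) < 2 ^ n) (v : Vertex n) :
    I.graph.Adj (treeVertex s i h) v ↔ v = treeVertex s i h.par ∨
      v = treeVertex s i (h.chd false) ∨ v = treeVertex s i (h.chd true) := by
  rw [adj_treeVertex_iff]
  constructor
  · rintro (⟨h', rfl, hh | hh⟩ | ⟨j, d, rfl, rfl⟩ | ⟨rfl, rfl, rfl⟩ | ⟨rfl, rfl, e, rfl, rfl⟩)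
    · rcases Node.eq_chd hh with rfl | rfl <;> simp
    · rw [(Node.eq_par hh).2]; simp
    · rw [Node.coe_leaf] at h2; omega
    · exact absurd Node.coe_root h1
    · exact absurd Node.coe_root h1
  · rintro (rfl | rfl | rfl)
    · exact .inl ⟨_, rfl, .inr (h.coe_par h1)⟩
    · exact .inl ⟨_, rfl, .inl (by rw [h.coe_chd h2]; simp)⟩
    · exact .inl ⟨_, rfl, .inl (by rw [h.coe_chd h2]; simp; omega)⟩

theorem adj_leaf (hn : 1 ≤ n) (I : Instance n a b) (s : Bool) (i : Fin n) (j : Fin (2 ^ n))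
    (v : Vertex n) :
    I.graph.Adj (treeVertex s i (.leaf (I.welding s i j))) v ↔
      v = treeVertex s i (Node.leaf (I.welding s i j)).par ∨
      v = treeVertex (!s) i (.leaf (I.welding (!s) i (nxt s false j))) ∨
      v = treeVertex (!s) i (.leaf (I.welding (!s) i (nxt s true j))) := by
  rw [adj_treeVertex_iff]
  constructor
  · rintro (⟨h', rfl, hh | hh⟩ | ⟨j', d, hj, rfl⟩ | ⟨rfl, e, rfl⟩ | ⟨rfl, e, -⟩)
    · have h1 := h'.lt_two_pow
      rw [Node.coe_leaf] at hh
      have h3 : 2 ^ (n + 1) = 2 * 2 ^ n := by ring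
      omega
    · rw [(Node.eq_par hh).2]; simp
    · obtain rfl := (I.welding s i).injective (Node.leaf_injective hj)
      cases d <;> simp
    · exact absurd (congrArg Subtype.val e) (Node.coe_leaf_ne_one hn _)
    · exact absurd (congrArg Subtype.val e) (Node.coe_leaf_ne_one hn _)
  · rintro (rfl | rfl | rfl)
    · exact .inl ⟨_, rfl, .inr (Node.coe_par _ (Node.coe_leaf_ne_one hn _))⟩
    · exact .inr (.inl ⟨_, _, rfl, rfl⟩)
    · exact .inr (.inl ⟨_, _, rfl, rfl⟩)

theorem adj_left_root (hn : 1 ≤ n) (I : Instance n a b) (i : Fin n) (v : Vertex n) :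
    I.graph.Adj (treeVertex false i (.root n)) v ↔ v = .path i ∨
      v = treeVertex false i ((Node.root n).chd false) ∨
      v = treeVertex false i ((Node.root n).chd true) := by
  have h2 : ((Node.root n : Node n) : ℕ) < 2 ^ n := by
    calc 1 < 2 ^ 1 := by norm_num
      _ ≤ 2 ^ n := Nat.pow_le_pow_right (by norm_num) hn
  rw [adj_treeVertex_iff]
  constructor
  · rintro (⟨h', rfl, hh | hh⟩ | ⟨j, d, hj, rfl⟩ | ⟨-, -, rfl⟩ | ⟨h, -⟩)
    · rcases Node.eq_chd hh with rfl | rfl <;> simp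
    · exact absurd Node.coe_root (Node.eq_par hh).1
    · rw [hj, Node.coe_leaf] at h2; omega
    · simp
    · simp at h
  · rintro (rfl | rfl | rfl)
    · exact .inr (.inr (.inl ⟨rfl, rfl, rfl⟩))
    · exact .inl ⟨_, rfl, .inl (by rw [Node.coe_chd _ h2]; simp)⟩
    · exact .inl ⟨_, rfl, .inl (by rw [Node.coe_chd _ h2, Node.coe_root]; simp)⟩

/-- The neighbours of a vertex reached regularly: the previous vertex and the two vertices that can
be visited next. -/
theorem adj_vert_iff (hn : 1 ≤ n) (I : Instance n a b) (l : Loc n) (hl : l.Regular)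
    (h0 : ∀ i, l = .path true i → 1 ≤ (i : ℕ)) (h1 : ∀ i, l = .path false i → (i : ℕ) + 1 < n)
    (v : Vertex n) :
    I.graph.Adj (l.vert I.welding) v ↔ v = l.prev I.welding ∨
      v = (l.step I.welding false).vert I.welding ∨
      v = (l.step I.welding true).vert I.welding := by
  rcases l with ⟨_ | _, i⟩ | ⟨i, h⟩ | ⟨s, i, j, d⟩ | ⟨s, i, w⟩ | ⟨s, i, h⟩
  · have hl' : 1 ≤ (i : ℕ) := hl
    have h1' := h1 i rfl
    simp only [Loc.vert, Loc.step, if_pos hl', Loc.prev]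
    rw [adj_path_iff]
    constructor
    · rintro (⟨j, rfl, h | h⟩ | rfl)
      · left; congr 1; exact Fin.ext (by simp; omega)
      · right; right; congr 1; exact Fin.ext (by simp; omega)
      · exact .inr (.inl rfl)
    · rintro (rfl | rfl | rfl)
      · exact .inl ⟨_, rfl, by simp; omega⟩
      · exact .inr rfl
      · exact .inl ⟨_, rfl, by simp; omega⟩
  · have hl' : (i : ℕ) + 1 < n := hl
    have h1' := h0 i rfl
    simp only [Loc.vert, Loc.step, dif_pos hl', Loc.prev]
    rw [adj_path_iff]
    constructor
    · rintro (⟨j, rfl, h | h⟩ | rfl)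
      · right; right; congr 1; exact Fin.ext (by simp; omega)
      · left; congr 1; exact Fin.ext (by simp; omega)
      · exact .inr (.inl rfl)
    · rintro (rfl | rfl | rfl)
      · exact .inl ⟨_, rfl, by simp; omega⟩
      · exact .inr rfl
      · exact .inl ⟨_, rfl, by simp⟩
  · by_cases hh : (h : ℕ) < 2 ^ n
    · simp only [Loc.vert, Loc.step, if_pos hh, Loc.prev]
      by_cases hr : (h : ℕ) = 1
      · obtain rfl : h = .root n := Subtype.ext hr
        rw [if_pos hr]
        exact adj_left_root hn I i v
      · rw [if_neg hr]
        exact adj_inner_node I false i h hr hh v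
    · obtain ⟨j, rfl⟩ := h.eq_leaf hh
      rw [Loc.step_desc_leaf, Loc.step_desc_leaf]
      simp only [Loc.vert, Loc.prev, if_neg (Node.coe_leaf_ne_one hn j)]
      simpa [treeVertex] using adj_leaf hn I false i ((I.welding false i).symm j) v
  · simp only [Loc.vert, Loc.step, Loc.prev]
    rw [adj_leaf hn]
    have key : ∀ d', (nxt (!s) d').symm j = (nxt s (!d') j : Fin (2 ^ n)) := by
      intro d'
      cases s <;> cases d' <;> simp [nxt]
    rw [key]
    cases d <;> simp only [Bool.not_true, Bool.not_false] <;> tauto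
  · have hl' : 4 ≤ (w : ℕ) := hl
    have hw := w.lt_two_pow
    have h3 : 2 ^ (n + 1) = 2 * 2 ^ n := by ring
    have hp := w.coe_par (by omega)
    simp only [Loc.vert, Loc.step, Loc.prev]
    rw [adj_inner_node I s i w.par (by omega) (by omega)]
    have hs := w.coe_sib (by omega)
    rcases Nat.mod_two_eq_zero_or_one w with h0 | h0
    · have e1 : w.par.chd false = w := Subtype.ext (by
        rw [Node.coe_chd _ (by omega)]; simp; omega)
      have e2 : w.par.chd true = w.sib := Subtype.ext (by
        rw [Node.coe_chd _ (by omega), hs, if_pos h0]; simp; omega)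
      rw [e1, e2]; tauto
    · have e1 : w.par.chd true = w := Subtype.ext (by
        rw [Node.coe_chd _ (by omega)]; simp; omega)
      have e2 : w.par.chd false = w.sib := Subtype.ext (by
        rw [Node.coe_chd _ (by omega), hs, if_neg (by omega)]; simp; omega)
      rw [e1, e2]; tauto
  · have hl' : 2 ≤ (h : ℕ) := hl
    by_cases hh : (h : ℕ) < 2 ^ n
    · simp only [Loc.vert, Loc.step, if_pos hh, Loc.prev]
      exact adj_inner_node I s i h (by omega) hh v
    · obtain ⟨j, rfl⟩ := h.eq_leaf hh
      rw [Loc.step_down_leaf, Loc.step_down_leaf]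
      simp only [Loc.vert, Loc.prev]
      simpa using adj_leaf hn I s i ((I.welding s i).symm j) v

/-- The two ends have only two neighbours, as nothing precedes them. -/
theorem adj_start_iff (hn : 2 ≤ n) (I : Instance n a b) (l : Loc n)
    (hl : l = .path true ⟨0, NeZero.pos n⟩ ∨
      l = .path false ⟨n - 1, by have := NeZero.pos n; omega⟩) (v : Vertex n) :
    I.graph.Adj (l.vert I.welding) v ↔ v = (l.step I.welding false).vert I.welding ∨
      v = (l.step I.welding true).vert I.welding := by
  rcases hl with rfl | rfl
  · simp only [Loc.vert, Loc.step]
    rw [adj_path_iff, dif_pos (by simp; omega)]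
    constructor
    · rintro (⟨j, rfl, h | h⟩ | rfl)
      · right; congr 1; exact Fin.ext (by simp at h ⊢; omega)
      · simp at h
      · exact .inl rfl
    · rintro (rfl | rfl)
      · exact .inr rfl
      · exact .inl ⟨_, rfl, by simp⟩
  · simp only [Loc.vert, Loc.step]
    rw [adj_path_iff, if_pos (show 1 ≤ n - 1 by omega)]
    constructor
    · rintro (⟨j, rfl, h | h⟩ | rfl)
      · have := j.2; simp at h; omega
      · right; congr 1; exact Fin.ext (by simp at h ⊢; omega)
      · exact .inl rfl
    · rintro (rfl | rfl)
      · exact .inr rfl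
      · exact .inl ⟨_, rfl, by simp; omega⟩

end Graph

/-! ### Blocks of the trees, and uniqueness of addresses -/

/-- The ancestor at depth `m` of a node of depth at least `m`. -/
def blk (m h : ℕ) : ℕ := h / 2 ^ (Nat.log 2 h - m)

theorem blk_half {m h : ℕ} (hh : m < Nat.log 2 h) : blk m (h / 2) = blk m h := by
  rw [blk, blk, Nat.log_div_base, Nat.div_div_eq_div_mul, ← pow_succ']
  congr 2
  omega

/-- The node `w` is an ancestor of `L`, or `L` itself. -/
def Anc (w L : ℕ) : Prop := ∃ k, L / 2 ^ k = w

theorem Anc.half {w L : ℕ} (h : Anc w L) : Anc (w / 2) L := by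
  obtain ⟨k, rfl⟩ := h
  exact ⟨k + 1, by rw [pow_succ, Nat.div_div_eq_div_mul]⟩

theorem Anc.le {w L : ℕ} (h : Anc w L) : w ≤ L := by
  obtain ⟨k, rfl⟩ := h
  exact Nat.div_le_self _ _

/-- Ancestors with the same parent are equal. -/
theorem Anc.eq_of_half {w w' L : ℕ} (h : Anc w L) (h' : Anc w' L) (h2 : 2 ≤ w)
    (e : w / 2 = w' / 2) : w = w' := by
  have key : ∀ k k', L / 2 ^ k / 2 = L / 2 ^ k' / 2 → k < k' → 2 ≤ L / 2 ^ k → False := by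
    intro k k' e hk h2
    have h3 : L / 2 ^ k' ≤ L / 2 ^ k / 2 := by
      rw [Nat.div_div_eq_div_mul, ← pow_succ]
      exact Nat.div_le_div_left (Nat.pow_le_pow_right (by norm_num) hk) (by positivity)
    omega
  obtain ⟨k, rfl⟩ := h
  obtain ⟨k', rfl⟩ := h'
  rcases lt_trichotomy k k' with h | rfl | h
  · exact (key k k' e h h2).elim
  · rfl
  · exact (key k' k e.symm h (by omega)).elim

section Injectivity

variable {n : ℕ} [NeZero n] {m : ℕ} {π : Welding n} {c T : Finset ℕ}

/-- Two explored addresses of which the first enters a tree from the alternating cycle, in a block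
that the second enters as well: along the cycle at an earlier address, or from above. -/
def BlockClash (m : ℕ) (π : Welding n) (c : Finset ℕ) (h h' : ℕ) : Prop :=
  ∃ s i j d, loc π c h = .cyc s i j d ∧
    ((h' < h ∧ ∃ j' d', loc π c h' = .cyc s i j' d' ∧
        blk m ((Node.leaf (π s i j') : Node n) : ℕ) =
          blk m ((Node.leaf (π s i j) : Node n) : ℕ)) ∨
      (s = false ∧ ∃ v, loc π c h' = .desc i v ∧ m ≤ Nat.log 2 v ∧
        blk m (v : ℕ) = blk m ((Node.leaf (π s i j) : Node n) : ℕ)))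

/-- No walk to an address in `T` ends with `m - 1` consecutive favourable steps. -/
def Unlucky (m : ℕ) (π : Welding n) (c T : Finset ℕ) : Prop :=
  ∀ h ∈ T, (loc π c h).luck < m - 1

/-- While a walk is in a tree that it has entered from the cycle at a leaf, it stays in the block of
this leaf, on the way up at the ancestors of the leaf, and on the way down at other nodes. -/
theorem exists_entry (hn : n = 2 * m) (hT : Closed T) (hl : Unlucky m π c T) {h : ℕ}
    (hh : h ∈ T) :
    (∀ s i w, loc π c h = .up s i w → m + 3 ≤ Nat.log 2 w ∧ ∃ e ∈ T, e ≤ h ∧ ∃ j d,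
      loc π c e = .cyc s i j d ∧ blk m w = blk m ((Node.leaf (π s i j) : Node n) : ℕ) ∧
        Anc w ((Node.leaf (π s i j) : Node n) : ℕ)) ∧
    (∀ s i v, loc π c h = .down s i v → m + 3 ≤ Nat.log 2 v ∧ ∃ e ∈ T, e ≤ h ∧ ∃ j d,
      loc π c e = .cyc s i j d ∧ blk m v = blk m ((Node.leaf (π s i j) : Node n) : ℕ) ∧
        ¬ Anc v ((Node.leaf (π s i j) : Node n) : ℕ)) := by
  have hup : ∀ g ∈ T, ∀ s i w, loc π c g = .up s i w → m + 3 ≤ Nat.log 2 w := by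
    intro g hg s i w e
    have h1 := hl g hg
    have h2 := w.log_le
    rw [e, Loc.luck] at h1
    omega
  induction h using Nat.strong_induction_on with
  | _ h ih =>
    by_cases h4 : h < 4
    · have : ∃ d i, loc π c h = .path d i := by
        rw [loc, dif_pos h4]
        split_ifs <;> exact ⟨_, _, rfl⟩
      obtain ⟨d, i, e⟩ := this
      simp [e]
    have hg := (hT h hh).2 (by omega)
    have hlt : h / 2 < h := by omega
    obtain ⟨ih1, ih2⟩ := ih (h / 2) hlt hg
    have e0 := loc_of_four_le π c (show 4 ≤ h by omega)
    generalize (decide (h % 2 = 1) ^^ decide (h / 2 ∈ c)) = b at e0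
    generalize hl0 : loc π c (h / 2) = l at e0 ih1 ih2
    rcases l with ⟨_ | _, i⟩ | ⟨i, v⟩ | ⟨s, i, j, d⟩ | ⟨s, i, w⟩ | ⟨s, i, v⟩
    · cases b <;> simp only [Loc.step] at e0 <;> (try split_ifs at e0) <;> simp [e0]
    · cases b <;> simp only [Loc.step] at e0 <;> (try split_ifs at e0) <;> simp [e0]
    · simp only [Loc.step] at e0
      split_ifs at e0 <;> simp [e0]
    · cases b <;> simp only [Loc.step] at e0
      · simp [e0]
      · refine ⟨?_, by simp [e0]⟩
        intro s' i' w' e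
        have hw := hup h hh _ _ _ e
        rw [e0] at e
        cases e
        exact ⟨hw, _, hg, hlt.le, j, d, hl0, rfl, 0, by simp⟩
    · obtain ⟨hw, e, he, hle, j, d, hloc, hb, ha⟩ := ih1 _ _ _ rfl
      have hw1 : (w : ℕ) ≠ 1 := by
        intro h1
        rw [h1] at hw
        simp at hw
      cases b <;> simp only [Loc.step] at e0
      · refine ⟨by simp [e0], ?_⟩
        intro s' i' v' ev
        rw [e0] at ev
        cases ev
        have hs := w.coe_sib hw1
        have h2 : (w.sib : ℕ) / 2 = w / 2 := by
          rw [hs]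
          have := w.one_le
          split_ifs <;> omega
        have hlog : Nat.log 2 (w.sib : ℕ) = Nat.log 2 w := by
          have e1 := Nat.log_div_base 2 (w.sib : ℕ)
          have e2 := Nat.log_div_base 2 (w : ℕ)
          rw [h2] at e1
          have : 0 < Nat.log 2 (w.sib : ℕ) := Nat.log_pos (by norm_num) (by
            have := w.one_le
            rw [hs]; split_ifs <;> omega)
          omega
        refine ⟨by omega, e, he, by omega, j, d, hloc, ?_, ?_⟩
        · rw [← hb, ← blk_half (by omega : m < Nat.log 2 (w.sib : ℕ)), h2, blk_half (by omega)]
        · intro ha'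
          have h5 := ha.eq_of_half ha' (by have := w.one_le; omega) h2.symm
          rw [hs] at h5
          have := w.one_le
          split_ifs at h5 <;> omega
      · refine ⟨?_, by simp [e0]⟩
        intro s' i' w' ew
        have hw' := hup h hh _ _ _ ew
        rw [e0] at ew
        cases ew
        refine ⟨hw', e, he, by omega, j, d, hloc, ?_, ?_⟩
        · rw [w.coe_par hw1, ← hb, blk_half (by omega)]
        · rw [w.coe_par hw1]; exact ha.half
    · obtain ⟨hv, e, he, hle, j, d, hloc, hb, ha⟩ := ih2 _ _ _ rfl
      simp only [Loc.step] at e0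
      split_ifs at e0 with hlt2
      · refine ⟨by simp [e0], ?_⟩
        intro s' i' v' ev
        rw [e0] at ev
        cases ev
        have h2 : (v.chd b : ℕ) / 2 = v := by
          rw [v.coe_chd hlt2]
          have := Bool.toNat_le b
          omega
        have hlog := Nat.log_div_base 2 (v.chd b : ℕ)
        rw [h2] at hlog
        refine ⟨by omega, e, he, by omega, j, d, hloc, ?_, ?_⟩
        · rw [← hb, ← blk_half (by omega : m < Nat.log 2 (v.chd b : ℕ)), h2]
        · intro ha'
          have := ha'.half
          rw [h2] at this
          exact ha this
      · simp [e0]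

/-- When no run of favourable steps is long, the walk stays in the part of the graph where it is
regular. -/
theorem regular_loc (hn : n = 2 * m) (hm : 1 ≤ m) (hT : Closed T) (hl : Unlucky m π c T) {h : ℕ}
    (hh : h ∈ T) : (loc π c h).Regular := by
  have h1 := hl h hh
  have hlog : ∀ x : ℕ, m + 3 ≤ Nat.log 2 x → 4 ≤ x := by
    intro x hx
    by_contra hlt
    have : Nat.log 2 x ≤ Nat.log 2 3 := Nat.log_mono_right (by omega)
    have h3 : Nat.log 2 3 = 1 := by decide
    omega
  obtain ⟨hu, hd⟩ := exists_entry hn hT hl hh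
  generalize loc π c h = l at h1 hu hd
  rcases l with ⟨_ | _, i⟩ | ⟨i, v⟩ | ⟨s, i, j, d⟩ | ⟨s, i, w⟩ | ⟨s, i, v⟩
  · simp only [Loc.luck] at h1
    show 1 ≤ (i : ℕ)
    omega
  · simp only [Loc.luck] at h1
    show (i : ℕ) + 1 < n
    omega
  · trivial
  · trivial
  · exact hlog _ (hu _ _ _ rfl).1
  · have := hlog _ (hd _ _ _ rfl).1
    show 2 ≤ (v : ℕ)
    omega

/-- Walks from either end stay in their own half of the path graph and do not return to the end. -/
theorem loc_path (hn : n = 2 * m) (hl : Unlucky m π c T) {h : ℕ} (hh : h ∈ T) :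
    (∀ i, loc π c h = .path true i → (i : ℕ) < m - 1 ∧ (4 ≤ h → 1 ≤ (i : ℕ))) ∧
    (∀ i, loc π c h = .path false i → m < (i : ℕ) ∧ (4 ≤ h → (i : ℕ) + 1 < n)) := by
  have h1 := hl h hh
  constructor <;> intro i e <;> rw [e] at h1 <;> simp only [Loc.luck] at h1 <;>
    refine ⟨by have := i.2; omega, fun h4 => ?_⟩ <;> rw [loc_of_four_le π c h4] at e
  · exact Loc.pos_of_step_eq e
  · exact Loc.lt_of_step_eq e

/-- How a tree vertex has been reached: from above, or from a leaf at which the tree was entered;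
in the second case this leaf determines the previous vertex. -/
theorem tree_kind (hn : n = 2 * m) (hT : Closed T) (hl : Unlucky m π c T) {h : ℕ}
    (hh : h ∈ T) {s : Bool} {i : Fin n} {v : Node n}
    (hv : (loc π c h).vert π = treeVertex s i v) :
    (s = false ∧ loc π c h = .desc i v) ∨
    ∃ e ∈ T, e ≤ h ∧ ∃ j d, loc π c e = .cyc s i j d ∧ m ≤ Nat.log 2 v ∧
      blk m v = blk m ((Node.leaf (π s i j) : Node n) : ℕ) ∧
      ((v = Node.leaf (π s i j) ∧ h = e) ∨
        (∃ w : Node n, 2 ≤ (w : ℕ) ∧ Anc w ((Node.leaf (π s i j) : Node n) : ℕ) ∧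
          (v : ℕ) = w / 2 ∧ (loc π c h).prev π = treeVertex s i w) ∨
        (¬ Anc v ((Node.leaf (π s i j) : Node n) : ℕ) ∧
          (loc π c h).prev π = treeVertex s i v.par)) := by
  obtain ⟨hu, hd⟩ := exists_entry hn hT hl hh
  generalize hloc : loc π c h = l at hu hd hv
  rcases l with ⟨_ | _, k⟩ | ⟨k, u⟩ | ⟨t, k, j, d⟩ | ⟨t, k, w⟩ | ⟨t, k, u⟩
  · exact absurd hv.symm treeVertex_ne_path
  · exact absurd hv.symm treeVertex_ne_path
  · obtain ⟨rfl, rfl, rfl⟩ := treeVertex_inj.1 (show treeVertex false k u = _ from hv)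
    exact .inl ⟨rfl, rfl⟩
  · obtain ⟨rfl, rfl, rfl⟩ := treeVertex_inj.1 hv
    exact .inr ⟨h, hh, le_rfl, j, d, hloc, by rw [Node.log_leaf]; omega, rfl, .inl ⟨rfl, rfl⟩⟩
  · obtain ⟨rfl, rfl, rfl⟩ := treeVertex_inj.1 hv
    obtain ⟨hw, e, he, hle, j, d, hloc', hb, ha⟩ := hu _ _ _ rfl
    have hw1 : (w : ℕ) ≠ 1 := by
      intro h1
      rw [h1] at hw
      simp at hw
    have hp := w.coe_par hw1
    refine .inr ⟨e, he, hle, j, d, hloc', ?_, ?_, .inr (.inl ⟨w, ?_, ha, hp, rfl⟩)⟩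
    · rw [w.log_par hw1]; omega
    · rw [hp, blk_half (by omega), hb]
    · have := w.one_le; omega
  · obtain ⟨rfl, rfl, rfl⟩ := treeVertex_inj.1 hv
    obtain ⟨hw, e, he, hle, j, d, hloc', hb, ha⟩ := hd _ _ _ rfl
    exact .inr ⟨e, he, hle, j, d, hloc', by omega, hb, .inr (.inr ⟨ha, rfl⟩)⟩

/-- Different addresses belong to different vertices, as long as no block is entered twice. -/
theorem eq_of_vert_eq (hn : n = 2 * m) (hm : 1 ≤ m) (hT : Closed T) (hl : Unlucky m π c T)
    {N : ℕ} (hno : ∀ g ∈ T, g ≤ N → ∀ g' ∈ T, ¬ BlockClash m π c g g') {h h' : ℕ}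
    (hh : h ∈ T) (hh' : h' ∈ T) (hN : h ≤ N) (hN' : h' ≤ N)
    (hv : (loc π c h).vert π = (loc π c h').vert π) : h = h' := by
  induction h using Nat.strong_induction_on generalizing h' with
  | _ h ih =>
    by_contra hne
    -- it suffices to compare the previous vertices
    have hprev : 4 ≤ h → 4 ≤ h' → (loc π c h).prev π = (loc π c h').prev π → False := by
      intro h4 h4' hp
      have hg := (hT h hh).2 h4
      have hg' := (hT h' hh').2 h4'
      have r := regular_loc hn hm hT hl hg
      have r' := regular_loc hn hm hT hl hg'
      rw [loc_of_four_le π c h4, loc_of_four_le π c h4', Loc.prev_step (by omega) _ r,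
        Loc.prev_step (by omega) _ r'] at hp
      have e := ih (h / 2) (by omega) hg hg' (by omega) (by omega) hp
      rw [loc_of_four_le π c h4, loc_of_four_le π c h4', ← e] at hv
      have hb : (decide (h' % 2 = 1) ^^ decide (h / 2 ∈ c)) =
          !(decide (h % 2 = 1) ^^ decide (h / 2 ∈ c)) := by
        have : (h' % 2 = 1) ↔ ¬ (h % 2 = 1) := by omega
        simp only [this]
        by_cases x : h % 2 = 1 <;> by_cases y : h / 2 ∈ c <;> simp [x, y]
      rw [hb] at hv
      have hs := Loc.vert_step_ne (π := π) (by omega : 1 ≤ n) _ r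
      cases hbb : (decide (h % 2 = 1) ^^ decide (h / 2 ∈ c)) <;> rw [hbb] at hv
      · exact hs hv.symm
      · exact hs hv
    -- a vertex of the path graph
    have hpath : ∀ d i, loc π c h = .path d i → ∃ d', loc π c h' = .path d' i := by
      intro d i e
      rw [e] at hv
      generalize loc π c h' = l at hv
      rcases l with ⟨d', k⟩ | ⟨k, u⟩ | ⟨t, k, j, d⟩ | ⟨t, k, w⟩ | ⟨t, k, u⟩
      · exact ⟨d', by rw [Vertex.path.inj hv]⟩
      · cases hv
      · exact absurd hv.symm treeVertex_ne_path
      · exact absurd hv.symm treeVertex_ne_path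
      · exact absurd hv.symm treeVertex_ne_path
    have hp := loc_path hn hl hh
    have hp' := loc_path hn hl hh'
    have hsmall : ∀ g ∈ T, ¬ 4 ≤ g → g = 2 ∨ g = 3 := fun g hg _ => by
      have := (hT g hg).1
      omega
    have htree : (∀ d i, loc π c h ≠ .path d i) → ∃ s i v,
        (loc π c h).vert π = treeVertex s i v := by
      intro hnp
      generalize loc π c h = l at hnp
      rcases l with ⟨d', k⟩ | ⟨k, u⟩ | ⟨t, k, j, d⟩ | ⟨t, k, w⟩ | ⟨t, k, u⟩
      · exact absurd rfl (hnp d' k)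
      · exact ⟨false, k, u, rfl⟩
      · exact ⟨_, _, _, rfl⟩
      · exact ⟨_, _, _, rfl⟩
      · exact ⟨_, _, _, rfl⟩
    by_cases hpa : ∃ d i, loc π c h = .path d i
    · obtain ⟨d, i, e⟩ := hpa
      obtain ⟨d', e'⟩ := hpath d i e
      have hdd : d = d' := by
        cases d <;> cases d' <;> try rfl
        · have := (hp.2 i e).1; have := (hp'.1 i e').1; omega
        · have := (hp.1 i e).1; have := (hp'.2 i e').1; omega
      subst hdd
      have h44 : 4 ≤ h ↔ 4 ≤ h' := by
        constructor <;> intro h4 <;> by_contra h4' <;> cases d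
        · have h2 := (hp.2 i e).2 h4
          rcases hsmall h' hh' h4' with rfl | rfl
          · rw [loc_two] at e'; cases e'
          · rw [loc_three] at e'; cases e'; simp at h2; omega
        · have h2 := (hp.1 i e).2 h4
          rcases hsmall h' hh' h4' with rfl | rfl
          · rw [loc_two] at e'; cases e'; simp at h2
          · rw [loc_three] at e'; cases e'
        · have h2 := (hp'.2 i e').2 h4
          rcases hsmall h hh h4' with rfl | rfl
          · rw [loc_two] at e; cases e
          · rw [loc_three] at e; cases e; simp at h2; omega
        · have h2 := (hp'.1 i e').2 h4
          rcases hsmall h hh h4' with rfl | rfl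
          · rw [loc_two] at e; cases e; simp at h2
          · rw [loc_three] at e; cases e
      by_cases h4 : 4 ≤ h
      · exact hprev h4 (h44.1 h4) (by rw [e, e'])
      · rcases hsmall h hh h4 with rfl | rfl <;>
          rcases hsmall h' hh' (fun x => h4 (h44.2 x)) with rfl | rfl
        · exact hne rfl
        · rw [loc_two] at e; rw [loc_three] at e'; rw [← e] at e'; cases e'
        · rw [loc_three] at e; rw [loc_two] at e'; rw [← e] at e'; cases e'
        · exact hne rfl
    · obtain ⟨s, i, v, e⟩ := htree fun d i e => hpa ⟨d, i, e⟩
      have h4 : ∀ g ∈ T, (loc π c g).vert π = treeVertex s i v → 4 ≤ g := by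
        intro g hg e
        by_contra h4
        rcases hsmall g hg h4 with rfl | rfl
        · rw [loc_two] at e; exact treeVertex_ne_path e.symm
        · rw [loc_three] at e; exact treeVertex_ne_path e.symm
      have hcon := hprev (h4 h hh e) (h4 h' hh' (hv ▸ e))
      rcases tree_kind hn hT hl hh e with ⟨hs, e1⟩ | ⟨x, hx, hxle, j, d, hxe, hlog, hb, hk⟩ <;>
        rcases tree_kind hn hT hl hh' (hv ▸ e) with
          ⟨hs', e1'⟩ | ⟨x', hx', hxle', j', d', hxe', hlog', hb', hk'⟩
      · exact hcon (by rw [e1, e1'])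
      · subst hs
        exact hno x' hx' (by omega) h hh ⟨_, _, _, _, hxe', .inr ⟨rfl, v, e1, hlog', hb'⟩⟩
      · subst hs'
        exact hno x hx (by omega) h' hh' ⟨_, _, _, _, hxe, .inr ⟨rfl, v, e1', hlog, hb⟩⟩
      · rcases lt_trichotomy x x' with hlt | rfl | hlt
        · exact hno x' hx' (by omega) x hx
            ⟨_, _, _, _, hxe', .inl ⟨hlt, _, _, hxe, hb.symm.trans hb'⟩⟩
        · rw [hxe] at hxe'
          cases hxe'
          rcases hk with ⟨hk, rfl⟩ | ⟨w, hw2, hw, hvw, hk⟩ | ⟨ha, hk⟩ <;>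
            rcases hk' with ⟨hk', rfl⟩ | ⟨w', hw2', hw', hvw', hk'⟩ | ⟨ha', hk'⟩
          · exact hne rfl
          · have := hw'.le
            rw [hk] at hvw'
            omega
          · exact ha' ⟨0, by simp [hk]⟩
          · have := hw.le
            rw [hk'] at hvw
            omega
          · have := hw.eq_of_half hw' hw2 (by omega)
            exact hcon (by rw [hk, hk', Subtype.ext this])
          · exact ha' (hvw ▸ hw.half)
          · exact ha ⟨0, by simp [hk']⟩
          · exact ha (hvw' ▸ hw'.half)
          · exact hcon (by rw [hk, hk'])
        · exact hno x hx (by omega) x' hx'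
            ⟨_, _, _, _, hxe, .inl ⟨hlt, _, _, hxe', hb'.symm.trans hb⟩⟩

end Injectivity

/-! ### Clashes are rare: exchanging leaves -/

namespace Loc

variable {n : ℕ} (π : Welding n)

/-- The leaf at which a walk is, if any: side, number of the welded tree, index of the leaf. -/
def leaf? : Loc n → Option (Bool × Fin n × Fin (2 ^ n))
  | desc i h => if (h : ℕ) < 2 ^ n then none else some (false, i, h.idx)
  | down s i h => if (h : ℕ) < 2 ^ n then none else some (s, i, h.idx)
  | cyc s i j _ => some (s, i, π s i j)
  | _ => none

/-- Places at leaves that are reached from above; there the walk enters the alternating cycle. -/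
def Seed : Loc n → Prop
  | desc _ h => 2 ^ n ≤ (h : ℕ)
  | down _ _ h => 2 ^ n ≤ (h : ℕ)
  | _ => False

theorem Seed.exists_leaf {l : Loc n} (hl : l.Seed) :
    ∃ s i L, (∀ π, l.leaf? π = some (s, i, L)) ∧
      ∀ π d, l.step π d = cyc (!s) i (nxt s d ((π s i).symm L)) d := by
  rcases l with ⟨d', k⟩ | ⟨k, u⟩ | ⟨t, k, j, d⟩ | ⟨t, k, w⟩ | ⟨t, k, u⟩
  · exact hl.elim
  · have : ¬ (u : ℕ) < 2 ^ n := not_lt.2 hl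
    exact ⟨false, k, u.idx, fun π => by simp [leaf?, this], fun π d => by simp [step, this]⟩
  · exact hl.elim
  · exact hl.elim
  · have : ¬ (u : ℕ) < 2 ^ n := not_lt.2 hl
    exact ⟨t, k, u.idx, fun π => by simp [leaf?, this], fun π d => by simp [step, this]⟩

theorem seed_or_cyc {l : Loc n} {x} (h : l.leaf? π = some x) :
    l.Seed ∨ ∃ s i j d, l = cyc s i j d := by
  rcases l with ⟨d', k⟩ | ⟨k, u⟩ | ⟨t, k, j, d⟩ | ⟨t, k, w⟩ | ⟨t, k, u⟩
  · simp [leaf?] at h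
  · simp only [leaf?] at h
    split_ifs at h with h1
    exact .inl (not_lt.1 h1)
  · exact .inr ⟨_, _, _, _, rfl⟩
  · simp [leaf?] at h
  · simp only [leaf?] at h
    split_ifs at h with h1
    exact .inl (not_lt.1 h1)

theorem vert_of_leaf? {l : Loc n} {s : Bool} {i : Fin n} {L : Fin (2 ^ n)}
    (h : l.leaf? π = some (s, i, L)) : l.vert π = treeVertex s i (.leaf L) := by
  rcases l with ⟨d', k⟩ | ⟨k, u⟩ | ⟨t, k, j, d⟩ | ⟨t, k, w⟩ | ⟨t, k, u⟩
  · simp [leaf?] at h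
  · simp only [leaf?] at h
    split_ifs at h with h1
    cases h
    rw [Node.leaf_idx _ (not_lt.1 h1)]
    rfl
  · cases h
    rfl
  · simp [leaf?] at h
  · simp only [leaf?] at h
    split_ifs at h with h1
    cases h
    rw [Node.leaf_idx _ (not_lt.1 h1)]
    rfl

end Loc

/-- The bijections after the exchange of two leaves of one tree. -/
def swapLeaves {n : ℕ} (π : Welding n) (s : Bool) (i : Fin n) (L L' : Fin (2 ^ n)) : Welding n :=
  fun t k => if t = s ∧ k = i then (π t k).trans (Equiv.swap L L') else π t k

section Swap

variable {n : ℕ} {π : Welding n} {s : Bool} {i : Fin n} {L L' : Fin (2 ^ n)}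

theorem swapLeaves_apply_self (j : Fin (2 ^ n)) :
    swapLeaves π s i L L' s i j = Equiv.swap L L' (π s i j) := by
  simp [swapLeaves]

theorem swapLeaves_swapLeaves : swapLeaves (swapLeaves π s i L L') s i L L' = π := by
  funext t k
  simp only [swapLeaves]
  split_ifs with h
  · ext x
    simp
  · rfl

theorem swapLeaves_apply {t : Bool} {k : Fin n} {j : Fin (2 ^ n)}
    (h : ∀ x, (t, k, π t k j) = (s, i, x) → x ≠ L ∧ x ≠ L') :
    swapLeaves π s i L L' t k j = π t k j := by
  by_cases htk : t = s ∧ k = i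
  · obtain ⟨rfl, rfl⟩ := htk
    obtain ⟨h1, h2⟩ := h _ rfl
    rw [swapLeaves_apply_self, Equiv.swap_apply_of_ne_of_ne h1 h2]
  · simp [swapLeaves, htk]

theorem swapLeaves_symm_apply {t : Bool} {k : Fin n} {y : Fin (2 ^ n)}
    (h : ∀ x, (t, k, y) = (s, i, x) → x ≠ L ∧ x ≠ L') :
    (swapLeaves π s i L L' t k).symm y = (π t k).symm y := by
  rw [Equiv.symm_apply_eq, swapLeaves_apply]
  · simp
  · simpa using h

theorem Loc.step_swapLeaves {l : Loc n}
    (h : ∀ x, l.leaf? π = some (s, i, x) → x ≠ L ∧ x ≠ L') (b : Bool) :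
    l.step (swapLeaves π s i L L') b = l.step π b := by
  rcases l with ⟨_ | _, k⟩ | ⟨k, u⟩ | ⟨t, k, j, d⟩ | ⟨t, k, w⟩ | ⟨t, k, u⟩
  · cases b <;> rfl
  · cases b <;> rfl
  · by_cases hu : (u : ℕ) < 2 ^ n
    · simp [Loc.step, hu]
    · simp only [Loc.step, if_neg hu]
      rw [swapLeaves_symm_apply]
      intro x hx
      exact h x (by simp [Loc.leaf?, hu, hx])
  · cases b
    · rfl
    · simp only [Loc.step]
      rw [swapLeaves_apply]
      intro x hx
      exact h x (by simp [Loc.leaf?, hx])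
  · cases b <;> rfl
  · by_cases hu : (u : ℕ) < 2 ^ n
    · simp [Loc.step, hu]
    · simp only [Loc.step, if_neg hu]
      rw [swapLeaves_symm_apply]
      intro x hx
      exact h x (by simp [Loc.leaf?, hu, hx])

theorem Loc.leaf?_swapLeaves {l : Loc n}
    (h : ∀ x, l.leaf? π = some (s, i, x) → x ≠ L ∧ x ≠ L') :
    l.leaf? (swapLeaves π s i L L') = l.leaf? π := by
  rcases l with ⟨_ | _, k⟩ | ⟨k, u⟩ | ⟨t, k, j, d⟩ | ⟨t, k, w⟩ | ⟨t, k, u⟩ <;> try rfl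
  simp only [Loc.leaf?]
  rw [swapLeaves_apply]
  intro x hx
  exact h x (by simp [Loc.leaf?, hx])

end Swap

/-- Position `j` of a side of an alternating cycle, among all the positions on this cycle. -/
def code {n : ℕ} (s : Bool) (j : Fin (2 ^ n)) : ZMod (2 ^ (n + 1)) :=
  ((2 * j + s.toNat : ℕ) : ZMod _)

theorem code_injective {n : ℕ} (s : Bool) :
    Function.Injective (code s : Fin (2 ^ n) → ZMod (2 ^ (n + 1))) := by
  intro j j' h
  have h3 : 2 ^ (n + 1) = 2 * 2 ^ n := by ring
  have hs : s.toNat ≤ 1 := Bool.toNat_le s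
  have := (ZMod.natCast_eq_natCast_iff' _ _ _).1 h
  rw [Nat.mod_eq_of_lt (by have := j.2; omega), Nat.mod_eq_of_lt (by have := j'.2; omega)] at this
  exact Fin.ext (by omega)

/-- The unit of displacement along a cycle. -/
def sgn (d : Bool) : ℤ := if d then 1 else -1

/-- The next place along the cycle in direction `d` has the next code in this direction. -/
theorem code_nxt {n : ℕ} (s d : Bool) (j : Fin (2 ^ n)) :
    code (!s) (nxt s d j) = code s j + (sgn d : ZMod (2 ^ (n + 1))) := by
  have hrot : ∀ j : Fin (2 ^ n), code false (finRotate _ j) = code true j + 1 := by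
    intro j
    have h1 : ((finRotate (2 ^ n) j : Fin (2 ^ n)) : ℕ) = (j + 1) % 2 ^ n := by
      rw [finRotate_apply, Fin.val_add, Fin.coe_ofNat_eq_mod, Nat.add_mod_mod]
    rw [code, code, h1, Bool.toNat_false, add_zero, ← Nat.mul_mod_mul_left, ← pow_succ',
      ZMod.natCast_mod]
    push_cast
    simp
    ring
  cases s <;> cases d
  · have := hrot ((finRotate _).symm j)
    simp only [Equiv.apply_symm_apply] at this
    simp [nxt, sgn, this]
  · simp [nxt, sgn, code]
  · simp [nxt, sgn, code]
  · simpa [nxt, sgn] using hrot j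

/-- The place before a step along the alternating cycle. -/
theorem Loc.of_step_eq_cyc {n : ℕ} {π : Welding n} {l : Loc n} {b : Bool} {s i j d}
    (h : l.step π b = .cyc s i j d) :
    (l.Seed ∧ b = d) ∨ (b = false ∧ ∃ s' j', l = .cyc s' i j' d) := by
  rcases l with ⟨_ | _, k⟩ | ⟨k, u⟩ | ⟨t, k, j', d'⟩ | ⟨t, k, w⟩ | ⟨t, k, u⟩
  · cases b <;> simp only [Loc.step] at h <;> ((try split_ifs at h); (try cases h))
  · cases b <;> simp only [Loc.step] at h <;> ((try split_ifs at h); (try cases h))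
  · simp only [Loc.step] at h
    split_ifs at h with hu
    cases h
    exact .inl ⟨not_lt.1 hu, rfl⟩
  · cases b <;> simp only [Loc.step] at h <;> cases h
    exact .inr ⟨rfl, _, _, rfl⟩
  · cases b <;> simp only [Loc.step] at h <;> cases h
  · simp only [Loc.step] at h
    split_ifs at h with hu
    cases h
    exact .inl ⟨not_lt.1 hu, rfl⟩

section Clash

variable {n : ℕ} [NeZero n] {m : ℕ} {π : Welding n} {c T : Finset ℕ}

/-- `Run π c dir e k g`: the walk to `g` goes through `e` and ends with `k` steps along the
alternating cycle in direction `dir`, the first of which is made at `e`. -/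
inductive Run (π : Welding n) (c : Finset ℕ) (dir : Bool) (e : ℕ) : ℕ → ℕ → Prop
  | zero : Run π c dir e 0 e
  | succ {k g : ℕ} (h4 : 4 ≤ g) (hr : Run π c dir e k (g / 2))
      (hg : ∃ s i j, loc π c g = .cyc s i j dir) : Run π c dir e (k + 1) g

/-- The start, the direction and the number of steps determine where the walk ends. -/
theorem Run.unique {dir : Bool} {e k g g' : ℕ} (h : Run π c dir e k g)
    (h' : Run π c dir e k g') : g = g' := by
  induction k generalizing g g' with
  | zero => cases h; cases h'; rfl
  | succ k ih =>
    rcases h with _ | ⟨h4, hr, s, i, j, hg⟩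
    rcases h' with _ | ⟨h4', hr', s', i', j', hg'⟩
    have e1 := ih hr hr'
    rw [loc_of_four_le π c h4] at hg
    rw [loc_of_four_le π c h4', ← e1] at hg'
    have hb : (decide (g % 2 = 1) ^^ decide (g / 2 ∈ c)) =
        (decide (g' % 2 = 1) ^^ decide (g / 2 ∈ c)) := by
      rcases Loc.of_step_eq_cyc hg with ⟨h1, h2⟩ | ⟨h1, s1, j1, h2⟩ <;>
        rcases Loc.of_step_eq_cyc hg' with ⟨h1', h2'⟩ | ⟨h1', s1', j1', h2'⟩
      · rw [h2, h2']
      · rw [h2'] at h1; exact h1.elim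
      · rw [h2] at h1'; exact h1'.elim
      · rw [h1, h1']
    have hb' : (g % 2 = 1) ↔ (g' % 2 = 1) := by
      by_cases x : g % 2 = 1 <;> by_cases y : g' % 2 = 1 <;> by_cases z : g / 2 ∈ c <;>
        simp_all
    omega

/-- Every step along the alternating cycle moves to the next position. -/
theorem Run.leaf? {dir : Bool} {e k g : ℕ} (h : Run π c dir e k g) {s i L}
    (he : (loc π c e).leaf? π = some (s, i, L)) :
    ∃ s' L', (loc π c g).leaf? π = some (s', i, L') ∧
      code s' ((π s' i).symm L') = code s ((π s i).symm L) + ((k * sgn dir : ℤ) : ZMod _) := by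
  induction h with
  | zero => exact ⟨s, L, he, by simp⟩
  | @succ k g h4 hr hg ih =>
    obtain ⟨s1, L1, h1, h2⟩ := ih
    obtain ⟨s2, i2, j2, hg⟩ := hg
    have hg0 := hg
    rw [loc_of_four_le π c h4] at hg
    have hstep : ∀ d, (loc π c (g / 2)).Seed ∨ (∃ s' j', loc π c (g / 2) = .cyc s' i2 j' dir) →
        (loc π c (g / 2)).step π d = .cyc s2 i2 j2 dir →
        i2 = i ∧ s2 = !s1 ∧ j2 = nxt s1 dir ((π s1 i).symm L1) := by
      rintro d (hs | ⟨s', j', hs⟩) hd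
      · obtain ⟨s3, i3, L3, h3, h4⟩ := hs.exists_leaf
        have := (h3 π).symm.trans h1
        cases this
        rw [h4] at hd
        cases hd
        exact ⟨rfl, rfl, rfl⟩
      · rw [hs] at hd h1
        cases h1
        cases d <;> simp only [Loc.step] at hd <;> cases hd
        simp
    have hk := hstep _ (by
      rcases Loc.of_step_eq_cyc hg with ⟨h, -⟩ | ⟨-, h⟩
      · exact .inl h
      · exact .inr h) hg
    obtain ⟨rfl, rfl, rfl⟩ := hk
    refine ⟨_, _, by rw [hg0]; rfl, ?_⟩
    rw [Equiv.symm_apply_apply, code_nxt, h2]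
    push_cast
    ring

/-- Every walk that is at a leaf has come along the cycle from a leaf reached from above. -/
theorem exists_run (hT : Closed T) {h : ℕ} (hh : h ∈ T) {x}
    (hx : (loc π c h).leaf? π = some x) :
    ∃ e ∈ T, e ≤ h ∧ (loc π c e).Seed ∧ ∃ dir k, Run π c dir e k h ∧
      k < (T.filter (· ≤ h)).card ∧ (k = 0 → (loc π c h).Seed) := by
  have hpos : ∀ g ∈ T, 0 < (T.filter (· ≤ g)).card := fun g hg =>
    Finset.card_pos.2 ⟨g, by simp [hg]⟩
  induction h using Nat.strong_induction_on generalizing x with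
  | _ h ih =>
    rcases Loc.seed_or_cyc π hx with hs | ⟨s, i, j, d, hc⟩
    · exact ⟨h, hh, le_rfl, hs, true, 0, .zero, hpos h hh, fun _ => hs⟩
    have h4 : 4 ≤ h := by
      by_contra h4
      rw [loc, dif_pos (by omega)] at hc
      split_ifs at hc
    have hg := (hT h hh).2 h4
    have hc0 := hc
    rw [loc_of_four_le π c h4] at hc
    have hcard : (T.filter (· ≤ h / 2)).card < (T.filter (· ≤ h)).card := by
      refine Finset.card_lt_card ?_
      rw [Finset.ssubset_iff_of_subset]
      · exact ⟨h, by simp [hh], by simp; omega⟩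
      · intro x hx
        simp only [Finset.mem_filter] at hx ⊢
        exact ⟨hx.1, by omega⟩
    rcases Loc.of_step_eq_cyc hc with ⟨h1, h2⟩ | ⟨-, s', j', h2⟩
    · refine ⟨h / 2, hg, by omega, h1, d, 1, .succ h4 .zero ⟨_, _, _, hc0⟩, ?_, by simp⟩
      have := hpos _ hg
      omega
    · obtain ⟨e, he, hle, hs, dir, k, hr, hk, hk0⟩ :=
        ih (h / 2) (by omega) hg (x := _) (by rw [h2]; rfl)
      have hd : dir = d := by
        rcases hr with _ | ⟨-, -, s3, i3, j3, h3⟩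
        · rw [h2] at hs; exact hs.elim
        · rw [h2] at h3; cases h3; rfl
      subst hd
      exact ⟨e, he, by omega, hs, dir, k + 1, .succ h4 hr ⟨_, _, _, hc0⟩, by omega, by simp⟩

/-- Two walks enter an alternating cycle from above, the second address being the earlier one, at
positions at distance at most `2 R`. -/
def PosClash (R : ℕ) (π : Welding n) (c : Finset ℕ) (h h' : ℕ) : Prop :=
  h' < h ∧ (loc π c h).Seed ∧ (loc π c h').Seed ∧ ∃ s s' i L L',
    (loc π c h).leaf? π = some (s, i, L) ∧ (loc π c h').leaf? π = some (s', i, L') ∧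
    ∃ d ∈ Finset.Icc (-(2 * R : ℤ)) (2 * R),
      code s ((π s i).symm L) = code s' ((π s' i).symm L') + (d : ZMod (2 ^ (n + 1)))

/-- A leaf reached along the cycle is new, when the positions where the cycle was entered before are
far from each other. -/
theorem leaf?_ne_of_cyc (hT : Closed T) (hR : 2 * T.card < 2 ^ n) {h : ℕ} (hh : h ∈ T)
    (hno : ∀ g ∈ T, g < h → ∀ g' ∈ T, ¬ PosClash T.card π c g g') {s i j d}
    (hc : loc π c h = .cyc s i j d) {g : ℕ} (hg : g ∈ T) (hgh : g < h) :
    (loc π c g).leaf? π ≠ some (s, i, π s i j) := by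
  intro hgl
  have hhl : (loc π c h).leaf? π = some (s, i, π s i j) := by rw [hc]; rfl
  obtain ⟨e, he, hle, hs, dir, k, hr, hk, hk0⟩ := exists_run hT hh hhl
  obtain ⟨e', he', hle', hs', dir', k', hr', hk', hk0'⟩ := exists_run hT hg hgl
  have hk1 : k ≠ 0 := fun h0 => by
    have := hk0 h0
    rw [hc] at this
    exact this
  have hcard : ∀ x, (T.filter (· ≤ x)).card ≤ T.card := fun x => Finset.card_filter_le _ _
  have hkT := hcard h
  have hkT' := hcard g
  obtain ⟨t, i1, L, hL, -⟩ := hs.exists_leaf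
  obtain ⟨t', i1', L', hL', -⟩ := hs'.exists_leaf
  obtain ⟨t1, L1, h1, hcode⟩ := hr.leaf? (hL π)
  obtain ⟨t1', L1', h1', hcode'⟩ := hr'.leaf? (hL' π)
  rw [hhl] at h1
  rw [hgl] at h1'
  cases h1
  cases h1'
  rw [hcode] at hcode'
  have hneh : e ≠ h := fun e0 => by
    rw [e0, hc] at hs
    exact hs
  have hsg : ∀ d, sgn d = 1 ∨ sgn d = -1 := by intro d; cases d <;> simp [sgn]
  rcases lt_trichotomy e e' with hlt | rfl | hlt
  · refine hno e' he' (by omega) e he ⟨hlt, hs', hs, t', t, i, L', L, hL' π, hL π,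
      k * sgn dir - k' * sgn dir', ?_, ?_⟩
    · rw [Finset.mem_Icc]
      rcases hsg dir with h | h <;> rcases hsg dir' with h' | h' <;> rw [h, h'] <;>
        constructor <;> omega
    · push_cast at hcode' ⊢
      linear_combination -hcode'
  · have hLL := (hL π).symm.trans (hL' π)
    cases hLL
    have hz : ((k * sgn dir - k' * sgn dir' : ℤ) : ZMod (2 ^ (n + 1))) = 0 := by
      push_cast at hcode' ⊢
      linear_combination hcode'
    rw [ZMod.intCast_zmod_eq_zero_iff_dvd] at hz
    have h3 : 2 ^ (n + 1) = 2 * 2 ^ n := by ring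
    have hzero := Int.eq_zero_of_abs_lt_dvd hz (by
      rw [abs_lt]
      rw [h3]
      rcases hsg dir with h | h <;> rcases hsg dir' with h' | h' <;> rw [h, h'] <;>
        constructor <;> push_cast <;> zify at hR hk hk' hkT hkT' <;> linarith)
    have hdd : dir = dir' ∧ k = k' := by
      cases dir <;> cases dir' <;> simp [sgn] at hzero ⊢ <;> omega
    obtain ⟨rfl, rfl⟩ := hdd
    have := hr.unique hr'
    omega
  · refine hno e he (by omega) e' he' ⟨hlt, hs, hs', t, t', i, L, L', hL π, hL' π,
      k' * sgn dir' - k * sgn dir, ?_, ?_⟩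
    · rw [Finset.mem_Icc]
      rcases hsg dir with h | h <;> rcases hsg dir' with h' | h' <;> rw [h, h'] <;>
        constructor <;> omega
    · push_cast at hcode' ⊢
      linear_combination hcode'

end Clash

theorem Loc.of_step_eq_desc {n : ℕ} {π : Welding n} {l : Loc n} {b : Bool} {i v}
    (h : l.step π b = .desc i v) :
    (∃ d k, l = .path d k) ∨ ∃ u : Node n, (u : ℕ) < 2 ^ n ∧ l = .desc i u := by
  rcases l with ⟨d, k⟩ | ⟨k, u⟩ | ⟨t, k, j', d'⟩ | ⟨t, k, w⟩ | ⟨t, k, u⟩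
  · exact .inl ⟨_, _, rfl⟩
  · simp only [Loc.step] at h
    split_ifs at h with hu
    cases h
    exact .inr ⟨u, hu, rfl⟩
  · cases b <;> simp only [Loc.step] at h <;> cases h
  · cases b <;> simp only [Loc.step] at h <;> cases h
  · simp only [Loc.step] at h
    split_ifs at h

theorem Loc.of_step_eq_path {n : ℕ} {π : Welding n} {l : Loc n} {b : Bool} {d i}
    (h : l.step π b = .path d i) :
    ∃ d k, l = .path d k := by
  rcases l with ⟨d, k⟩ | ⟨k, u⟩ | ⟨t, k, j', d'⟩ | ⟨t, k, w⟩ | ⟨t, k, u⟩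
  · exact ⟨_, _, rfl⟩
  · simp only [Loc.step] at h
    split_ifs at h with hu
  · cases b <;> simp only [Loc.step] at h <;> cases h
  · cases b <;> simp only [Loc.step] at h <;> cases h
  · simp only [Loc.step] at h
    split_ifs at h

/-- A block has `2 ^ m` leaves. -/
theorem card_blk_le {n m : ℕ} (hn : n = 2 * m) (B : ℕ) :
    ((Finset.univ : Finset (Fin (2 ^ n))).filter
      fun x => blk m ((Node.leaf x : Node n) : ℕ) = B).card ≤ 2 ^ m := by
  have : (Finset.range (2 ^ m)).card = 2 ^ m := Finset.card_range _
  rw [← this]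
  refine Finset.card_le_card_of_injOn (fun x => ((Node.leaf x : Node n) : ℕ) % 2 ^ m) ?_ ?_
  · intro x _
    exact Finset.mem_coe.2 (Finset.mem_range.2 (Nat.mod_lt _ (by positivity)))
  · intro x hx y hy e
    have hx := (Finset.mem_filter.1 (Finset.mem_coe.1 hx)).2
    have hy := (Finset.mem_filter.1 (Finset.mem_coe.1 hy)).2
    rw [← hy, blk, blk, Node.log_leaf, Node.log_leaf, show n - m = m by omega] at hx
    have e : ((Node.leaf x : Node n) : ℕ) % 2 ^ m = ((Node.leaf y : Node n) : ℕ) % 2 ^ m := e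
    apply Node.leaf_injective
    apply Subtype.ext
    rw [← Nat.div_add_mod ((Node.leaf x : Node n) : ℕ) (2 ^ m), hx, e, Nat.div_add_mod]

/-! ### Counting by switchings -/

section Switching

variable {n : ℕ} [NeZero n] {m : ℕ} {π : Welding n} {c T : Finset ℕ}

/-- Before `h` the walks do not depend on leaves not yet reached. -/
theorem loc_swapLeaves (hT : Closed T) {h : ℕ} (hh : h ∈ T) {s i L L'}
    (hno : ∀ g ∈ T, g < h → ∀ x, (loc π c g).leaf? π = some (s, i, x) → x ≠ L ∧ x ≠ L') :
    loc (swapLeaves π s i L L') c h = loc π c h := by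
  induction h using Nat.strong_induction_on with
  | _ h ih =>
    by_cases h4 : h < 4
    · rw [loc, dif_pos h4, loc, dif_pos h4]
    · have hg := (hT h hh).2 (by omega)
      rw [loc_of_four_le _ c (by omega), loc_of_four_le π c (by omega),
        ih (h / 2) (by omega) hg fun g hg hlt => hno g hg (by omega)]
      exact Loc.step_swapLeaves (hno _ hg (by omega)) _

/-- Walks that have not yet been on an alternating cycle do not depend on the cycles. -/
theorem loc_eq_of_desc (π' : Welding n) {h : ℕ} :
    (∀ d i, loc π c h = .path d i → loc π' c h = .path d i) ∧
      ∀ i v, loc π c h = .desc i v → loc π' c h = .desc i v := by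
  induction h using Nat.strong_induction_on with
  | _ h ih =>
    by_cases h4 : h < 4
    · have : loc π c h = loc π' c h := by rw [loc, dif_pos h4, loc, dif_pos h4]
      simp [this]
    · have hpath : (∃ d k, loc π c (h / 2) = .path d k) → loc π' c h = loc π c h := by
        rintro ⟨d, k, e⟩
        rw [loc_of_four_le π' c (by omega), loc_of_four_le π c (by omega),
          (ih _ (by omega)).1 _ _ e, e]
        cases d <;> cases (decide (h % 2 = 1) ^^ decide (h / 2 ∈ c)) <;> rfl
      have e0 := loc_of_four_le π c (show 4 ≤ h by omega)
      refine ⟨fun d i e => ?_, fun i v e => ?_⟩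
      · rw [hpath (Loc.of_step_eq_path (e0 ▸ e)), e]
      · rcases Loc.of_step_eq_desc (e0 ▸ e) with h1 | ⟨u, hu, h1⟩
        · rw [hpath h1, e]
        · rw [← e, loc_of_four_le π' c (by omega), loc_of_four_le π c (by omega),
            (ih _ (by omega)).2 _ _ h1, h1]
          simp only [Loc.step, if_pos hu]

/-- The leaf at `h` is reached by no earlier walk. -/
def Fresh (T : Finset ℕ) (c : Finset ℕ) (h : ℕ) (π : Welding n) (s : Bool) (i : Fin n)
    (L : Fin (2 ^ n)) : Prop :=
  ∀ g ∈ T, g < h → (loc π c g).leaf? π ≠ some (s, i, L)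

/-- `π'` arises from `π` by exchanging the leaf at `h` with a leaf reached by no earlier walk. -/
def Switch (T : Finset ℕ) (c : Finset ℕ) (h : ℕ) (π π' : Welding n) : Prop :=
  ∃ s i L L', (loc π c h).leaf? π = some (s, i, L) ∧ Fresh T c h π s i L' ∧
    π' = swapLeaves π s i L L'

open Classical in
/-- If every member of `V` reaches a new leaf at `h`, and few members of `V` lead to the same result
of an exchange, then `V` is small. -/
theorem card_switch (V : Finset (Welding n)) (h B : ℕ)
    (hV : ∀ π ∈ V, ∃ s i L, (loc π c h).leaf? π = some (s, i, L))
    (hB : ∀ π', (V.filter fun π => Switch T c h π π').card ≤ B) :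
    V.card * (2 ^ n - T.card) ≤ B * Fintype.card (Welding n) := by
  rw [mul_comm B]
  refine Finset.card_mul_le_card_mul (Switch T c h) (s := V) (t := Finset.univ)
    (fun π hπ => ?_) (fun π' _ => hB π')
  obtain ⟨s, i, L, hL⟩ := hV π hπ
  set M := (Finset.univ : Finset (Fin (2 ^ n))).filter fun x => Fresh T c h π s i x with hM
  set N := Mᶜ with hN
  have hNc : N.card ≤ T.card := by
    refine (Finset.card_le_card_of_injOn (s := N)
      (t := T.image fun g => (loc π c g).leaf? π) (fun x => some (s, i, x)) ?_ ?_).trans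
      Finset.card_image_le
    · intro x hx
      have hx : ¬ Fresh T c h π s i x := by simpa [hN, hM] using hx
      simp only [Fresh, not_forall, not_not] at hx
      obtain ⟨g, hg, -, e⟩ := hx
      exact Finset.mem_coe.2 (Finset.mem_image.2 ⟨g, hg, e⟩)
    · intro x _ y _ e
      simpa using e
  have hF : 2 ^ n - T.card ≤ M.card := by
    rw [hN, Finset.card_compl, Fintype.card_fin] at hNc
    omega
  refine hF.trans (Finset.card_le_card_of_injOn (fun x => swapLeaves π s i L x) ?_ ?_)
  · intro x hx
    exact Finset.mem_coe.2 (Finset.mem_filter.2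
      ⟨Finset.mem_univ _, s, i, L, x, hL, (Finset.mem_filter.1 hx).2, rfl⟩)
  · intro x _ y _ e
    have := congrArg (fun w : Welding n => w s i ((π s i).symm L)) e
    simpa [swapLeaves_apply_self] using this

/-- What an exchange at `h` leaves unchanged. -/
theorem switch_spec (hT : Closed T) {h : ℕ} {π' : Welding n} {s i L L'}
    (hf : Fresh T c h π s i L) (hf' : Fresh T c h π s i L') (e : π' = swapLeaves π s i L L') :
    (∀ g ∈ T, g ≤ h → loc π' c g = loc π c g) ∧
    (∀ g ∈ T, g < h → (loc π c g).leaf? π' = (loc π c g).leaf? π) ∧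
    (∀ g ∈ T, g < h → ∀ t k x, (loc π c g).leaf? π = some (t, k, x) →
      (π' t k).symm x = (π t k).symm x) := by
  have hno : ∀ g ∈ T, g < h → ∀ x, (loc π c g).leaf? π = some (s, i, x) → x ≠ L ∧ x ≠ L' := by
    intro g hg hlt x hx
    exact ⟨fun e => hf g hg hlt (e ▸ hx), fun e => hf' g hg hlt (e ▸ hx)⟩
  subst e
  refine ⟨fun g hg hle => ?_, fun g hg hlt => ?_, fun g hg hlt t k x hx => ?_⟩
  · exact loc_swapLeaves hT hg fun g' hg' hlt => hno g' hg' (by omega)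
  · exact Loc.leaf?_swapLeaves (hno g hg hlt)
  · rw [swapLeaves_symm_apply]
    intro y hy
    exact hno g hg hlt y (hy ▸ hx)

/-- No clash involves an address before `h`. -/
def NoClashBefore (m : ℕ) (T c : Finset ℕ) (h : ℕ) (π : Welding n) : Prop :=
  ∀ g ∈ T, g < h → ∀ g' ∈ T, ¬ BlockClash m π c g g' ∧ ¬ PosClash T.card π c g g'

open Classical in
/-- A first clash at `h` that consists in entering a block again. An exchange
affects only new leaves, so the block can be read off afterwards, and the leaf exchanged was one of
its `2 ^ m` leaves. -/
theorem card_blockClash (hn : n = 2 * m) (hT : Closed T) (hR : 2 * T.card < 2 ^ n) {h h' : ℕ}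
    (hh : h ∈ T) (hh' : h' ∈ T) :
    ((Finset.univ : Finset (Welding n)).filter fun π =>
      BlockClash m π c h h' ∧ NoClashBefore m T c h π).card * (2 ^ n - T.card) ≤
      2 ^ m * Fintype.card (Welding n) := by
  refine card_switch (T := T) (c := c) _ h _ (fun π hπ => ?_) (fun π' => ?_)
  · obtain ⟨s, i, j, d, hc, -⟩ := (Finset.mem_filter.1 hπ).2.1
    exact ⟨s, i, π s i j, by rw [hc]; rfl⟩
  -- the new leaf lies in a block that is known after the exchange
  set B : ℕ := match loc π' c h' with
    | .cyc s i j _ => blk m ((Node.leaf (π' s i j) : Node n) : ℕ)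
    | .desc _ v => blk m v
    | _ => 0 with hB
  have key : ∀ π, BlockClash m π c h h' → NoClashBefore m T c h π → Switch T c h π π' →
      ∃ s i j d, loc π' c h = .cyc s i j d ∧ blk m ((Node.leaf (π s i j) : Node n) : ℕ) = B ∧
        π = swapLeaves π' s i (π s i j) (π' s i j) := by
    rintro π ⟨s, i, j, d, hc, hcl⟩ hno ⟨s1, i1, L, L', hL, hf', rfl⟩
    rw [hc] at hL
    cases hL
    have hf : Fresh T c h π s i (π s i j) := fun g hg hlt =>
      leaf?_ne_of_cyc hT hR hh (fun g hg hlt g' hg' => (hno g hg hlt g' hg').2) hc hg hlt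
    obtain ⟨h1, h2, h3⟩ := switch_spec hT hf hf' rfl
    refine ⟨s, i, j, d, by rw [h1 h hh le_rfl, hc], ?_, ?_⟩
    · rcases hcl with ⟨hlt, j', d', hc', hb⟩ | ⟨rfl, v, hc', -, hb⟩
      · have e1 : loc (swapLeaves π s i (π s i j) L') c h' = .cyc s i j' d' := by
          rw [h1 h' hh' hlt.le, hc']
        have e2 := h2 h' hh' hlt
        rw [hc'] at e2
        simp only [Loc.leaf?, Option.some.injEq, Prod.mk.injEq, true_and] at e2
        rw [hB, e1, ← hb, ← e2]
      · have e1 := (loc_eq_of_desc (π := π) (c := c) (h := h')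
          (swapLeaves π false i (π false i j) L')).2 _ _ hc'
        rw [hB, e1, ← hb]
    · rw [swapLeaves_apply_self, Equiv.swap_apply_left, swapLeaves_swapLeaves]
  by_cases hex : ∃ s i j d, loc π' c h = .cyc s i j d
  · obtain ⟨s, i, j, d, hc⟩ := hex
    refine le_trans ?_ (card_blk_le hn B)
    refine Finset.card_le_card_of_injOn (fun π => π s i j) ?_ ?_
    · intro π hπ
      simp only [Finset.coe_filter, Finset.mem_univ, true_and, Finset.mem_filter,
        Set.mem_ofPred_eq] at hπ ⊢
      obtain ⟨s1, i1, j1, d1, h1, h2, h3⟩ := key π hπ.1.1 hπ.1.2 hπ.2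
      rw [hc] at h1
      cases h1
      exact h2
    · intro π hπ ρ hρ e
      simp only [Finset.coe_filter, Finset.mem_univ, true_and, Finset.mem_filter,
        Set.mem_ofPred_eq] at hπ hρ
      obtain ⟨s1, i1, j1, d1, h1, h2, h3⟩ := key π hπ.1.1 hπ.1.2 hπ.2
      obtain ⟨s2, i2, j2, d2, h4, h5, h6⟩ := key ρ hρ.1.1 hρ.1.2 hρ.2
      rw [hc] at h1 h4
      cases h1
      cases h4
      have e : π s i j = ρ s i j := e
      rw [h3, h6, e]
  · refine le_trans (le_of_eq (Finset.card_eq_zero.2 (Finset.filter_eq_empty_iff.2 ?_)))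
      (Nat.zero_le _)
    intro π hπ hs
    have hπ := (Finset.mem_filter.1 hπ).2
    obtain ⟨s1, i1, j1, d1, h1, -⟩ := key π hπ.1 hπ.2 hs
    exact hex ⟨_, _, _, _, h1⟩

open Classical in
/-- A first clash at `h` that consists in entering a cycle near an earlier entrance. The leaf is new
since different addresses have different places before the first clash. -/
theorem card_posClash (hn : n = 2 * m) (hm : 1 ≤ m) (hT : Closed T) {h h' : ℕ}
    (hh : h ∈ T) (hh' : h' ∈ T) :
    ((Finset.univ : Finset (Welding n)).filter fun π => Unlucky m π c T ∧
      PosClash T.card π c h h' ∧ NoClashBefore m T c h π).card * (2 ^ n - T.card) ≤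
      (4 * T.card + 1) * Fintype.card (Welding n) := by
  refine card_switch (T := T) (c := c) _ h _ (fun π hπ => ?_) (fun π' => ?_)
  · obtain ⟨-, -, -, s, s', i, L, L', hL, -⟩ := (Finset.mem_filter.1 hπ).2.2.1
    exact ⟨s, i, L, hL⟩
  -- the position of the leaf is close to one that is known after the exchange
  set P : ZMod (2 ^ (n + 1)) := match (loc π' c h').leaf? π' with
    | some (s, i, x) => code s ((π' s i).symm x)
    | none => 0 with hP
  have key : ∀ π, Unlucky m π c T → PosClash T.card π c h h' → NoClashBefore m T c h π →
      Switch T c h π π' → (loc π' c h).Seed ∧ ∃ s i L, (loc π' c h).leaf? π' = some (s, i, L) ∧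
        (∃ d ∈ Finset.Icc (-(2 * T.card : ℤ)) (2 * T.card),
          code s ((π s i).symm L) = P + (d : ZMod (2 ^ (n + 1)))) ∧
        π = swapLeaves π' s i L (π' s i ((π s i).symm L)) := by
    rintro π hu ⟨hlt, hs, hs', s, s', i, L, L1, hL, hL1, d, hd, hcode⟩ hno
      ⟨s1, i1, L0, L', hL', hf', rfl⟩
    rw [hL] at hL'
    cases hL'
    have hf : Fresh T c h π s i L := by
      intro g hg hgh e
      have : g = h := by
        refine eq_of_vert_eq (N := h) hn hm hT hu ?_ hg hh hgh.le le_rfl ?_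
        · intro g hg hle g' hg' hb
          rcases hle.lt_or_eq with hlt | rfl
          · exact (hno g hg hlt g' hg').1 hb
          · obtain ⟨t, k, j, d, hc, -⟩ := hb
            rw [hc] at hs
            exact hs
        · rw [Loc.vert_of_leaf? π e, Loc.vert_of_leaf? π hL]
      omega
    obtain ⟨h1, h2, h3⟩ := switch_spec hT hf hf' rfl
    have e1 := h1 h hh le_rfl
    rw [e1]
    obtain ⟨s2, i2, L2, h5, -⟩ := hs.exists_leaf
    have h6 := (h5 π).symm.trans hL
    cases h6
    refine ⟨hs, s, i, L, h5 _, ⟨d, hd, ?_⟩, ?_⟩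
    · rw [hcode, hP, h1 h' hh' hlt.le, h2 h' hh' hlt, hL1]
      simp only
      rw [h3 h' hh' hlt _ _ _ hL1]
    · rw [swapLeaves_apply_self, Equiv.apply_symm_apply, Equiv.swap_apply_left,
        swapLeaves_swapLeaves]
  by_cases hex : ∃ s i L, (loc π' c h).leaf? π' = some (s, i, L)
  · obtain ⟨s, i, L, hc⟩ := hex
    have hcard : (Finset.Icc (-(2 * T.card : ℤ)) (2 * T.card)).card = 4 * T.card + 1 := by
      rw [Int.card_Icc]; omega
    rw [← hcard]
    refine le_trans ?_ (Finset.card_image_le (s := Finset.Icc (-(2 * T.card : ℤ)) (2 * T.card))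
      (f := fun d : ℤ => P + (d : ZMod (2 ^ (n + 1)))))
    refine Finset.card_le_card_of_injOn (fun π => code s ((π s i).symm L)) ?_ ?_
    · intro π hπ
      simp only [Finset.coe_filter, Finset.mem_univ, true_and, Finset.mem_filter,
        Set.mem_ofPred_eq] at hπ
      obtain ⟨-, s1, i1, L1, h1, ⟨d, hd, h2⟩, h3⟩ := key π hπ.1.1 hπ.1.2.1 hπ.1.2.2 hπ.2
      rw [hc] at h1
      cases h1
      exact Finset.mem_coe.2 (Finset.mem_image.2 ⟨d, hd, h2.symm⟩)
    · intro π hπ ρ hρ e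
      simp only [Finset.coe_filter, Finset.mem_univ, true_and, Finset.mem_filter,
        Set.mem_ofPred_eq] at hπ hρ
      obtain ⟨-, s1, i1, L1, h1, -, h3⟩ := key π hπ.1.1 hπ.1.2.1 hπ.1.2.2 hπ.2
      obtain ⟨-, s2, i2, L2, h4, -, h6⟩ := key ρ hρ.1.1 hρ.1.2.1 hρ.1.2.2 hρ.2
      rw [hc] at h1 h4
      cases h1
      cases h4
      rw [h3, h6, code_injective s e]
  · refine le_trans (le_of_eq (Finset.card_eq_zero.2 (Finset.filter_eq_empty_iff.2 ?_)))
      (Nat.zero_le _)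
    intro π hπ hs
    have hπ := (Finset.mem_filter.1 hπ).2
    obtain ⟨-, s1, i1, L1, h1, -⟩ := key π hπ.1 hπ.2.1 hπ.2.2 hs
    exact hex ⟨_, _, _, h1⟩

open Classical in
/-- For fixed exchanges it is unlikely that a block is entered twice: consider the first clash. -/
theorem card_exists_blockClash (hn : n = 2 * m) (hm : 1 ≤ m) (hT : Closed T)
    (hR : 2 * T.card < 2 ^ n) :
    ((Finset.univ : Finset (Welding n)).filter fun π => Unlucky m π c T ∧
      ∃ h ∈ T, ∃ h' ∈ T, BlockClash m π c h h').card * (2 ^ n - T.card) ≤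
      T.card ^ 2 * (2 ^ m + 4 * T.card + 1) * Fintype.card (Welding n) := by
  set V1 : ℕ × ℕ → Finset (Welding n) := fun p => Finset.univ.filter fun π =>
    BlockClash m π c p.1 p.2 ∧ NoClashBefore m T c p.1 π with hV1
  set V2 : ℕ × ℕ → Finset (Welding n) := fun p => Finset.univ.filter fun π => Unlucky m π c T ∧
    PosClash T.card π c p.1 p.2 ∧ NoClashBefore m T c p.1 π with hV2
  have hsub : ((Finset.univ : Finset (Welding n)).filter fun π => Unlucky m π c T ∧
      ∃ h ∈ T, ∃ h' ∈ T, BlockClash m π c h h') ⊆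
      (T ×ˢ T).biUnion fun p => V1 p ∪ V2 p := by
    intro π hπ
    obtain ⟨hu, h, hh, h', hh', hc⟩ := (Finset.mem_filter.1 hπ).2
    have hex : ∃ h, h ∈ T ∧ ∃ h' ∈ T, BlockClash m π c h h' ∨ PosClash T.card π c h h' :=
      ⟨h, hh, h', hh', .inl hc⟩
    obtain ⟨h1, h2, h3, h4⟩ := Nat.find_spec hex
    have hno : NoClashBefore m T c (Nat.find hex) π := by
      intro g hg hlt g' hg'
      have := Nat.find_min hex hlt
      simp only [not_and, not_exists, not_or] at this
      exact this hg g' hg'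
    refine Finset.mem_biUnion.2 ⟨(Nat.find hex, h2), Finset.mem_product.2 ⟨h1, h3⟩, ?_⟩
    rcases h4 with h4 | h4
    · exact Finset.mem_union_left _ (Finset.mem_filter.2 ⟨Finset.mem_univ _, h4, hno⟩)
    · exact Finset.mem_union_right _ (Finset.mem_filter.2 ⟨Finset.mem_univ _, hu, h4, hno⟩)
  calc _ ≤ (∑ p ∈ T ×ˢ T, (V1 p ∪ V2 p).card) * (2 ^ n - T.card) :=
        Nat.mul_le_mul_right _ ((Finset.card_le_card hsub).trans Finset.card_biUnion_le)
    _ = ∑ p ∈ T ×ˢ T, (V1 p ∪ V2 p).card * (2 ^ n - T.card) := Finset.sum_mul _ _ _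
    _ ≤ ∑ p ∈ T ×ˢ T, (2 ^ m + 4 * T.card + 1) * Fintype.card (Welding n) := by
        refine Finset.sum_le_sum fun p hp => ?_
        obtain ⟨h1, h2⟩ := Finset.mem_product.1 hp
        have e1 := card_blockClash (c := c) hn hT hR h1 h2
        have e2 := card_posClash (c := c) hn hm hT h1 h2
        calc _ ≤ ((V1 p).card + (V2 p).card) * (2 ^ n - T.card) :=
              Nat.mul_le_mul_right _ (Finset.card_union_le _ _)
          _ ≤ _ := by rw [add_mul, add_assoc (2 ^ m), add_mul (2 ^ m)]; exact add_le_add e1 e2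
    _ = _ := by
        rw [Finset.sum_const, Finset.card_product, smul_eq_mul]
        ring

end Switching

/-! ### Explored parts of the graph that look like a forest -/

section Embeds

variable {n : ℕ} [NeZero n] {a b : Name n} {m : ℕ}

/-- The addresses up to the children of those in `E` are placed at different vertices, the vertices
with addresses in `E` have exactly the neighbours that their addresses suggest, and they do not
include the middle vertex. -/
structure Embeds (I : Instance n a b) (E : Finset ℕ) (v : ℕ → Vertex n) : Prop where
  start : v 2 = WeldedPath.start n
  finish : v 3 = WeldedPath.finish n
  injOn : Set.InjOn v (known E)
  adj : ∀ h ∈ E, ∀ w, I.graph.Adj (v h) w ↔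
    (4 ≤ h ∧ w = v (h / 2)) ∨ w = v (2 * h) ∨ w = v (2 * h + 1)
  ne_middle : ∀ h ∈ E, v h ≠ middle n

/-- No bad event occurs up to the children of the addresses in `E`. -/
def Good (m : ℕ) (E : Finset ℕ) (π : Welding n) (c : Finset ℕ) : Prop :=
  Unlucky m π c (known E) ∧ ∀ h ∈ known E, ∀ h' ∈ known E, ¬ BlockClash m π c h h'

theorem Good.injOn {E c : Finset ℕ} {π : Welding n} (hn : n = 2 * m) (hm : 1 ≤ m)
    (hE : Closed E) (hg : Good m E π c) :
    Set.InjOn (fun h => (loc π c h).vert π) (known E) := by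
  intro h hh h' hh' e
  exact eq_of_vert_eq (N := max h h') hn hm hE.closed_known hg.1
    (fun g hg1 _ g' hg2 => hg.2 g hg1 g' hg2) hh hh' (le_max_left _ _) (le_max_right _ _) e

theorem Good.embeds {E c : Finset ℕ} (hn : n = 2 * m) (hm : 1 ≤ m) (hE : Closed E)
    (I : Instance n a b) (hg : Good m E I.welding c) :
    Embeds I E fun h => (loc I.welding c h).vert I.welding where
  start := by simp only [loc_two]; rfl
  finish := by simp only [loc_three]; rfl
  injOn := hg.injOn hn hm hE
  adj h hh w := by
    have hk := hE.subset_known hh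
    have h2 := (hE h hh).1
    have hch : ∀ P : Bool → Prop, (P false ∨ P true) ↔
        (P (false ^^ decide (h ∈ c)) ∨ P (true ^^ decide (h ∈ c))) := by
      intro P
      by_cases hc : h ∈ c <;> simp [hc, or_comm]
    have e1 := loc_two_mul I.welding c h2 false
    have e2 := loc_two_mul I.welding c h2 true
    rw [Bool.toNat_false, add_zero] at e1
    rw [Bool.toNat_true] at e2
    simp only [e1, e2]
    rw [← hch fun d => w = ((loc I.welding c h).step I.welding d).vert I.welding]
    by_cases h4 : 4 ≤ h
    · have hT := hE.closed_known
      have hr := regular_loc hn hm hT hg.1 hk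
      have hr' := regular_loc hn hm hT hg.1 ((hT h hk).2 h4)
      have hp := loc_path hn hg.1 hk
      rw [adj_vert_iff (by omega) I _ hr (fun i e => (hp.1 i e).2 h4)
        (fun i e => (hp.2 i e).2 h4)]
      have := Loc.prev_step (π := I.welding) (by omega) _ hr'
        (decide (h % 2 = 1) ^^ decide (h / 2 ∈ c))
      rw [← loc_of_four_le _ _ h4] at this
      rw [this]
      simp [h4]
    · rw [adj_start_iff (by omega)]
      · simp [h4]
      · rcases (show h = 2 ∨ h = 3 by omega) with rfl | rfl
        · exact .inl (loc_two _ _)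
        · exact .inr (loc_three _ _)
  ne_middle h hh e := by
    have hp := loc_path hn hg.1 (hE.subset_known hh)
    generalize loc I.welding c h = l at e hp
    simp only [middle] at e
    rcases l with ⟨_ | _, k⟩ | ⟨k, u⟩ | ⟨t, k, j, d⟩ | ⟨t, k, w⟩ | ⟨t, k, u⟩
    · have := (hp.2 k rfl).1
      have := congrArg Fin.val (Vertex.path.inj e)
      simp only at this
      omega
    · have := (hp.1 k rfl).1
      have := congrArg Fin.val (Vertex.path.inj e)
      simp only at this
      omega
    · cases e
    · exact treeVertex_ne_path e
    · exact treeVertex_ne_path e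
    · exact treeVertex_ne_path e

variable {I : Instance n a b} {E : Finset ℕ} {v : ℕ → Vertex n}

theorem Embeds.adj_imp (hv : Embeds I E v) (hE : Closed E) {h h' : ℕ} (hh : h ∈ E) (hh' : h' ∈ E)
    (ha : I.graph.Adj (v h) (v h')) : (4 ≤ h ∧ h' = h / 2) ∨ (4 ≤ h' ∧ h = h' / 2) := by
  have hk : ∀ {x}, x ∈ E → x ∈ known E := fun hx => hE.subset_known hx
  have h2 := (hE h hh).1
  rcases (hv.adj h hh _).1 ha with ⟨h4, e⟩ | e | e
  · exact .inl ⟨h4, hv.injOn (hk hh') (hk ((hE h hh).2 h4)) e⟩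
  · have := hv.injOn (hk hh') (mem_known.2 (.inr (.inr (by
      rwa [Nat.mul_div_cancel_left _ (by norm_num)])))) e
    exact .inr ⟨by omega, by omega⟩
  · have := hv.injOn (hk hh') (mem_known.2 (.inr (.inr (by
      rwa [show (2 * h + 1) / 2 = h by omega])))) e
    exact .inr ⟨by omega, by omega⟩

theorem Embeds.ncard_le (hv : Embeds I E v) {h : ℕ} (hh : h ∈ E) :
    (I.graph.neighborSet (v h)).ncard ≤ 3 := by
  have hsub : I.graph.neighborSet (v h) ⊆ ({v (h / 2), v (2 * h), v (2 * h + 1)} : Finset _) := by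
    intro w hw
    rcases (hv.adj h hh w).1 hw with ⟨-, rfl⟩ | rfl | rfl <;> simp
  refine (Set.ncard_le_ncard hsub (Finset.finite_toSet _)).trans ?_
  rw [Set.ncard_coe_finset]
  exact Finset.card_le_three

/-- On a cycle the vertex with the largest address would have two neighbours of smaller address. -/
theorem Embeds.not_isCycle (hv : Embeds I E v) (hE : Closed E) {u : Vertex n}
    (w : I.graph.Walk u u) (hw : w.IsCycle) (hs : ∀ x ∈ w.support, ∃ h ∈ E, v h = x) : False := by
  obtain ⟨h, hh, hmax⟩ := (E.filter fun h => v h ∈ w.support).exists_max_image id (by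
    obtain ⟨h, hh, e⟩ := hs u w.start_mem_support
    exact ⟨h, Finset.mem_filter.2 ⟨hh, e ▸ w.start_mem_support⟩⟩)
  obtain ⟨hhE, hhs⟩ := Finset.mem_filter.1 hh
  have hw' := hw.rotate hhs
  have hmem : ∀ x ∈ (w.rotate _ hhs).support, x ∈ w.support := fun x hx =>
    (SimpleGraph.Walk.mem_support_rotate_iff _ _ hhs).1 hx
  have key : ∀ x ∈ (w.rotate _ hhs).support, I.graph.Adj (v h) x → x = v (h / 2) := by
    intro x hx ha
    obtain ⟨g, hg, rfl⟩ := hs x (hmem x hx)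
    have hgm := hmax g (Finset.mem_filter.2 ⟨hg, hmem _ hx⟩)
    have hg2 := (hE g hg).1
    rcases hv.adj_imp hE hhE hg ha with ⟨-, e⟩ | ⟨-, e⟩
    · rw [e]
    · simp only [id] at hgm
      omega
  have hnil : ¬ (w.rotate _ hhs).Nil := hw'.not_nil
  apply hw'.snd_ne_penultimate
  exact (key _ (SimpleGraph.Walk.getVert_mem_support _ _) (SimpleGraph.Walk.adj_snd hnil)).trans
    (key _ (SimpleGraph.Walk.getVert_mem_support _ _)
      (SimpleGraph.Walk.adj_penultimate hnil).symm).symm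

/-- The two components of the explored part are not joined. -/
theorem Embeds.not_walk (hv : Embeds I E v) (hE : Closed E)
    (w : I.graph.Walk (WeldedPath.start n) (WeldedPath.finish n))
    (hs : ∀ x ∈ w.support, ∃ h ∈ E, v h = x) : False := by
  -- the address `2` or `3` above a given one
  let rt : ℕ → ℕ := fun h => h / 2 ^ (Nat.log 2 h - 1)
  have hrt : ∀ h, 4 ≤ h → rt (h / 2) = rt h := by
    intro h h4
    have : 2 ≤ Nat.log 2 h := Nat.le_log_of_pow_le (by norm_num) (by omega)
    simp only [rt]
    rw [Nat.log_div_base, Nat.div_div_eq_div_mul, ← pow_succ']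
    congr 2
    omega
  have key : ∀ {x y} (p : I.graph.Walk x y), (∀ z ∈ p.support, ∃ h ∈ E, v h = z) →
      ∀ h ∈ E, ∀ h' ∈ E, v h = x → v h' = y → rt h = rt h' := by
    intro x y p
    induction p with
    | nil =>
      intro _ h hh h' hh' e e'
      rw [hv.injOn (hE.subset_known hh) (hE.subset_known hh') (e.trans e'.symm)]
    | @cons x z y hxz p ih =>
      intro hp h hh h' hh' e e'
      obtain ⟨g, hg, e2⟩ := hp z (by simp)
      rw [← ih (fun z hz => hp z (by simp [hz])) g hg h' hh' e2 e']
      subst e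
      subst e2
      rcases hv.adj_imp hE hh hg hxz with ⟨h4, e⟩ | ⟨h4, e⟩
      · rw [e, hrt h h4]
      · rw [e, hrt g h4]
  have h23 : 2 ∈ E ∧ 3 ∈ E := by
    obtain ⟨h, hh, e⟩ := hs _ w.start_mem_support
    obtain ⟨h', hh', e'⟩ := hs _ w.end_mem_support
    rw [← hv.start] at e
    rw [← hv.finish] at e'
    have := hv.injOn (hE.subset_known hh) (mem_known.2 (.inl rfl)) e
    have := hv.injOn (hE.subset_known hh') (mem_known.2 (.inr (.inl rfl))) e'
    subst_vars
    exact ⟨hh, hh'⟩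
  have := key w hs 2 h23.1 3 h23.2 hv.start hv.finish
  have e2 : Nat.log 2 2 = 1 := by decide
  have e3 : Nat.log 2 3 = 1 := by decide
  simp [rt, e2, e3] at this

end Embeds

/-! ### Most placements are good -/

section Count

variable {n : ℕ} [NeZero n] {m : ℕ}

open Classical in
/-- For a given welding, few exchanges lead to a long run of favourable steps. -/
theorem card_not_unlucky {E : Finset ℕ} (hE : Closed E) (π : Welding n) (m : ℕ) :
    (E.powerset.filter fun c => ¬ Unlucky m π c (known E)).card * 2 ^ (m - 1) ≤
      (known E).card * 2 ^ E.card := by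
  calc _ ≤ (∑ h ∈ known E, (E.powerset.filter fun c => m - 1 ≤ (loc π c h).luck).card) *
        2 ^ (m - 1) := by
        refine Nat.mul_le_mul_right _ ((Finset.card_le_card ?_).trans Finset.card_biUnion_le)
        intro c hc
        obtain ⟨h1, h2⟩ := Finset.mem_filter.1 hc
        simp only [Unlucky, not_forall, not_lt] at h2
        obtain ⟨h, hh, h3⟩ := h2
        exact Finset.mem_biUnion.2 ⟨h, hh, Finset.mem_filter.2 ⟨h1, h3⟩⟩
    _ ≤ ∑ h ∈ known E, 2 ^ E.card := by
        rw [Finset.sum_mul]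
        exact Finset.sum_le_sum fun h hh => card_luck_mul_le π hE (m - 1) hh
    _ = _ := by rw [Finset.sum_const, smul_eq_mul]

/-- An upper bound for the probability of a bad event when there are `t` addresses: the first term
is for long runs of favourable steps, the second for clashes in trees with `2 ^ (2 * m)` leaves. -/
noncomputable def badBound (m t : ℕ) : ℝ :=
  t / 2 ^ (m - 1) + t ^ 2 * (2 ^ m + 4 * t + 1) / (2 ^ (2 * m) - t)

open Classical in
/-- For most weldings and exchanges the addresses in `E` and their children are well placed. -/
theorem card_good (hn : n = 2 * m) (hm : 1 ≤ m) {E : Finset ℕ} (hE : Closed E)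
    (hR : 2 * (known E).card < 2 ^ n) :
    (1 - badBound m (known E).card) * (Fintype.card (Welding n) * 2 ^ E.card) ≤
      ((((Finset.univ : Finset (Welding n)) ×ˢ E.powerset).filter
        fun p => Good m E p.1 p.2).card : ℝ) := by
  set t := (known E).card with ht
  set W := Fintype.card (Welding n) with hW
  set S := (Finset.univ : Finset (Welding n)) ×ˢ E.powerset with hS
  set A := S.filter fun p => ¬ Unlucky m p.1 p.2 (known E) with hA
  set B := S.filter fun p => Unlucky m p.1 p.2 (known E) ∧
    ∃ h ∈ known E, ∃ h' ∈ known E, BlockClash m p.1 p.2 h h' with hB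
  have hScard : S.card = W * 2 ^ E.card := by
    rw [hS, Finset.card_product, Finset.card_powerset, Finset.card_univ]
  have hA1 : A.card * 2 ^ (m - 1) ≤ W * (t * 2 ^ E.card) := by
    rw [hA, Finset.card_filter, hS, Finset.sum_product, Finset.sum_mul]
    refine (Finset.sum_le_sum fun π _ => ?_).trans
      (le_of_eq (by rw [Finset.sum_const, smul_eq_mul, Finset.card_univ]))
    rw [← Finset.card_filter]
    exact card_not_unlucky hE π m
  have hB1 : B.card * (2 ^ n - t) ≤ 2 ^ E.card * (t ^ 2 * (2 ^ m + 4 * t + 1) * W) := by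
    rw [hB, Finset.card_filter, hS, Finset.sum_product_right, Finset.sum_mul]
    refine (Finset.sum_le_sum fun c _ => ?_).trans
      (le_of_eq (by rw [Finset.sum_const, smul_eq_mul, Finset.card_powerset]))
    rw [← Finset.card_filter]
    exact card_exists_blockClash hn hm hE.closed_known hR
  have hcov : S.card ≤ (S.filter fun p => Good m E p.1 p.2).card + A.card + B.card := by
    refine (Finset.card_le_card (t := (S.filter fun p => Good m E p.1 p.2) ∪ A ∪ B) ?_).trans
      ((Finset.card_union_le _ _).trans (Nat.add_le_add_right (Finset.card_union_le _ _) _))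
    intro p hp
    simp only [Finset.mem_union, hA, hB, Finset.mem_filter, hp, true_and]
    by_cases hu : Unlucky m p.1 p.2 (known E)
    · by_cases hc : ∃ h ∈ known E, ∃ h' ∈ known E, BlockClash m p.1 p.2 h h'
      · exact .inr ⟨hu, hc⟩
      · push Not at hc
        exact .inl (.inl ⟨hu, hc⟩)
    · exact .inl (.inr hu)
  have hA2 : (A.card : ℝ) ≤ t / 2 ^ (m - 1) * (W * 2 ^ E.card) := by
    rw [div_mul_eq_mul_div, le_div_iff₀ (by positivity)]
    calc (A.card : ℝ) * 2 ^ (m - 1) ≤ W * (t * 2 ^ E.card) := by exact_mod_cast hA1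
      _ = _ := by ring
  have hpos : (0 : ℝ) < 2 ^ (2 * m) - t := by
    rw [sub_pos, ← hn]
    exact_mod_cast (by omega : t < 2 ^ n)
  have hB2 : (B.card : ℝ) ≤ t ^ 2 * (2 ^ m + 4 * t + 1) / (2 ^ (2 * m) - t) *
      (W * 2 ^ E.card) := by
    rw [div_mul_eq_mul_div, le_div_iff₀ hpos, ← hn]
    have : ((2 ^ n - t : ℕ) : ℝ) = 2 ^ n - t := by
      rw [Nat.cast_sub (by omega)]
      push_cast
      rfl
    rw [← this]
    calc (B.card : ℝ) * ((2 ^ n - t : ℕ) : ℝ)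
        ≤ 2 ^ E.card * (t ^ 2 * (2 ^ m + 4 * t + 1) * W) := by exact_mod_cast hB1
      _ = _ := by ring
  have hcov' : (W * 2 ^ E.card : ℝ) ≤
      (S.filter fun p => Good m E p.1 p.2).card + A.card + B.card := by
    rw [hScard] at hcov
    exact_mod_cast hcov
  rw [badBound]
  linarith

end Count

/-! ### Counting names and instances -/

/-- There are many injections with given values on a finite set that avoid the values in `F`. -/
theorem exists_extensions {α β : Type*} [Fintype α] [Fintype β] (K : Finset ℕ) (v : ℕ → α)
    (z : ℕ → β) (F : Finset β) (hv : Set.InjOn v K) (hz : Set.InjOn z K)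
    (hF : ∀ u ∈ F, ∀ h ∈ K, z h ≠ u) :
    ∃ A : Finset (α ↪ β),
      (Fintype.card β - K.card - F.card).descFactorial (Fintype.card α - K.card) = A.card ∧
      ∀ f ∈ A, (∀ h ∈ K, f (v h) = z h) ∧ ∀ u ∈ F, ∀ x, f x ≠ u := by
  classical
  set X := K.image v with hX
  set Y := K.image z ∪ F with hY
  have hXc : X.card = K.card := Finset.card_image_of_injOn hv
  have hYc : Y.card = K.card + F.card := by
    rw [hY, Finset.card_union_of_disjoint, Finset.card_image_of_injOn hz]
    rw [Finset.disjoint_left]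
    intro y hy hyF
    obtain ⟨h, hh, rfl⟩ := Finset.mem_image.1 hy
    exact hF _ hyF h hh rfl
  have hcard : Fintype.card ({x // x ∈ Xᶜ} ↪ {y // y ∈ Yᶜ}) =
      (Fintype.card β - K.card - F.card).descFactorial (Fintype.card α - K.card) := by
    rw [Fintype.card_embedding_eq, Fintype.card_coe, Fintype.card_coe, Finset.card_compl,
      Finset.card_compl, hXc, hYc, Nat.sub_sub]
  have hpre : ∀ x, x ∈ X → ∃ h ∈ K, v h = x := fun x hx => by simpa [hX] using hx
  -- a given injection on the complement is extended by the given values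
  let e : ({x // x ∈ Xᶜ} ↪ {y // y ∈ Yᶜ}) → α → β := fun g x =>
    if hx : x ∈ X then z (hpre x hx).choose else (g ⟨x, Finset.mem_compl.2 hx⟩ : β)
  have he1 : ∀ g, ∀ h ∈ K, e g (v h) = z h := by
    intro g h hh
    have hx : v h ∈ X := Finset.mem_image_of_mem v hh
    have hc := (hpre _ hx).choose_spec
    simp only [e, dif_pos hx]
    rw [hv hc.1 hh hc.2]
  have he2 : ∀ g x (hx : x ∉ X), e g x = (g ⟨x, Finset.mem_compl.2 hx⟩ : β) := by
    intro g x hx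
    simp only [e, dif_neg hx]
  have he3 : ∀ g x, x ∉ X → e g x ∉ Y := by
    intro g x hx
    rw [he2 g x hx]
    exact Finset.mem_compl.1 (g ⟨x, _⟩).2
  have hinj : ∀ g, Function.Injective (e g) := by
    intro g x y hxy
    by_cases hx : x ∈ X <;> by_cases hy : y ∈ X
    · obtain ⟨h, hh, rfl⟩ := hpre x hx
      obtain ⟨h', hh', rfl⟩ := hpre y hy
      rw [he1 g h hh, he1 g h' hh'] at hxy
      rw [hz hh hh' hxy]
    · obtain ⟨h, hh, rfl⟩ := hpre x hx
      rw [he1 g h hh] at hxy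
      exact absurd (hxy ▸ Finset.mem_union_left _ (Finset.mem_image_of_mem z hh)) (he3 g y hy)
    · obtain ⟨h, hh, rfl⟩ := hpre y hy
      rw [he1 g h hh] at hxy
      exact absurd (hxy ▸ Finset.mem_union_left _ (Finset.mem_image_of_mem z hh)) (he3 g x hx)
    · rw [he2 g x hx, he2 g y hy] at hxy
      exact congrArg Subtype.val (g.injective (Subtype.ext hxy))
  have hE : Function.Injective fun g => (⟨e g, hinj g⟩ : α ↪ β) := by
    intro g g' hgg
    ext x
    have hx := Finset.mem_compl.1 x.2
    have h1 : e g x = e g' x := DFunLike.congr_fun hgg (x : α)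
    rw [he2 g x hx, he2 g' x hx] at h1
    exact h1
  refine ⟨Finset.univ.map ⟨_, hE⟩, by rw [Finset.card_map, Finset.card_univ, hcard], ?_⟩
  intro f hf
  obtain ⟨g, -, rfl⟩ := Finset.mem_map.1 hf
  refine ⟨he1 g, fun u hu x hxu => ?_⟩
  have hxu : e g x = u := hxu
  by_cases hx : x ∈ X
  · obtain ⟨h, hh, rfl⟩ := hpre x hx
    rw [he1 g h hh] at hxu
    exact hF u hu h hh hxu
  · exact he3 g x hx (hxu ▸ Finset.mem_union_right _ hu)

theorem card_embeddings_le {α β : Type*} [Fintype α] [Fintype β] {x y : α} {a b : β}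
    [Fintype {f : α ↪ β // f x = a ∧ f y = b}] (hxy : x ≠ y) (hab : a ≠ b) :
    Fintype.card {f : α ↪ β // f x = a ∧ f y = b} ≤
      (Fintype.card β - 2).descFactorial (Fintype.card α - 2) := by
  classical
  have hcard : Fintype.card ({w // w ∈ ({x, y} : Finset α)ᶜ} ↪ {w // w ∈ ({a, b} : Finset β)ᶜ}) =
      (Fintype.card β - 2).descFactorial (Fintype.card α - 2) := by
    rw [Fintype.card_embedding_eq, Fintype.card_coe, Fintype.card_coe, Finset.card_compl,
      Finset.card_compl, Finset.card_pair hxy, Finset.card_pair hab]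
  rw [← hcard]
  refine Fintype.card_le_of_injective (fun f => ⟨fun w => ⟨f.1 w, ?_⟩, ?_⟩) ?_
  · have hw := w.2
    simp only [Finset.mem_compl, Finset.mem_insert, Finset.mem_singleton, not_or] at hw ⊢
    exact ⟨fun h => hw.1 (f.1.injective (h.trans f.2.1.symm)),
      fun h => hw.2 (f.1.injective (h.trans f.2.2.symm))⟩
  · intro w w' h
    exact Subtype.ext (f.1.injective (congrArg Subtype.val h))
  · intro f g h
    apply Subtype.ext
    ext w
    by_cases hwx : w = x
    · rw [hwx, f.2.1, g.2.1]
    by_cases hwy : w = y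
    · rw [hwy, f.2.2, g.2.2]
    have := DFunLike.congr_fun h (⟨w, by simp [hwx, hwy]⟩ : {w // w ∈ ({x, y} : Finset α)ᶜ})
    exact congrArg Subtype.val this

theorem card_name (n : ℕ) : Fintype.card (Name n) = 2 ^ (2 * n) := by simp [Name]

section Instances

variable {n : ℕ} [NeZero n] {a b : Name n} {m : ℕ}

noncomputable instance Instance.fintype : Fintype (Instance n a b) := Fintype.ofFinite _

/-- The listings of the outer endpoints of the hung edges. -/
abbrev Listing (n : ℕ) : Type := Fin (Fintype.card (Spoke n)) ≃ Spoke n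

/-- The number of ways to name the vertices when `k` of them have got names already and `f` names
are excluded. -/
def namings (n k f : ℕ) : ℕ :=
  (2 ^ (2 * n) - k - f).descFactorial (Fintype.card (Vertex n) - k)

/-- The instance with given bijections, listing and names. -/
def mkInstance (π : Welding n) (ρ : Listing n) (f : Vertex n ↪ Name n) (hs : f (start n) = a)
    (ht : f (finish n) = b) : Instance n a b := ⟨π false, π true, ρ, f, hs, ht⟩

theorem welding_mkInstance (π : Welding n) (ρ : Listing n) (f : Vertex n ↪ Name n)
    (hs : f (start n) = a) (ht : f (finish n) = b) : (mkInstance π ρ f hs ht).welding = π := by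
  funext s
  cases s <;> rfl

theorem Instance.ext' {I J : Instance n a b} (h1 : I.welding = J.welding) (h2 : I.top = J.top)
    (h3 : I.name = J.name) : I = J := by
  have e1 : I.weldLeft = J.weldLeft := congrFun h1 false
  have e2 : I.weldRight = J.weldRight := congrFun h1 true
  cases I
  cases J
  simp_all

theorem card_instance_le (hn : 2 ≤ n) (hab : a ≠ b) :
    Fintype.card (Instance n a b) ≤
      Fintype.card (Welding n) * Fintype.card (Listing n) * namings n 2 0 := by
  classical
  have hne : start n ≠ finish n := by
    intro h
    have := congrArg Fin.val (Vertex.path.inj h)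
    simp only at this
    omega
  have h1 := card_embeddings_le (α := Vertex n) (β := Name n) hne hab
  rw [card_name n] at h1
  refine le_trans ?_ (Nat.mul_le_mul_left _ (show _ ≤ namings n 2 0 by simpa [namings] using h1))
  rw [← Fintype.card_prod, ← Fintype.card_prod]
  refine Fintype.card_le_of_injective (fun I => ((I.welding, I.top), ⟨I.name,
    I.name_start, I.name_finish⟩)) ?_
  intro I J h
  simp only [Prod.mk.injEq, Subtype.mk.injEq] at h
  exact Instance.ext' h.1.1 h.1.2 h.2

/-! ### States of a query algorithm -/

/-- The names in the answer when the vertex with address `h` is explored and `z` gives the names. -/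
def answer (z : ℕ → Name n) (h : ℕ) : Finset (Name n) :=
  {z (2 * h), z (2 * h + 1)} ∪ if 4 ≤ h then {z (h / 2)} else ∅

/-- What a query algorithm knows: the explored addresses, names for the known addresses, and names
that have turned out not to belong to a vertex. -/
structure IsState (a b : Name n) (Q : Finset ℕ) (z : ℕ → Name n) (F : Finset (Name n)) :
    Prop where
  closed : Closed Q
  injOn : Set.InjOn z (known Q)
  start : z 2 = a
  finish : z 3 = b
  ne : ∀ u ∈ F, ∀ h ∈ known Q, z h ≠ u

/-- The oracle has given the answers recorded in a state. -/
structure Explored (I : Instance n a b) (Q : Finset ℕ) (z : ℕ → Name n) (F : Finset (Name n)) :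
    Prop where
  oracle_name : ∀ h ∈ Q, I.oracle (z h) = some (answer z h)
  oracle_fail : ∀ u ∈ F, I.oracle u = none

/-- The names recorded in a state belong to a part of the graph that looks like a forest. -/
def Nice (I : Instance n a b) (Q : Finset ℕ) (z : ℕ → Name n) (F : Finset (Name n)) : Prop :=
  Explored I Q z F ∧ ∃ v, Embeds I (known Q) v ∧ ∀ h ∈ known Q, I.name (v h) = z h

theorem oracle_eq_none {I : Instance n a b} {u : Name n} :
    I.oracle u = none ↔ ∀ x, I.name x ≠ u := by
  classical
  simp [Instance.oracle]

theorem oracle_eq_answer {I : Instance n a b} {Q : Finset ℕ} {z : ℕ → Name n} {v : ℕ → Vertex n}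
    (hQ : Closed Q) (hv : Embeds I (known Q) v) (hz : ∀ h ∈ known Q, I.name (v h) = z h) {h : ℕ}
    (hh : h ∈ Q) : I.oracle (z h) = some (answer z h) := by
  classical
  have hk := hQ.subset_known hh
  have hex : ∃ x, I.name x = z h := ⟨v h, hz h hk⟩
  have h1 : 2 * h ∈ known Q := mem_known.2 (.inr (.inr (by
    rwa [Nat.mul_div_cancel_left _ (by norm_num)])))
  have h2 : 2 * h + 1 ∈ known Q := mem_known.2 (.inr (.inr (by
    rwa [show (2 * h + 1) / 2 = h by omega])))
  have h3 : 4 ≤ h → h / 2 ∈ known Q := fun h4 => hQ.subset_known ((hQ h hh).2 h4)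
  rw [Instance.oracle, if_pos hex]
  congr 1
  ext w
  simp only [Finset.mem_filter, Finset.mem_univ, true_and, answer, Finset.mem_union,
    Finset.mem_insert, Finset.mem_singleton]
  constructor
  · rintro ⟨x, y, hx, rfl, hxy⟩
    have hxv : x = v h := I.name.injective (hx.trans (hz h hk).symm)
    subst hxv
    rcases (hv.adj h hk y).1 hxy with ⟨h4, rfl⟩ | rfl | rfl
    · right; rw [if_pos h4, hz _ (h3 h4)]; simp
    · left; left; exact hz _ h1
    · left; right; exact hz _ h2
  · rintro ((rfl | rfl) | hw)
    · exact ⟨v h, _, hz h hk, hz _ h1, (hv.adj h hk _).2 (.inr (.inl rfl))⟩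
    · exact ⟨v h, _, hz h hk, hz _ h2, (hv.adj h hk _).2 (.inr (.inr rfl))⟩
    · split_ifs at hw with h4
      · rw [Finset.mem_singleton.1 hw]
        exact ⟨v h, _, hz h hk, hz _ (h3 h4), (hv.adj h hk _).2 (.inl ⟨h4, rfl⟩)⟩
      · simp at hw

/-- The exchanges at explored addresses can be read off from the places. -/
theorem eq_of_vert_loc_eq {π : Welding n} {Q c c' : Finset ℕ} (hn : 1 ≤ n) (hQ : Closed Q)
    (hc : c ⊆ Q) (hc' : c' ⊆ Q) (hr : ∀ h ∈ Q, (loc π c h).Regular)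
    (h : ∀ h ∈ known Q, (loc π c h).vert π = (loc π c' h).vert π) : c = c' := by
  ext g
  induction g using Nat.strong_induction_on with
  | _ g ih =>
    by_cases hg : g ∈ Q
    · have e := loc_congr π ih
      have h1 : 2 * g ∈ known Q := mem_known.2 (.inr (.inr (by
        rwa [Nat.mul_div_cancel_left _ (by norm_num)])))
      have e1 := loc_two_mul π c (hQ g hg).1 false
      have e2 := loc_two_mul π c' (hQ g hg).1 false
      rw [Bool.toNat_false, add_zero, Bool.false_xor] at e1 e2
      have h2 := h _ h1
      rw [e1, e2, ← e] at h2
      have hne := Loc.vert_step_ne (π := π) hn _ (hr g hg)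
      by_cases x : g ∈ c <;> by_cases y : g ∈ c' <;> simp only [x, y] at h2 ⊢
      · exact (hne (by simpa using h2)).elim
      · exact (hne (by simpa using h2.symm)).elim
    · exact ⟨fun x => absurd (hc x) hg, fun x => absurd (hc' x) hg⟩

open Classical in
/-- The exchanges at explored addresses that can be continued to a good placement one generation
further. -/
theorem card_good_inter (hn : n = 2 * m) (hm : 1 ≤ m) {Q : Finset ℕ} (hQ : Closed Q)
    (hR : 2 * (6 + 4 * Q.card) < 2 ^ n) :
    (1 - badBound m (6 + 4 * Q.card)) * (Fintype.card (Welding n) * 2 ^ Q.card) ≤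
      ((((Finset.univ : Finset (Welding n)) ×ˢ Q.powerset).filter fun p =>
        ∃ c ⊆ known Q, c ∩ Q = p.2 ∧ Good m (known Q) p.1 c).card : ℝ) := by
  have hE := hQ.closed_known
  have hcard : (known (known Q)).card = 6 + 4 * Q.card := by
    rw [hE.card_known, hQ.card_known]; ring
  have h1 := card_good (n := n) hn hm hE (by rwa [hcard])
  rw [hcard] at h1
  set A := ((Finset.univ : Finset (Welding n)) ×ˢ (known Q).powerset).filter
    fun p => Good m (known Q) p.1 p.2 with hA
  set B := (((Finset.univ : Finset (Welding n)) ×ˢ Q.powerset).filter fun p =>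
        ∃ c ⊆ known Q, c ∩ Q = p.2 ∧ Good m (known Q) p.1 c) with hB
  have hAB : A.card ≤ 2 ^ (known Q \ Q).card * B.card := by
    refine (Finset.card_le_mul_card_image (f := fun p : Welding n × Finset ℕ => (p.1, p.2 ∩ Q))
      A (2 ^ (known Q \ Q).card) ?_).trans (Nat.mul_le_mul_left _ (Finset.card_le_card ?_))
    · rintro ⟨π, c⟩ -
      rw [← Finset.card_powerset]
      refine Finset.card_le_card_of_injOn (fun p => p.2 \ Q) ?_ ?_
      · intro p hp
        have hp := (Finset.mem_filter.1 (Finset.mem_filter.1 (Finset.mem_coe.1 hp)).1).1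
        have := Finset.mem_powerset.1 (Finset.mem_product.1 hp).2
        exact Finset.mem_coe.2 (Finset.mem_powerset.2 (Finset.sdiff_subset_sdiff this le_rfl))
      · intro p hp p' hp' e
        have hp := (Finset.mem_filter.1 (Finset.mem_coe.1 hp)).2
        have hp' := (Finset.mem_filter.1 (Finset.mem_coe.1 hp')).2
        have e : p.2 \ Q = p'.2 \ Q := e
        have e2 := hp.trans hp'.symm
        simp only [Prod.mk.injEq] at e2
        refine Prod.ext e2.1 ?_
        rw [← Finset.sdiff_union_inter p.2 Q, ← Finset.sdiff_union_inter p'.2 Q, e, e2.2]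
    · intro p hp
      obtain ⟨⟨π, c⟩, hc, rfl⟩ := Finset.mem_image.1 hp
      obtain ⟨h2, h3⟩ := Finset.mem_filter.1 hc
      have h4 := Finset.mem_powerset.1 (Finset.mem_product.1 h2).2
      exact Finset.mem_filter.2 ⟨Finset.mem_product.2 ⟨Finset.mem_univ _,
        Finset.mem_powerset.2 Finset.inter_subset_right⟩, c, h4, rfl, h3⟩
  have hpow : (2 : ℝ) ^ (known Q).card = 2 ^ (known Q \ Q).card * 2 ^ Q.card := by
    rw [← pow_add, Finset.card_sdiff_add_card_eq_card hQ.subset_known]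
  rw [hpow] at h1
  have hAB' : (A.card : ℝ) ≤ 2 ^ (known Q \ Q).card * B.card := by exact_mod_cast hAB
  have hpos : (0 : ℝ) < 2 ^ (known Q \ Q).card := by positivity
  refine le_of_mul_le_mul_left ?_ hpos
  refine le_trans (le_of_eq ?_) (h1.trans hAB')
  ring

open Classical in
/-- Many instances are compatible with a given state: each choice of a welding, of exchanges that
admit a good placement, of a top cycle and of the remaining names gives a different one. -/
theorem card_nice (hn : n = 2 * m) (hm : 1 ≤ m) {Q : Finset ℕ} {z : ℕ → Name n}
    {F : Finset (Name n)} (hS : IsState a b Q z F) (hR : 2 * (6 + 4 * Q.card) < 2 ^ n) :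
    (1 - badBound m (6 + 4 * Q.card)) * (Fintype.card (Welding n) * 2 ^ Q.card) *
      (Fintype.card (Listing n) * namings n (2 + 2 * Q.card) F.card) ≤
      (((Finset.univ : Finset (Instance n a b)).filter fun I => Nice I Q z F).card : ℝ) := by
  set B := (((Finset.univ : Finset (Welding n)) ×ˢ Q.powerset).filter fun p =>
        ∃ c ⊆ known Q, c ∩ Q = p.2 ∧ Good m (known Q) p.1 c) with hB
  have hQ := hS.closed
  have hloc : ∀ p ∈ B, ∃ c, Good m (known Q) p.1 c ∧
      ∀ h ∈ known Q, loc p.1 p.2 h = loc p.1 c h := by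
    intro p hp
    obtain ⟨-, c, -, h2, h3⟩ := Finset.mem_filter.1 hp
    exact ⟨c, h3, fun h hh => by rw [← h2, loc_inter p.1 hQ c hh]⟩
  set S : (Welding n × Finset ℕ) × Listing n → Finset (Instance n a b) := fun q =>
    Finset.univ.filter fun I => I.welding = q.1.1 ∧ I.top = q.2 ∧
      (∀ h ∈ known Q, I.name ((loc q.1.1 q.1.2 h).vert q.1.1) = z h) ∧
      ∀ u ∈ F, ∀ x, I.name x ≠ u with hSdef
  have hsub : (B ×ˢ (Finset.univ : Finset (Listing n))).biUnion S ⊆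
      (Finset.univ : Finset (Instance n a b)).filter fun I => Nice I Q z F := by
    intro I hI
    obtain ⟨⟨p, ρ⟩, hp, hI⟩ := Finset.mem_biUnion.1 hI
    obtain ⟨-, hw, -, hz, hF⟩ := Finset.mem_filter.1 hI
    obtain ⟨c, hc, hl⟩ := hloc p (Finset.mem_product.1 hp).1
    simp only at hw hz
    rw [← hw] at hc hl hz
    have hv := hc.embeds hn hm hQ.closed_known I
    have hz' : ∀ h ∈ known Q, I.name ((loc I.welding c h).vert I.welding) = z h :=
      fun h hh => by rw [← hl h hh]; exact hz h hh
    exact Finset.mem_filter.2 ⟨Finset.mem_univ _,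
      ⟨fun h hh => oracle_eq_answer hQ hv hz' hh, fun u hu => oracle_eq_none.2 (hF u hu)⟩,
      _, hv, hz'⟩
  have hdisj : ∀ q ∈ B ×ˢ (Finset.univ : Finset (Listing n)),
      ∀ q' ∈ B ×ˢ (Finset.univ : Finset (Listing n)), q ≠ q' → Disjoint (S q) (S q') := by
    rintro ⟨⟨π, c⟩, ρ⟩ hq ⟨⟨π', c'⟩, ρ'⟩ hq' hne
    rw [Finset.disjoint_left]
    intro I hI hI'
    obtain ⟨-, h1, h2, h3, -⟩ := Finset.mem_filter.1 hI
    obtain ⟨-, h1', h2', h3', -⟩ := Finset.mem_filter.1 hI'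
    simp only at h1 h2 h3 h1' h2' h3'
    subst h1 h2 h1' h2'
    apply hne
    have hpB := (Finset.mem_product.1 hq).1
    have hpB' := (Finset.mem_product.1 hq').1
    have hc := Finset.mem_powerset.1 (Finset.mem_product.1 (Finset.mem_filter.1 hpB).1).2
    have hc' := Finset.mem_powerset.1 (Finset.mem_product.1 (Finset.mem_filter.1 hpB').1).2
    obtain ⟨d, hd, hl⟩ := hloc _ hpB
    have : c = c' := by
      refine eq_of_vert_loc_eq (π := I.welding) (by omega) hQ hc hc' ?_ ?_
      · intro h hh
        rw [hl h (hQ.subset_known hh)]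
        exact regular_loc hn hm hQ.closed_known.closed_known hd.1
          (hQ.closed_known.subset_known (hQ.subset_known hh))
      · intro h hh
        exact I.name.injective ((h3 h hh).trans (h3' h hh).symm)
    rw [this]
  have hcardS : ∀ q ∈ B ×ˢ (Finset.univ : Finset (Listing n)),
      namings n (2 + 2 * Q.card) F.card ≤ (S q).card := by
    rintro ⟨⟨π, c⟩, ρ⟩ hq
    obtain ⟨d, hd, hl⟩ := hloc _ (Finset.mem_product.1 hq).1
    have hinj := hd.injOn hn hm hQ.closed_known
    simp only at hl hd
    have hv : Set.InjOn (fun h => (loc π c h).vert π) (known Q) := by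
      intro h hh h' hh' e
      refine hinj (hQ.closed_known.subset_known hh) (hQ.closed_known.subset_known hh') ?_
      simp only at e ⊢
      rwa [← hl h hh, ← hl h' hh']
    obtain ⟨A, h1, hA⟩ :=
      exists_extensions (known Q) (fun h => (loc π c h).vert π) z F hv hS.injOn hS.ne
    rw [card_name n, hQ.card_known] at h1
    refine (show namings n (2 + 2 * Q.card) F.card = _ from h1).le.trans ?_
    have hst : ∀ f : Vertex n ↪ Name n, (∀ h ∈ known Q, f ((loc π c h).vert π) = z h) →
        f (start n) = a ∧ f (finish n) = b := by
      intro f hf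
      have h2 := hf 2 (mem_known.2 (.inl rfl))
      have h3 := hf 3 (mem_known.2 (.inr (.inl rfl)))
      rw [loc_two, hS.start] at h2
      rw [loc_three, hS.finish] at h3
      exact ⟨h2, h3⟩
    refine Finset.card_le_card_of_surjOn (fun I => I.name) ?_
    intro f hf
    obtain ⟨hf1, hf2⟩ := hA f (Finset.mem_coe.1 hf)
    refine ⟨mkInstance π ρ f (hst f hf1).1 (hst f hf1).2, Finset.mem_coe.2 (Finset.mem_filter.2
      ⟨Finset.mem_univ _, welding_mkInstance _ _ _ _ _, rfl, hf1, hf2⟩), rfl⟩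
  have hsum : B.card * Fintype.card (Listing n) * namings n (2 + 2 * Q.card) F.card ≤
      ((Finset.univ : Finset (Instance n a b)).filter fun I => Nice I Q z F).card := by
    refine le_trans ?_ (Finset.card_le_card hsub)
    rw [Finset.card_biUnion hdisj]
    have := Finset.card_nsmul_le_sum _ _ _ hcardS
    rwa [Finset.card_product, Finset.card_univ, smul_eq_mul] at this
  have hB1 := card_good_inter hn hm hQ hR
  calc _ ≤ (B.card : ℝ) * (Fintype.card (Listing n) * namings n (2 + 2 * Q.card) F.card) :=
        mul_le_mul_of_nonneg_right hB1 (by positivity)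
    _ = ((B.card * Fintype.card (Listing n) * namings n (2 + 2 * Q.card) F.card : ℕ) : ℝ) := by
        push_cast
        ring
    _ ≤ _ := Nat.cast_le.2 hsum

end Instances

/-! ### Names of newly explored vertices -/

section Names

variable {n : ℕ} {a b : Name n}

theorem namings_anti (k : ℕ) {f f' : ℕ} (h : f ≤ f') : namings n k f' ≤ namings n k f :=
  Nat.descFactorial_le _ (by omega)

theorem namings_pos {k f : ℕ} (h : Fintype.card (Vertex n) + f ≤ 2 ^ (2 * n)) :
    0 < namings n k f := by
  rw [Nat.pos_iff_ne_zero, namings, ne_eq, Nat.descFactorial_eq_zero_iff_lt]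
  omega

/-- Two more vertices get names: every naming arises from a choice of two names in some order. -/
theorem namings_le {k f U : ℕ} (hk : k + 2 ≤ Fintype.card (Vertex n))
    (h : Fintype.card (Vertex n) + f ≤ 2 ^ (2 * n)) (hU : 2 ^ (2 * n) - k - f ≤ U) :
    namings n k f ≤ U.choose 2 * (2 * namings n (k + 2) f) := by
  obtain ⟨y, hy⟩ : ∃ y, 2 ^ (2 * n) - k - f = y + 2 := ⟨2 ^ (2 * n) - k - f - 2, by omega⟩
  obtain ⟨r, hr⟩ : ∃ r, Fintype.card (Vertex n) - k = r + 2 :=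
    ⟨Fintype.card (Vertex n) - k - 2, by omega⟩
  have h1 : namings n (k + 2) f = y.descFactorial r := by
    rw [namings]
    congr 1 <;> omega
  rw [namings, hy, hr, h1, Nat.succ_descFactorial_succ, Nat.succ_descFactorial_succ]
  have h2 : (y + 2).choose 2 * 2 = (y + 2) * (y + 1) := by
    rw [Nat.choose_two_right]
    exact Nat.div_mul_cancel (Nat.even_mul_pred_self (y + 2)).two_dvd
  calc (y + 1 + 1) * ((y + 1) * y.descFactorial r)
      = (y + 2).choose 2 * (2 * y.descFactorial r) := by
        rw [← mul_assoc, ← mul_assoc, h2]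
    _ ≤ _ := Nat.mul_le_mul_right _ (Nat.choose_le_choose 2 (by omega))

theorem IsState.insert_fail {Q : Finset ℕ} {z : ℕ → Name n} {F : Finset (Name n)} {u : Name n}
    (hS : IsState a b Q z F) (hu : u ∉ z '' known Q) : IsState a b Q z (insert u F) where
  closed := hS.closed
  injOn := hS.injOn
  start := hS.start
  finish := hS.finish
  ne w hw h hh := by
    rcases Finset.mem_insert.1 hw with rfl | hw
    · exact fun e => hu ⟨h, hh, e⟩
    · exact hS.ne w hw h hh

/-- The names after the exploration of `h`. -/
def extend (z : ℕ → Name n) (h : ℕ) (y y' : Name n) : ℕ → Name n :=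
  Function.update (Function.update z (2 * h) y) (2 * h + 1) y'

section Extend

variable {Q : Finset ℕ} {z : ℕ → Name n} {F : Finset (Name n)} {h : ℕ} {y y' : Name n}

theorem extend_left : extend z h y y' (2 * h) = y := by simp [extend]

theorem extend_right : extend z h y y' (2 * h + 1) = y' := by simp [extend]

theorem extend_of_known (hQ : Closed Q) (hh : h ∈ known Q) (hhQ : h ∉ Q) {g : ℕ}
    (hg : g ∈ known Q) : extend z h y y' g = z g := by
  have h2 := (hQ.closed_known h hh).1
  have : g / 2 ≠ h := by
    rintro rfl
    rcases mem_known.1 hg with rfl | rfl | h3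
    · omega
    · omega
    · exact hhQ h3
  rw [extend, Function.update_of_ne (by omega), Function.update_of_ne (by omega)]

theorem mem_known_insert {g : ℕ} :
    g ∈ known (insert h Q) ↔ g ∈ known Q ∨ g = 2 * h ∨ g = 2 * h + 1 := by
  simp only [mem_known, Finset.mem_insert]
  constructor
  · rintro (h | h | h | h)
    · exact .inl (.inl h)
    · exact .inl (.inr (.inl h))
    · exact .inr (by omega)
    · exact .inl (.inr (.inr h))
  · rintro ((h | h | h) | h)
    · exact .inl h
    · exact .inr (.inl h)
    · exact .inr (.inr (.inr h))
    · exact .inr (.inr (.inl (by omega)))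

theorem answer_congr {z z' : ℕ → Name n} {g : ℕ} (h1 : z (2 * g) = z' (2 * g))
    (h2 : z (2 * g + 1) = z' (2 * g + 1)) (h3 : 4 ≤ g → z (g / 2) = z' (g / 2)) :
    answer z g = answer z' g := by
  rw [answer, answer, h1, h2]
  split_ifs with h4
  · rw [h3 h4]
  · rfl

theorem answer_extend_of_mem (hQ : Closed Q) (hh : h ∈ known Q) (hhQ : h ∉ Q) {g : ℕ}
    (hg : g ∈ Q) : answer (extend z h y y') g = answer z g :=
  answer_congr (extend_of_known hQ hh hhQ (mem_known.2 (.inr (.inr (by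
      rwa [Nat.mul_div_cancel_left _ (by norm_num)])))))
    (extend_of_known hQ hh hhQ (mem_known.2 (.inr (.inr (by
      rwa [show (2 * g + 1) / 2 = g by omega])))))
    (fun h4 => extend_of_known hQ hh hhQ (hQ.subset_known ((hQ g hg).2 h4)))

theorem Closed.insert (hQ : Closed Q) (hh : h ∈ known Q) : Closed (insert h Q) := by
  intro g hg
  rcases Finset.mem_insert.1 hg with rfl | hg
  · refine ⟨(hQ.closed_known g hh).1, fun h4 => Finset.mem_insert_of_mem ?_⟩
    exact (hQ.four_le hh (by omega) (by omega)).2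
  · exact ⟨(hQ g hg).1, fun h4 => Finset.mem_insert_of_mem ((hQ g hg).2 h4)⟩

theorem IsState.extend (hS : IsState a b Q z F) (hh : h ∈ known Q) (hhQ : h ∉ Q) (hyy : y ≠ y')
    (hy : y ∉ z '' known Q) (hyF : y ∉ F) (hy' : y' ∉ z '' known Q) (hyF' : y' ∉ F) :
    IsState a b (insert h Q) (extend z h y y') F where
  closed := hS.closed.insert hh
  injOn := by
    intro g hg g' hg' e
    have key : ∀ g ∈ known Q, WeldedPath.extend z h y y' g = z g := fun g hg =>
      extend_of_known hS.closed hh hhQ hg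
    rcases mem_known_insert.1 hg with hg | rfl | rfl <;>
      rcases mem_known_insert.1 hg' with hg' | rfl | rfl
    · rw [key g hg, key g' hg'] at e
      exact hS.injOn hg hg' e
    · rw [key g hg, extend_left] at e
      exact (hy ⟨g, hg, e⟩).elim
    · rw [key g hg, extend_right] at e
      exact (hy' ⟨g, hg, e⟩).elim
    · rw [key g' hg', extend_left] at e
      exact (hy ⟨g', hg', e.symm⟩).elim
    · rfl
    · rw [extend_left, extend_right] at e
      exact (hyy e).elim
    · rw [key g' hg', extend_right] at e
      exact (hy' ⟨g', hg', e.symm⟩).elim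
    · rw [extend_left, extend_right] at e
      exact (hyy e.symm).elim
    · rfl
  start := by rw [extend_of_known hS.closed hh hhQ (mem_known.2 (.inl rfl)), hS.start]
  finish := by rw [extend_of_known hS.closed hh hhQ (mem_known.2 (.inr (.inl rfl))), hS.finish]
  ne u hu g hg := by
    rcases mem_known_insert.1 hg with hg | rfl | rfl
    · rw [extend_of_known hS.closed hh hhQ hg]
      exact hS.ne u hu g hg
    · rw [extend_left]
      rintro rfl
      exact hyF hu
    · rw [extend_right]
      rintro rfl
      exact hyF' hu

theorem Explored.of_extend [NeZero n] {I : Instance n a b} (hQ : Closed Q) (hh : h ∈ known Q)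
    (hhQ : h ∉ Q)
    (he : Explored I (insert h Q) (WeldedPath.extend z h y y') F) :
    Explored I Q z F ∧ I.oracle (z h) = some (answer (WeldedPath.extend z h y y') h) := by
  refine ⟨⟨fun g hg => ?_, he.oracle_fail⟩, ?_⟩
  · have := he.oracle_name g (Finset.mem_insert_of_mem hg)
    rwa [extend_of_known hQ hh hhQ (hQ.subset_known hg), answer_extend_of_mem hQ hh hhQ hg] at this
  · have := he.oracle_name h (Finset.mem_insert_self _ _)
    rwa [extend_of_known hQ hh hhQ hh] at this

theorem answer_extend (hQ : Closed Q) (hh : h ∈ known Q) (hhQ : h ∉ Q) :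
    answer (extend z h y y') h = {y, y'} ∪ if 4 ≤ h then {z (h / 2)} else ∅ := by
  rw [answer, extend_left, extend_right]
  split_ifs with h4
  · rw [extend_of_known hQ hh hhQ (hQ.subset_known (hQ.four_le hh (by omega) (by omega)).2)]
  · rfl

end Extend

end Names

/-! ### Following a query algorithm -/

section Run

variable {n : ℕ} [NeZero n] {a b : Name n} {m : ℕ}

/-- The set `X` of vertices contains the middle vertex, a vertex of degree at least `4`, or all
vertices of a cycle. -/
def FindsIn (I : Instance n a b) (X : Set (Vertex n)) : Prop :=
  middle n ∈ X ∨ (∃ v ∈ X, 4 ≤ (I.graph.neighborSet v).ncard) ∨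
    ∃ (v : Vertex n) (c : I.graph.Walk v v), c.IsCycle ∧ ∀ u ∈ c.support, u ∈ X

theorem FindsIn.mono {I : Instance n a b} {X Y : Set (Vertex n)} (h : FindsIn I X) (hXY : X ⊆ Y) :
    FindsIn I Y := by
  rcases h with h | ⟨v, hv, h⟩ | ⟨v, c, hc, h⟩
  · exact .inl (hXY h)
  · exact .inr (.inl ⟨v, hXY hv, h⟩)
  · exact .inr (.inr ⟨v, c, hc, fun u hu => hXY (h u hu)⟩)

/-- Neither does the algorithm output a path, nor do the vertices with names in `K`, together with
those that become known, contain something forbidden. -/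
def Fails (I : Instance n a b) (K : Set (Name n)) (A : QueryTree n) : Prop :=
  ¬ I.OutputsPath A ∧ ¬ FindsIn I {v | I.name v ∈ K ∨ I.name v ∈ A.seen I.oracle}

theorem Fails.query {I : Instance n a b} {K K' : Set (Name n)} {u : Name n}
    {next : Option (Finset (Name n)) → QueryTree n} {r : Option (Finset (Name n))}
    (h : Fails I K' (next r)) (hr : I.oracle u = r)
    (hK : ∀ x, I.name x = u ∨ I.name x ∈ r.getD ∅ ∨ I.name x ∈ K → I.name x ∈ K') :
    Fails I K (.query u next) := by
  subst hr
  refine ⟨h.1, fun hf => h.2 (hf.mono ?_)⟩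
  rintro x (hx | (hx | hx) | hx)
  · exact .inl (hK x (.inr (.inr hx)))
  · exact .inl (hK x (.inl hx))
  · exact .inl (hK x (.inr (.inl hx)))
  · exact .inr hx

/-- When the known part of the graph looks like a forest, an algorithm that outputs only known names
fails. -/
theorem Nice.fails_output {I : Instance n a b} {Q : Finset ℕ} {z : ℕ → Name n}
    {F : Finset (Name n)} (hQ : Closed Q) (h : Nice I Q z F) {l : List (Name n)}
    (hl : (∀ u ∈ l, u ∈ z '' known Q ∨ u ∈ F) ∨ ∃ u ∈ l, u ∈ F) :
    Fails I (z '' known Q) (.output l) := by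
  obtain ⟨he, v, hv, hz⟩ := h
  have hF : ∀ x, I.name x ∉ F := fun x hx => oracle_eq_none.1 (he.oracle_fail _ hx) x rfl
  have hvK : ∀ x, I.name x ∈ z '' known Q → ∃ h ∈ known Q, v h = x := by
    rintro x ⟨h, hh, e⟩
    exact ⟨h, hh, I.name.injective ((hz h hh).trans e)⟩
  have hmem : ∀ x : Vertex n, (I.name x ∈ z '' known Q ∨
      I.name x ∈ (QueryTree.output l).seen I.oracle) → ∃ h ∈ known Q, v h = x := by
    rintro x (hx | hx)
    · exact hvK x hx
    · exact hx.elim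
  constructor
  · rintro ⟨w, -, e⟩
    have e : l = w.support.map I.name := e
    rcases hl with hl | ⟨u, hu, huF⟩
    · refine hv.not_walk hQ.closed_known w fun x hx => ?_
      rcases hl (I.name x) (e ▸ List.mem_map_of_mem hx) with h | h
      · exact hvK x h
      · exact (hF x h).elim
    · rw [e] at hu
      obtain ⟨x, -, rfl⟩ := List.mem_map.1 hu
      exact hF x huF
  · rintro (hx | ⟨x, hx, h4⟩ | ⟨x, c, hc, hx⟩)
    · obtain ⟨h, hh, e⟩ := hmem _ hx
      exact hv.ne_middle h hh e
    · obtain ⟨h, hh, rfl⟩ := hmem _ hx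
      have := hv.ncard_le hh
      omega
    · exact hv.not_isCycle hQ.closed_known c hc fun u hu => hmem u (hx u hu)

open Classical in
/-- The instances compatible with a state for which the rest of the algorithm fails. -/
noncomputable def failing (a b : Name n) (Q : Finset ℕ) (z : ℕ → Name n) (F : Finset (Name n))
    (A : QueryTree n) : Finset (Instance n a b) :=
  Finset.univ.filter fun I => Explored I Q z F ∧ Fails I (z '' known Q) A

theorem mem_failing {Q : Finset ℕ} {z : ℕ → Name n} {F : Finset (Name n)} {A : QueryTree n}
    {I : Instance n a b} : I ∈ failing a b Q z F A ↔
      Explored I Q z F ∧ Fails I (z '' known Q) A := by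
  classical
  simp [failing]

/-- From every state an algorithm with few queries fails on most instances. The lower bound of
`card_nice` is made independent of `F` by excluding `q + 1` names from the start, which is as many
as the queries and the output can guess. Then it is preserved when a guess fails, and when a vertex
is explored it is the sum of the bounds for the possible pairs of new names. -/
theorem le_card_failing (hn : n = 2 * m) (hm : 1 ≤ m) {q : ℕ} {ε : ℝ} (hε : ε < 1)
    (hbad : ∀ k ≤ q, badBound m (6 + 4 * k) ≤ ε) (hq : 2 * (6 + 4 * q) < 2 ^ n)
    (hV : 6 + 4 * q ≤ Fintype.card (Vertex n))
    (hN : Fintype.card (Vertex n) + (q + 1) ≤ 2 ^ (2 * n)) (A : QueryTree n) :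
    ∀ (Q : Finset ℕ) (z : ℕ → Name n) (F : Finset (Name n)), IsState a b Q z F →
      Q.card + F.card ≤ q →
      (∀ I : Instance n a b, Explored I Q z F →
        Q.card + F.card + A.queryCount I.oracle ≤ q) →
      (1 - ε) * (Fintype.card (Welding n) * 2 ^ Q.card) *
        (Fintype.card (Listing n) * namings n (2 + 2 * Q.card) (q + 1)) ≤
      ((failing a b Q z F A).card : ℝ) := by
  classical
  have hWpos : (0 : ℝ) < Fintype.card (Welding n) := by exact_mod_cast Fintype.card_pos
  have hLpos : (0 : ℝ) < Fintype.card (Listing n) := by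
    have : Nonempty (Listing n) := ⟨(Fintype.equivFin _).symm⟩
    exact_mod_cast Fintype.card_pos
  -- the bound holds for the instances with a nice state
  have hnice : ∀ (Q : Finset ℕ) (z : ℕ → Name n) (F : Finset (Name n)), IsState a b Q z F →
      Q.card ≤ q → F.card ≤ q + 1 →
      (1 - ε) * (Fintype.card (Welding n) * 2 ^ Q.card) *
        (Fintype.card (Listing n) * namings n (2 + 2 * Q.card) (q + 1)) ≤
      (((Finset.univ : Finset (Instance n a b)).filter fun I => Nice I Q z F).card : ℝ) := by
    intro Q z F hS h1 h2
    refine le_trans ?_ (card_nice hn hm hS (by omega))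
    have h3 : (namings n (2 + 2 * Q.card) (q + 1) : ℝ) ≤ namings n (2 + 2 * Q.card) F.card := by
      exact_mod_cast namings_anti _ h2
    have h4 := hbad _ h1
    have h5 : 0 ≤ 1 - badBound m (6 + 4 * Q.card) := by linarith
    gcongr
  have hpos : ∀ k l : ℕ, 0 < (1 - ε) * (Fintype.card (Welding n) * 2 ^ k) *
      (Fintype.card (Listing n) * namings n l (q + 1)) := by
    intro k l
    have : (0 : ℝ) < namings n l (q + 1) := by exact_mod_cast namings_pos hN
    have : 0 < 1 - ε := by linarith
    positivity
  induction A with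
  | output l =>
    intro Q z F hS hc _
    obtain ⟨F', hS', hFF, hF', hl⟩ : ∃ F', IsState a b Q z F' ∧ F ⊆ F' ∧ F'.card ≤ q + 1 ∧
        ((∀ u ∈ l, u ∈ z '' known Q ∨ u ∈ F') ∨ ∃ u ∈ l, u ∈ F') := by
      by_cases hl : ∀ u ∈ l, u ∈ z '' known Q ∨ u ∈ F
      · exact ⟨F, hS, le_rfl, by omega, .inl hl⟩
      -- a new name in the output counts as one more guess
      · simp only [not_forall, not_or] at hl
        obtain ⟨u, hu, h1, h2⟩ := hl
        refine ⟨insert u F, hS.insert_fail h1, Finset.subset_insert _ _, ?_,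
          .inr ⟨u, hu, Finset.mem_insert_self _ _⟩⟩
        rw [Finset.card_insert_of_notMem h2]
        omega
    refine (hnice Q z F' hS' (by omega) hF').trans (Nat.cast_le.2 (Finset.card_le_card ?_))
    intro I hI
    have hI := (Finset.mem_filter.1 hI).2
    exact mem_failing.2 ⟨⟨hI.1.oracle_name, fun u hu => hI.1.oracle_fail u (hFF hu)⟩,
      hI.fails_output hS.closed hl⟩
  | query u next ih =>
    intro Q z F hS hc hcount
    -- some instance is compatible with the state, so a query is still allowed
    have hlt : Q.card + F.card + 1 ≤ q := by
      have h1 := hnice Q z F hS (by omega) (by omega)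
      have h2 : (0 : ℝ) < _ := (hpos Q.card (2 + 2 * Q.card)).trans_le h1
      rw [Nat.cast_pos, Finset.card_pos] at h2
      obtain ⟨I, hI⟩ := h2
      have := hcount I (Finset.mem_filter.1 hI).2.1
      simp only [QueryTree.queryCount] at this
      omega
    -- the remaining queries after a known answer
    have hrest : ∀ r (I : Instance n a b), Explored I Q z F → I.oracle u = r →
        Q.card + F.card + 1 + (next r).queryCount I.oracle ≤ q := by
      rintro r I hI rfl
      have := hcount I hI
      simp only [QueryTree.queryCount] at this
      omega
    -- queries whose answers are known do not change the state
    by_cases huF : u ∈ F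
    · refine (ih none Q z F hS hc fun I hI => ?_).trans (Nat.cast_le.2 (Finset.card_le_card ?_))
      · have := hrest none I hI (hI.oracle_fail u huF)
        omega
      · intro I hI
        obtain ⟨h1, h2⟩ := mem_failing.1 hI
        have h0 := h1.oracle_fail u huF
        refine mem_failing.2 ⟨h1, h2.query h0 ?_⟩
        rintro x (hx | hx | hx)
        · exact (oracle_eq_none.1 h0 x hx).elim
        · simp at hx
        · exact hx
    by_cases huK : u ∈ z '' known Q
    · obtain ⟨h, hh, rfl⟩ := huK
      have hh : h ∈ known Q := hh
      by_cases hhQ : h ∈ Q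
      · refine (ih (some (answer z h)) Q z F hS hc fun I hI => ?_).trans
          (Nat.cast_le.2 (Finset.card_le_card ?_))
        · have := hrest _ I hI (hI.oracle_name h hhQ)
          omega
        · intro I hI
          obtain ⟨h1, h2⟩ := mem_failing.1 hI
          refine mem_failing.2 ⟨h1, h2.query (h1.oracle_name h hhQ) ?_⟩
          rintro x (hx | hx | hx)
          · exact ⟨h, hh, hx.symm⟩
          · simp only [Option.getD_some, answer, Finset.mem_union, Finset.mem_insert,
              Finset.mem_singleton] at hx
            rcases hx with (hx | hx) | hx
            · exact ⟨2 * h, mem_known.2 (.inr (.inr (by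
                rwa [Nat.mul_div_cancel_left _ (by norm_num)]))), hx.symm⟩
            · exact ⟨2 * h + 1, mem_known.2 (.inr (.inr (by
                rwa [show (2 * h + 1) / 2 = h by omega]))), hx.symm⟩
            · split_ifs at hx with h4
              · exact ⟨h / 2, hS.closed.subset_known ((hS.closed h hhQ).2 h4),
                  (Finset.mem_singleton.1 hx).symm⟩
              · simp at hx
          · exact hx
      -- a new vertex is explored: two new names become known
      · set U : Finset (Name n) := ((known Q).image z ∪ F)ᶜ with hU
        have hUmem : ∀ y, y ∈ U ↔ y ∉ z '' known Q ∧ y ∉ F := by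
          intro y
          simp [hU]
        have hUcard : U.card = 2 ^ (2 * n) - (2 + 2 * Q.card) - F.card := by
          rw [hU, Finset.card_compl, card_name n, Finset.card_union_of_disjoint,
            Finset.card_image_of_injOn hS.injOn, hS.closed.card_known, Nat.sub_sub]
          rw [Finset.disjoint_left]
          intro y hy hyF
          obtain ⟨g, hg, rfl⟩ := Finset.mem_image.1 hy
          exact hS.ne _ hyF g hg rfl
        have hpair : ∀ P ∈ U.powersetCard 2, ∃ p : Name n × Name n, p.1 ≠ p.2 ∧ P = {p.1, p.2} := by
          intro P hP
          obtain ⟨y, y', h1, h2⟩ := Finset.card_eq_two.1 (Finset.mem_powersetCard.1 hP).2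
          exact ⟨(y, y'), h1, h2⟩
        choose! p hp1 hp2 using hpair
        set zP : Finset (Name n) → ℕ → Name n := fun P => extend z h (p P).1 (p P).2 with hzP
        set S : Finset (Name n) → Finset (Instance n a b) := fun P =>
          failing a b (insert h Q) (zP P) F (next (some (answer (zP P) h))) with hSdef
        have hcardQ : (insert h Q).card = Q.card + 1 := Finset.card_insert_of_notMem hhQ
        have hS1 : ∀ P ∈ U.powersetCard 2,
            (1 - ε) * (Fintype.card (Welding n) * 2 ^ (Q.card + 1)) *
              (Fintype.card (Listing n) * namings n (2 + 2 * Q.card + 2) (q + 1)) ≤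
            ((S P).card : ℝ) := by
          intro P hP
          have hPU := (Finset.mem_powersetCard.1 hP).1
          have h1 := (hUmem _).1 (hPU ((Finset.ext_iff.1 (hp2 P hP) (p P).1).2 (by simp)))
          have h2 := (hUmem _).1 (hPU ((Finset.ext_iff.1 (hp2 P hP) (p P).2).2 (by simp)))
          have hS' : IsState a b (insert h Q) (zP P) F :=
            hS.extend hh hhQ (hp1 P hP) h1.1 h1.2 h2.1 h2.2
          have := ih (some (answer (zP P) h)) (insert h Q) (zP P) F hS' (by omega) (by
            intro I hI
            obtain ⟨h3, h4⟩ := hI.of_extend hS.closed hh hhQ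
            have := hrest (some (answer (zP P) h)) I h3 h4
            omega)
          rw [hcardQ, show 2 + 2 * (Q.card + 1) = 2 + 2 * Q.card + 2 by ring] at this
          exact this
        have hsub : (U.powersetCard 2).biUnion S ⊆ failing a b Q z F (.query (z h) next) := by
          intro I hI
          obtain ⟨P, hP, hI⟩ := Finset.mem_biUnion.1 hI
          obtain ⟨h1, h2⟩ := mem_failing.1 hI
          obtain ⟨h3, h4⟩ := h1.of_extend hS.closed hh hhQ
          have hKK : ∀ g ∈ known Q, z g ∈ zP P '' known (insert h Q) := fun g hg =>
            ⟨g, mem_known_insert.2 (.inl hg), extend_of_known hS.closed hh hhQ hg⟩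
          refine mem_failing.2 ⟨h3, h2.query h4 ?_⟩
          rintro x (hx | hx | ⟨g, hg, hx⟩)
          · rw [hx]
            exact hKK h hh
          · rw [Option.getD_some] at hx
            simp only [answer, Finset.mem_union, Finset.mem_insert, Finset.mem_singleton] at hx
            rcases hx with (hx | hx) | hx
            · exact ⟨2 * h, mem_known_insert.2 (.inr (.inl rfl)), hx.symm⟩
            · exact ⟨2 * h + 1, mem_known_insert.2 (.inr (.inr rfl)), hx.symm⟩
            · split_ifs at hx with h5
              · refine ⟨h / 2, mem_known_insert.2 (.inl (hS.closed.subset_known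
                  (hS.closed.four_le hh (by omega) (by omega)).2)),
                  (Finset.mem_singleton.1 hx).symm⟩
              · simp at hx
          · rw [← hx]
            exact hKK g hg
        have hdisj : ∀ P ∈ U.powersetCard 2, ∀ P' ∈ U.powersetCard 2, P ≠ P' →
            Disjoint (S P) (S P') := by
          intro P hP P' hP' hne
          rw [Finset.disjoint_left]
          intro I hI hI'
          apply hne
          have h1 := ((mem_failing.1 hI).1.of_extend hS.closed hh hhQ).2
          have h2 := ((mem_failing.1 hI').1.of_extend hS.closed hh hhQ).2
          have h3 := h1.symm.trans h2
          rw [answer_extend hS.closed hh hhQ, answer_extend hS.closed hh hhQ, ← hp2 P hP,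
            ← hp2 P' hP', Option.some.injEq] at h3
          -- the new names are those in the answer that were unknown before
          have key : ∀ P ∈ U.powersetCard 2,
              (P ∪ if 4 ≤ h then {z (h / 2)} else ∅) ∩ U = P := by
            intro P hP
            have hPU := (Finset.mem_powersetCard.1 hP).1
            ext y
            rw [Finset.mem_inter, Finset.mem_union]
            constructor
            · rintro ⟨hy | hy, hyU⟩
              · exact hy
              · split_ifs at hy with h5
                · rw [Finset.mem_singleton.1 hy] at hyU
                  exact absurd ⟨h / 2, hS.closed.subset_known
                    (hS.closed.four_le hh (by omega) (by omega)).2, rfl⟩ ((hUmem _).1 hyU).1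
                · simp at hy
            · exact fun hy => ⟨.inl hy, hPU hy⟩
          rw [← key P hP, h3, key P' hP']
        have hnam := namings_le (n := n) (k := 2 + 2 * Q.card) (f := q + 1) (U := U.card)
          (by omega) hN (by omega)
        have hnam' : (namings n (2 + 2 * Q.card) (q + 1) : ℝ) ≤
            U.card.choose 2 * (2 * namings n (2 + 2 * Q.card + 2) (q + 1)) := by
          exact_mod_cast hnam
        have hε' : 0 ≤ 1 - ε := by linarith
        calc _ ≤ (1 - ε) * (Fintype.card (Welding n) * 2 ^ Q.card) *
              (Fintype.card (Listing n) * (U.card.choose 2 *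
                (2 * namings n (2 + 2 * Q.card + 2) (q + 1)))) := by gcongr
          _ = U.card.choose 2 * ((1 - ε) * (Fintype.card (Welding n) * 2 ^ (Q.card + 1)) *
              (Fintype.card (Listing n) * namings n (2 + 2 * Q.card + 2) (q + 1))) := by
              ring
          _ ≤ ∑ P ∈ U.powersetCard 2, ((S P).card : ℝ) := by
              have := Finset.card_nsmul_le_sum _ _ _ hS1
              rwa [Finset.card_powersetCard, nsmul_eq_mul] at this
          _ = (((U.powersetCard 2).biUnion S).card : ℝ) := by
              rw [Finset.card_biUnion hdisj]
              push_cast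
              rfl
          _ ≤ _ := Nat.cast_le.2 (Finset.card_le_card hsub)
    -- an unknown name is assumed to be unused
    · have hcard : (insert u F).card = F.card + 1 := Finset.card_insert_of_notMem huF
      refine (ih none Q z (insert u F) (hS.insert_fail huK) (by omega) fun I hI => ?_).trans
        (Nat.cast_le.2 (Finset.card_le_card ?_))
      · have h1 : Explored I Q z F :=
          ⟨hI.oracle_name, fun w hw => hI.oracle_fail w (Finset.mem_insert_of_mem hw)⟩
        have := hrest none I h1 (hI.oracle_fail u (Finset.mem_insert_self _ _))
        omega
      · intro I hI
        obtain ⟨h1, h2⟩ := mem_failing.1 hI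
        have h0 := h1.oracle_fail u (Finset.mem_insert_self _ _)
        refine mem_failing.2 ⟨⟨h1.oracle_name, fun w hw =>
          h1.oracle_fail w (Finset.mem_insert_of_mem hw)⟩, h2.query h0 ?_⟩
        rintro x (hx | hx | hx)
        · exact (oracle_eq_none.1 h0 x hx).elim
        · simp at hx
        · exact hx

end Run

/-! ### Numerical estimates -/

/-- The disjoint parts of the vertex set. -/
def vertexEquiv (n : ℕ) :
    Vertex n ≃ Fin n ⊕ (Fin n × Node n) ⊕ (Fin n × Node n) ⊕ Spoke n ⊕ Spoke n where
  toFun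
    | .path i => .inl i
    | .left i h => .inr (.inl (i, h))
    | .right i h => .inr (.inr (.inl (i, h)))
    | .inner e => .inr (.inr (.inr (.inl e)))
    | .outer e => .inr (.inr (.inr (.inr e)))
  invFun
    | .inl i => .path i
    | .inr (.inl p) => .left p.1 p.2
    | .inr (.inr (.inl p)) => .right p.1 p.2
    | .inr (.inr (.inr (.inl e))) => .inner e
    | .inr (.inr (.inr (.inr e))) => .outer e
  left_inv v := by cases v <;> rfl
  right_inv v := by rcases v with _ | _ | _ | _ | _ <;> rfl

theorem card_spoke_le (n : ℕ) : Fintype.card (Spoke n) ≤ n * (n + 1) := by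
  rw [Fintype.card_sigma]
  calc ∑ i : Fin n, Fintype.card (Fin ((i : ℕ) + 2)) ≤ ∑ _i : Fin n, (n + 1) :=
        Finset.sum_le_sum fun i _ => by
          rw [Fintype.card_fin]
          omega
    _ = n * (n + 1) := by simp

theorem card_vertex (n : ℕ) : Fintype.card (Vertex n) =
    n + 2 * (n * (2 ^ (n + 1) - 1)) + 2 * Fintype.card (Spoke n) := by
  rw [Fintype.card_congr (vertexEquiv n)]
  simp only [Fintype.card_sum, Fintype.card_prod, Fintype.card_fin, Fintype.card_coe,
    Nat.card_Ico]
  ring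

theorem card_vertex_le (n : ℕ) : Fintype.card (Vertex n) ≤ 8 * n * 2 ^ n := by
  have h1 := card_spoke_le n
  have h2 : n + 1 ≤ 2 ^ n := Nat.lt_two_pow_self
  have h3 : n * (2 ^ (n + 1) - 1) ≤ n * (2 * 2 ^ n) :=
    Nat.mul_le_mul_left _ (by rw [pow_succ]; omega)
  have h4 : n * (n + 1) ≤ n * 2 ^ n := Nat.mul_le_mul_left _ h2
  rw [card_vertex]
  nlinarith

theorem le_card_vertex {n : ℕ} (hn : 0 < n) : 2 ^ n ≤ Fintype.card (Vertex n) := by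
  have h1 : 1 * (2 ^ (n + 1) - 1) ≤ n * (2 ^ (n + 1) - 1) := Nat.mul_le_mul_right _ hn
  rw [card_vertex]
  rw [pow_succ] at *
  omega

/-- Lowering the base of a falling factorial by `1` costs a factor of at least
`1 - r / (D + 1)`; these losses add up at most. -/
theorem descFactorial_sub_le (D f r : ℕ) :
    (1 - f * (r / (D + 1) : ℝ)) * ((D + f).descFactorial r : ℝ) ≤ D.descFactorial r := by
  set s : ℝ := r / (D + 1) with hs
  have hs0 : 0 ≤ s := by positivity
  induction f with
  | zero => simp
  | succ f ih =>
    have hstep : (1 - s) * ((D + f + 1).descFactorial r : ℝ) ≤ (D + f).descFactorial r := by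
      have h0 : (0 : ℝ) < D + f + 1 := by positivity
      have h1 : ((D + f + 1 : ℝ) - r) * ((D + f + 1).descFactorial r : ℝ) ≤
          (D + f + 1) * (D + f).descFactorial r := by
        rcases le_total r (D + f + 1) with h | h
        · have := Nat.succ_descFactorial (D + f) r
          have h2 : (((D + f + 1 - r) * (D + f + 1).descFactorial r : ℕ) : ℝ) =
            (((D + f + 1) * (D + f).descFactorial r : ℕ) : ℝ) := by exact_mod_cast this
          push_cast [Nat.cast_sub h] at h2
          exact h2.le
        · have h' : ((D : ℝ) + f + 1) ≤ r := by exact_mod_cast h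
          exact (mul_nonpos_of_nonpos_of_nonneg (by linarith) (by positivity)).trans
            (by positivity)
      have h2 : (D + f + 1 : ℝ) * (1 - s) ≤ (D + f + 1 : ℝ) - r := by
        have h3 : (r : ℝ) = (D + 1) * s := by
          rw [hs]
          field_simp
        nlinarith [mul_nonneg (Nat.cast_nonneg (α := ℝ) f) hs0]
      have h3 := mul_le_mul_of_nonneg_right h2
        (Nat.cast_nonneg (α := ℝ) ((D + f + 1).descFactorial r))
      refine le_of_mul_le_mul_left ?_ h0
      linarith
    rw [← add_assoc]
    push_cast
    have hX : (0 : ℝ) ≤ ((D + f + 1).descFactorial r : ℝ) := by positivity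
    rcases le_total 0 (1 - f * s) with h | h
    · calc _ ≤ (1 - f * s) * ((1 - s) * ((D + f + 1).descFactorial r : ℝ)) := by
            rw [← mul_assoc]
            refine mul_le_mul_of_nonneg_right ?_ hX
            have : 0 ≤ f * s * s := by positivity
            nlinarith
        _ ≤ (1 - f * s) * ((D + f).descFactorial r : ℝ) := mul_le_mul_of_nonneg_left hstep h
        _ ≤ _ := ih
    · exact (mul_nonpos_of_nonpos_of_nonneg (by linarith) hX).trans (by positivity)

/-- The error of one state in terms of `Y = 2 ^ (n / 6)`. -/
theorem badBound_le {m t : ℕ} {Y : ℝ} (hm : 1 ≤ m) (hY : 152 ≤ Y) (hYm : (2 : ℝ) ^ m = Y ^ 3)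
    (ht : (t : ℝ) ≤ 5 * Y) : badBound m t ≤ 101 / Y := by
  have hY0 : 0 < Y := by linarith
  have ht0 : (0 : ℝ) ≤ t := by positivity
  have h1 : (t : ℝ) / 2 ^ (m - 1) ≤ 1 / Y := by
    have h2 : (2 : ℝ) ^ (m - 1) = Y ^ 3 / 2 := by
      rw [← hYm, eq_div_iff two_ne_zero, ← pow_succ, Nat.sub_add_cancel hm]
    rw [h2, div_le_div_iff₀ (by positivity) hY0]
    nlinarith [mul_le_mul_of_nonneg_right ht hY0.le, pow_pos hY0 2]
  have h2 : (t : ℝ) ^ 2 * (2 ^ m + 4 * t + 1) / (2 ^ (2 * m) - t) ≤ 100 / Y := by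
    have hY2 : 152 * Y ≤ Y ^ 2 := by nlinarith
    have hY3 : 152 * Y ^ 2 ≤ Y ^ 3 := by nlinarith [pow_pos hY0 2]
    have hY6 : Y ^ 3 * 1 ≤ Y ^ 3 * Y ^ 3 :=
      mul_le_mul_of_nonneg_left (by nlinarith) (by positivity)
    have h3 : (2 : ℝ) ^ (2 * m) = Y ^ 6 := by
      rw [mul_comm, pow_mul, hYm, ← pow_mul]
    have h4 : Y ^ 6 / 2 ≤ Y ^ 6 - t := by
      have : Y ^ 6 = Y ^ 3 * Y ^ 3 := by ring
      nlinarith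
    have h5 : (t : ℝ) ^ 2 ≤ 25 * Y ^ 2 := by nlinarith
    have h6 : Y ^ 3 + 4 * t + 1 ≤ 2 * Y ^ 3 := by nlinarith
    rw [h3, hYm]
    calc _ ≤ 25 * Y ^ 2 * (2 * Y ^ 3) / (Y ^ 6 / 2) := by gcongr
      _ = 100 / Y := by
        field_simp
        norm_num
  rw [badBound]
  calc _ ≤ 1 / Y + 100 / Y := add_le_add h1 h2
    _ = 101 / Y := by ring

/-- Forbidding a few more names hardly changes the number of namings. -/
theorem mul_namings_le {n q : ℕ} {Y : ℝ} (hY : 152 ≤ Y) (hq : (q : ℝ) ≤ Y)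
    (hYN : (2 : ℝ) ^ (2 * n) = Y ^ 12) (hV : (Fintype.card (Vertex n) : ℝ) ≤ Y ^ 7) :
    (1 - 1 / Y) * (namings n 2 0 : ℝ) ≤ namings n 2 (q + 1) := by
  have hY0 : 0 < Y := by linarith
  have hY4 : (152 : ℝ) ^ 3 ≤ Y ^ 3 := pow_le_pow_left₀ (by norm_num) hY 3
  have hY11 : (1 : ℝ) ≤ Y ^ 11 := one_le_pow₀ (by linarith)
  have hY12 : Y ≤ Y ^ 12 / 152 := by
    have h : (152 : ℝ) ≤ Y ^ 11 := by
      calc (152 : ℝ) ≤ Y ^ 1 := by rwa [pow_one]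
        _ ≤ Y ^ 11 := pow_le_pow_right₀ (by linarith) (by norm_num)
    have h' := mul_le_mul_of_nonneg_left h hY0.le
    rw [le_div_iff₀ (by norm_num)]
    calc Y * 152 ≤ Y * Y ^ 11 := h'
      _ = Y ^ 12 := by ring
  have hN : q + 3 ≤ 2 ^ (2 * n) := by
    have : ((q + 3 : ℕ) : ℝ) ≤ ((2 ^ (2 * n) : ℕ) : ℝ) := by
      push_cast
      rw [hYN]
      linarith
    exact_mod_cast this
  obtain ⟨D, hD⟩ : ∃ D, 2 ^ (2 * n) - 2 = D + (q + 1) :=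
    ⟨2 ^ (2 * n) - 2 - (q + 1), by omega⟩
  have hDR : Y ^ 12 / 2 ≤ (D : ℝ) + 1 := by
    have h1 : 2 ^ (2 * n) = D + q + 3 := by omega
    have h2 : (2 : ℝ) ^ (2 * n) = D + q + 3 := by exact_mod_cast h1
    rw [hYN] at h2
    linarith
  have h1 := descFactorial_sub_le D (q + 1) (Fintype.card (Vertex n) - 2)
  rw [namings, namings, hD, Nat.sub_zero, Nat.add_sub_cancel]
  refine le_trans (mul_le_mul_of_nonneg_right ?_ (Nat.cast_nonneg _)) h1
  have h2 : ((Fintype.card (Vertex n) - 2 : ℕ) : ℝ) ≤ Y ^ 7 :=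
    (Nat.cast_le.2 (Nat.sub_le _ 2)).trans hV
  have h3 : ((q + 1 : ℕ) : ℝ) ≤ 2 * Y := by
    push_cast
    linarith
  have h4 : ((q + 1 : ℕ) : ℝ) * (((Fintype.card (Vertex n) - 2 : ℕ) : ℝ) / ((D : ℝ) + 1)) ≤
      2 * Y * (Y ^ 7 / (Y ^ 12 / 2)) := by
    gcongr
  have h5 : 2 * Y * (Y ^ 7 / (Y ^ 12 / 2)) ≤ 1 / Y := by
    have h6 : 2 * Y * (Y ^ 7 / (Y ^ 12 / 2)) = 4 / Y ^ 4 := by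
      field_simp
      norm_num
    rw [h6, div_le_div_iff₀ (by positivity) hY0]
    nlinarith
  linarith

/-! ### The success probability -/

section Final

variable {n : ℕ} [NeZero n] {a b : Name n}

/-- The two ways in which a deterministic algorithm can succeed happen on few instances. -/
theorem card_success_le (hn : Even n) (hab : a ≠ b) {A : QueryTree n}
    (hA : ∀ I : Instance n a b, (A.queryCount I.oracle : ℝ) ≤ (2 : ℝ) ^ ((n : ℝ) / 6))
    {E : Instance n a b → Prop} (hE : ∀ I, E I → I.OutputsPath A ∨ I.Finds A) :
    (Nat.card {I : Instance n a b // E I} : ℝ) ≤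
      2 * ((n : ℝ) + 1) * 4 * (2 : ℝ) ^ (-((n : ℝ) / 6)) * Nat.card (Instance n a b) := by
  classical
  set Y : ℝ := (2 : ℝ) ^ ((n : ℝ) / 6) with hY
  have hY0 : 0 < Y := by positivity
  rw [Real.rpow_neg (by norm_num), ← hY, Nat.card_eq_fintype_card, Nat.card_eq_fintype_card,
    Fintype.card_subtype]
  have htriv : ((Finset.univ.filter E).card : ℝ) ≤ Fintype.card (Instance n a b) := by
    exact_mod_cast Finset.card_le_univ _
  set C : ℝ := (Fintype.card (Instance n a b) : ℝ) with hC
  have hC0 : 0 ≤ C := by positivity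
  -- for small `n` the bound exceeds `1`
  rcases lt_or_ge Y (8 * (n + 1)) with hYn | hYn
  · refine htriv.trans (le_mul_of_one_le_left hC0 ?_)
    rw [← div_eq_mul_inv, one_le_div hY0]
    linarith
  have hpow : ∀ k l : ℕ, n * k = 6 * l → Y ^ k = 2 ^ l := by
    intro k l h
    rw [hY, ← Real.rpow_natCast, ← Real.rpow_mul (by norm_num), ← Real.rpow_natCast]
    congr 1
    have : (n : ℝ) * k = 6 * l := by exact_mod_cast h
    linarith
  have hn18 : 18 ≤ n := by
    by_contra h
    have h1 : Y ≤ (2 : ℝ) ^ (3 : ℝ) := Real.rpow_le_rpow_of_exponent_le (by norm_num) (by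
      have : (n : ℝ) ≤ 18 := by exact_mod_cast (by omega : n ≤ 18)
      linarith)
    have h2 : (1 : ℝ) ≤ n := by exact_mod_cast NeZero.pos n
    norm_num at h1
    linarith
  have hnR : (18 : ℝ) ≤ n := by exact_mod_cast hn18
  -- `152 = 8 * (18 + 1)`
  have hY152 : 152 ≤ Y := by linarith
  obtain ⟨m, hm⟩ := hn.exists_two_nsmul
  rw [smul_eq_mul] at hm
  have hYm : (2 : ℝ) ^ m = Y ^ 3 := (hpow 3 m (by omega)).symm
  have hYn6 : (2 : ℝ) ^ n = Y ^ 6 := (hpow 6 n (by omega)).symm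
  have hYN : (2 : ℝ) ^ (2 * n) = Y ^ 12 := (hpow 12 (2 * n) (by omega)).symm
  set q := ⌊Y⌋₊ with hq
  have hqY : (q : ℝ) ≤ Y := Nat.floor_le hY0.le
  set V := Fintype.card (Vertex n) with hV
  have hVY : (V : ℝ) + 8 * Y ^ 6 ≤ Y ^ 7 := by
    have h1 : (V : ℝ) ≤ 8 * n * 2 ^ n := by exact_mod_cast card_vertex_le n
    rw [hYn6] at h1
    have h2 := mul_le_mul_of_nonneg_right hYn (pow_pos hY0 6).le
    calc (V : ℝ) + 8 * Y ^ 6 ≤ 8 * (n + 1) * Y ^ 6 := by linarith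
      _ ≤ Y * Y ^ 6 := h2
      _ = Y ^ 7 := by ring
  have hY6 : Y * 152 ^ 5 ≤ Y ^ 6 := by
    have : (152 : ℝ) ^ 5 ≤ Y ^ 5 := pow_le_pow_left₀ (by norm_num) hY152 5
    calc Y * 152 ^ 5 ≤ Y * Y ^ 5 := mul_le_mul_of_nonneg_left this hY0.le
      _ = Y ^ 6 := by ring
  have hY12 : Y ^ 7 * 152 ^ 5 ≤ Y ^ 12 := by
    have : (152 : ℝ) ^ 5 ≤ Y ^ 5 := pow_le_pow_left₀ (by norm_num) hY152 5
    calc Y ^ 7 * 152 ^ 5 ≤ Y ^ 7 * Y ^ 5 := mul_le_mul_of_nonneg_left this (by positivity)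
      _ = Y ^ 12 := by ring
  have hN : V + (q + 1) ≤ 2 ^ (2 * n) := by
    have : (V : ℝ) + (q + 1) ≤ 2 ^ (2 * n) := by
      rw [hYN]
      linarith
    exact_mod_cast this
  have hVq : 6 + 4 * q ≤ V := by
    have h1 : ((6 + 4 * q : ℕ) : ℝ) ≤ ((2 ^ n : ℕ) : ℝ) := by
      push_cast
      rw [hYn6]
      linarith
    exact (Nat.cast_le.1 h1).trans (le_card_vertex (NeZero.pos n))
  have hq2 : 2 * (6 + 4 * q) < 2 ^ n := by
    have : (2 * (6 + 4 * q) : ℝ) < 2 ^ n := by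
      rw [hYn6]
      linarith
    exact_mod_cast this
  have hε : 101 / Y < 1 := by
    rw [div_lt_one hY0]
    linarith
  -- the state before the first query
  set z : ℕ → Name n := fun h => if h = 2 then a else b with hz
  have hknown : ∀ h, h ∈ known ∅ ↔ h = 2 ∨ h = 3 := fun h => by simp [mem_known]
  have hS : IsState a b ∅ z ∅ := by
    refine ⟨fun h hh => absurd hh (Finset.notMem_empty h), ?_, by simp [hz], by simp [hz], by simp⟩
    intro h hh h' hh' e
    rcases (hknown h).1 hh with rfl | rfl <;> rcases (hknown h').1 hh' with rfl | rfl
    · rfl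
    · simp [hz, hab] at e
    · simp [hz, hab.symm] at e
    · rfl
  have hfail := le_card_failing (m := m) hm (by omega) (q := q) hε (fun k hk =>
    badBound_le (by omega) hY152 hYm (by
      have : (k : ℝ) ≤ q := by exact_mod_cast hk
      push_cast
      linarith)) hq2 hVq hN A ∅ z ∅ hS (by simp) (fun I _ => by
      simpa using Nat.le_floor (hA I))
  have hinst : C ≤ Fintype.card (Welding n) * Fintype.card (Listing n) * namings n 2 0 := by
    rw [hC]
    exact_mod_cast card_instance_le (n := n) (a := a) (b := b) (by omega) hab
  have hnam := mul_namings_le (n := n) hY152 hqY hYN (by linarith [pow_pos hY0 6])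
  -- the loss is `101 / Y` for bad placements and `1 / Y` for guessed names
  have hgood : (1 - 102 / Y) * C ≤ ((failing a b ∅ z ∅ A).card : ℝ) := by
    refine le_trans ?_ hfail
    have h0 : (0 : ℝ) ≤ 1 - 101 / Y := by linarith
    have h1 : (1 - 102 / Y) ≤ (1 - 101 / Y) * (1 - 1 / Y) := by
      have : 0 ≤ 101 / Y * (1 / Y) := by positivity
      have e : 102 / Y = 101 / Y + 1 / Y := by ring
      nlinarith
    have h2 : (0 : ℝ) ≤ (1 - 101 / Y) * (1 - 1 / Y) := by
      refine mul_nonneg h0 ?_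
      have : 1 / Y ≤ 101 / Y := by gcongr; norm_num
      linarith
    calc (1 - 102 / Y) * C ≤ (1 - 101 / Y) * (1 - 1 / Y) * C := mul_le_mul_of_nonneg_right h1 hC0
      _ ≤ (1 - 101 / Y) * (1 - 1 / Y) *
          (Fintype.card (Welding n) * Fintype.card (Listing n) * namings n 2 0) :=
        mul_le_mul_of_nonneg_left hinst h2
      _ = (1 - 101 / Y) * (Fintype.card (Welding n) * Fintype.card (Listing n)) *
          ((1 - 1 / Y) * namings n 2 0) := by ring
      _ ≤ (1 - 101 / Y) * (Fintype.card (Welding n) * Fintype.card (Listing n)) *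
          namings n 2 (q + 1) := mul_le_mul_of_nonneg_left hnam (by positivity)
      _ = _ := by
        simp only [Finset.card_empty, pow_zero, mul_zero, add_zero, mul_one]
        ring
  have hdisj : Disjoint (Finset.univ.filter E) (failing a b ∅ z ∅ A) := by
    rw [Finset.disjoint_left]
    intro I hI hI'
    have h1 := (mem_failing.1 hI').2
    rcases hE I (Finset.mem_filter.1 hI).2 with h | h
    · exact h1.1 h
    · refine h1.2 (FindsIn.mono (X := I.visited A) h ?_)
      rintro v (hv | hv | hv)
      · exact .inl ⟨2, (hknown 2).2 (.inl rfl), by simp [hz, hv]⟩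
      · exact .inl ⟨3, (hknown 3).2 (.inr rfl), by simp [hz, hv]⟩
      · exact .inr hv
  have hsum : ((Finset.univ.filter E).card : ℝ) + ((failing a b ∅ z ∅ A).card : ℝ) ≤ C := by
    rw [hC, ← Nat.cast_add, ← Finset.card_union_of_disjoint hdisj]
    exact_mod_cast Finset.card_le_univ _
  calc ((Finset.univ.filter E).card : ℝ) ≤ 102 / Y * C := by linarith
    _ ≤ 2 * (n + 1) * 4 * Y⁻¹ * C := by
      refine mul_le_mul_of_nonneg_right ?_ hC0
      rw [div_eq_mul_inv]
      exact mul_le_mul_of_nonneg_right (by linarith) (by positivity)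

/-- A randomized algorithm is an average of deterministic ones. -/
theorem prob_le {R : PMF (QueryTree n)} {E : Instance n a b → QueryTree n → Prop} {β : ℝ}
    (h : ∀ A ∈ R.support, (Nat.card {I : Instance n a b // E I A} : ℝ) ≤
      β * Nat.card (Instance n a b)) (hβ : 0 ≤ β) : prob R E ≤ ENNReal.ofReal β := by
  calc prob R E ≤ ∑' A, R A * ENNReal.ofReal β := by
        refine ENNReal.tsum_le_tsum fun A => ?_
        by_cases hA : A ∈ R.support
        · refine mul_le_mul_right ?_ _
          refine ENNReal.div_le_of_le_mul ?_
          have := ENNReal.ofReal_le_ofReal (h A hA)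
          rwa [ENNReal.ofReal_mul hβ, ENNReal.ofReal_natCast, ENNReal.ofReal_natCast] at this
        · rw [PMF.mem_support_iff, not_not] at hA
          simp [hA]
    _ = ENNReal.ofReal β := by rw [ENNReal.tsum_mul_right, PMF.tsum_coe, one_mul]

end Final

end WeldedPath

theorem mainTheorem2 (n : ℕ) [NeZero n] (hn : Even n)
    (hroom : Fintype.card (WeldedPath.Vertex n) ≤ 2 ^ (2 * n))
    (a b : WeldedPath.Name n) (hab : a ≠ b)
    (R : PMF (WeldedPath.QueryTree n))
    (hR : ∀ A ∈ R.support, ∀ I : WeldedPath.Instance n a b,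
      (A.queryCount I.oracle : ℝ) ≤ (2 : ℝ) ^ ((n : ℝ) / 6)) :
    WeldedPath.prob R (fun (I : WeldedPath.Instance n a b) A => I.OutputsPath A) ≤
        ENNReal.ofReal (2 * ((n : ℝ) + 1) * 4 * (2 : ℝ) ^ (-((n : ℝ) / 6))) ∧
      WeldedPath.prob R (fun (I : WeldedPath.Instance n a b) A => I.Finds A) ≤
        ENNReal.ofReal (2 * ((n : ℝ) + 1) * 4 * (2 : ℝ) ^ (-((n : ℝ) / 6))) :=
  ⟨WeldedPath.prob_le (fun A hA =>
      WeldedPath.card_success_le hn hab (hR A hA) fun _ => Or.inl) (by positivity),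
    WeldedPath.prob_le (fun A hA =>
      WeldedPath.card_success_le hn hab (hR A hA) fun _ => Or.inr) (by positivity)⟩
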